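/- **Background flow.** Let $\gamma>1$, $\zeta_0>1$, $S_0>0$, $J>0$. Put $u_s=(\gamma S_0J^{\gamma-1})^{1/(\gamma+1)}$, $\bar u_I=\zeta_0u_s$, $\bar\rho_I=J/\bar u_I$, and $$H(u)=\int_{u_s}^{u}\frac{J}{\bar u_I t^{\gamma+1}}\,(t^{\gamma+1}-u_s^{\gamma+1})(\bar u_I-t)\,dt,\qquad \mathcal T_{\rm acc}=\{(u,E):u>0,\ \tfrac12E^2=H(u),\ (u-u_s)E\ge 0\}.$$ For $E_0<0$ let $u_0$ be the number with $(u_0,E_0)\in\mathcal T_{\rm acc}$ (then $0<u_0<u_s$), and let $(\bar u,\bar E)$ be the smooth solution on $[0,\ell_{\max})$ of $$(\bar u^{\gamma+1}-u_s^{\gamma+1})\,\bar u'=\bar E\,\bar u^{\gamma},\qquad \bar E'=\frac{J}{\bar u}-\bar\rho_I,\qquad (\bar u,\bar E)(0)=(u_0,E_0),$$ where $\ell_{\max}$ is the maximal length with $\bar u>0$ and $\bar u'>0$ on $[0,\ell_{\max})$ and $\bar u'(x)\to0$ as $x\to\ell_{\max}-$. Put $\bar\rho=J/\bar u$ and $\bar\Phi(x_1)=\int_0^{x_1}\bar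 E\,dt+\frac{u_0^2}{2}+\frac{\gamma S_0}{\gamma-1}\left(\frac{J}{u_0}\right)^{\gamma-1}$. **Domain.** For $0<L<\ell_{\max}$ let $\Omega_L=(0,L)\times(-1,1)$, $\Gamma_0=\{0\}\times[-1,1]$, $\Gamma_w=(0,L)\times\{-1,1\}$, $\Gamma_L=\{L\}\times[-1,1]$. **Coefficients.** Let $P=(\tilde\phi,\tilde\psi,\tilde\Psi)$ with $\tilde\phi\in H^5(\Omega_L)$, $\tilde\psi,\tilde\Psi\in H^4(\Omega_L)$. Put ${\bf V}=(\bar u,0)+\nabla\tilde\psi+(\partial_2\tilde\phi,-\partial_1\tilde\phi)$ and $$A_{ij}=(\gamma-1)\left(\bar\Phi+\tilde\Psi-\tfrac12|{\bf V}|^2\right)\delta_{ij}-V_iV_j,\qquad a_{ij}^P=\frac{A_{ij}}{A_{22}},$$ $$a^P=\frac{\bar E-(\gamma+1)\bar u'\bar u}{A_{22}},\qquad b_1^P=\frac{\bar u}{A_{22}},\qquad b_0^P=\frac{(\gamma-1)\bar u'}{A_{22}},$$ $$c_0=\frac{1}{\gamma S_0\bar\rho^{\gamma-2}},\qquad c_1=\frac{-\bar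 u}{\gamma S_0\bar\rho^{\gamma-2}}.$$ For $r_2,r_3>0$ let $\mathcal P(r_2,r_3)$ be the set of such $P$ with $\|\tilde\phi\|_{H^5(\Omega_L)}\le r_2$, $\|\tilde\psi\|_{H^4(\Omega_L)}+\|\tilde\Psi\|_{H^4(\Omega_L)}\le r_3$, and, on $\Gamma_w$ in the sense of traces, $\partial_2^{k}\tilde\phi=0$ for $k=0,2,4$ and $\partial_2^k\tilde\psi=\partial_2^k\tilde\Psi=0$ for $k=1,3$. **Boundary value problem.** For $f_1,f_2\in L^2(\Omega_L)$ consider $$\sum_{i,j=1}^2a_{ij}^P\partial_{ij}v+a^P\partial_1v+b_1^P\partial_1w+b_0^Pw=f_1,\qquad \Delta w-c_0w-c_1\partial_1v=f_2\quad\text{a.e. in }\Omega_L,\tag{1}$$ $$v=0,\ \partial_1w=0\ \text{ on }\Gamma_0,\qquad \partial_2v=\partial_2w=0\ \text{ on }\Gamma_w,\qquad w=0\ \text{ on }\Gamma_L.\tag{2}$$ **Statement.** For all $\gamma>1$, $\zeta_0>1$, $S_0>0$ there are constants $0<\bar J<1<\underline J<\infty$ depending only on $(\gamma,\zeta_0,S_0)$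 such that for every $J\in(0,\bar J]\cup[\underline J,\infty)$ there is a constant $d\in(0,1)$ depending only on $(\gamma,\zeta_0,S_0,J)$ with the following property. Let $E_0<0$ and $0<L<\ell_{\max}$ satisfy $$1-d\le\frac{u_0}{u_s}<1<\frac{\bar u(L)}{u_s}\le1+d .$$ Then there are constants $\bar\delta>0$ and $C>0$ depending only on $(\gamma,\zeta_0,S_0,E_0,J,L)$ such that, whenever $r_2,r_3>0$, $\max\{r_2,r_3\}\le2\bar\delta$ and $P\in\mathcal P(r_2,r_3)$, every solution $(v,w)$ of (1)–(2) that is $C^2$ up to the boundary (in particular, every smooth solution) satisfies $$\|\partial_1v\|_{L^2(\Gamma_0)}+\|Dv\|_{L^2(\Gamma_L)}+\|v\|_{H^1(\Omega_L)}+\|w\|_{H^1(\Omega_L)}\le C\left(\|f_1\|_{L^2(\Omega_L)}+\|f_2\|_{L^2(\Omega_L)}\right),$$ where $\|Dv\|_{L^2(\Gamma_L)}=\|\partial_1v\|_{L^2(\Gamma_L)}+\|\partial_2v\|_{L^2(\Gamma_L)}$. -/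

import Mathlib

open MeasureTheory Set Filter Topology
open scoped ContDiff

namespace EP

noncomputable section

/-! ### The one-dimensional accelerating background flow -/

/-- The sonic speed `u_s = (γ S₀ J^{γ-1})^{1/(γ+1)}`. -/
def us (γ J S₀ : ℝ) : ℝ := (γ * S₀ * J ^ (γ - 1)) ^ (1 / (γ + 1))

/-- The speed `ū_I = J / ρ̄_I`; by definition of `ζ₀` it is `ζ₀ u_s`. -/
def uIon (γ ζ₀ J S₀ : ℝ) : ℝ := ζ₀ * us γ J S₀

/-- The constant ion density `ρ̄_I = J / (ζ₀ u_s)`. -/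
def rhoIon (γ ζ₀ J S₀ : ℝ) : ℝ := J / uIon γ ζ₀ J S₀

/-- `H(u) = ∫_{u_s}^u J / (ū_I t^{γ+1}) (t^{γ+1} - u_s^{γ+1}) (ū_I - t) dt`, used for `u > 0`. -/
def H (γ ζ₀ J S₀ u : ℝ) : ℝ :=
  ∫ t in (us γ J S₀)..u,
    J / (uIon γ ζ₀ J S₀ * t ^ (γ + 1)) * (t ^ (γ + 1) - us γ J S₀ ^ (γ + 1)) *
      (uIon γ ζ₀ J S₀ - t)

/-- The accelerating branch of the critical trajectory `E² / 2 = H(u)`, `(u - u_s) E ≥ 0`. -/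
def Tacc (γ ζ₀ J S₀ : ℝ) : Set (ℝ × ℝ) :=
  {p | 0 < p.1 ∧ p.2 ^ 2 / 2 - H γ ζ₀ J S₀ p.1 = 0 ∧ 0 ≤ (p.1 - us γ J S₀) * p.2}

/-- `(u, E)` is the smooth accelerating background flow on its maximal interval of acceleration
`[0, ℓ)`, starting from the point `(u 0, E₀)` of the accelerating critical trajectory.
The first equation is the ODE `u' = E u^γ / (u^{γ+1} - u_s^{γ+1})`, cleared of the denominator,
which vanishes at the sonic point. -/
structure IsBackground (γ ζ₀ J S₀ E₀ ℓ : ℝ) (u E : ℝ → ℝ) : Prop where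
  length_pos : 0 < ℓ
  smooth_u : ContDiffOn ℝ ∞ u (Ico 0 ℓ)
  smooth_E : ContDiffOn ℝ ∞ E (Ico 0 ℓ)
  pos : ∀ x ∈ Ico 0 ℓ, 0 < u x
  init : E 0 = E₀
  init_mem : (u 0, E 0) ∈ Tacc γ ζ₀ J S₀
  ode_u : ∀ x ∈ Ico 0 ℓ,
    derivWithin u (Ico 0 ℓ) x * (u x ^ (γ + 1) - us γ J S₀ ^ (γ + 1)) = E x * u x ^ γ
  ode_E : ∀ x ∈ Ico 0 ℓ, derivWithin E (Ico 0 ℓ) x = J / u x - rhoIon γ ζ₀ J S₀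
  accelerating : ∀ x ∈ Ico 0 ℓ, 0 < derivWithin u (Ico 0 ℓ) x
  maximal : Tendsto (derivWithin u (Ico 0 ℓ)) (𝓝[<] ℓ) (𝓝 0)

/-- The background electric potential `Φ̄`. -/
def PhiBar (γ J S₀ : ℝ) (u E : ℝ → ℝ) (x₁ : ℝ) : ℝ :=
  (∫ t in (0 : ℝ)..x₁, E t) + u 0 ^ 2 / 2 + γ * S₀ / (γ - 1) * (J / u 0) ^ (γ - 1)

/-! ### The nozzle, classical partial derivatives and Sobolev spaces -/

/-- The nozzle `Ω_L = (0, L) × (-1, 1)`. -/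
def Om (L : ℝ) : Set (ℝ × ℝ) := Ioo 0 L ×ˢ Ioo (-1) 1

/-- The closed nozzle `[0, L] × [-1, 1]`. -/
def OmBar (L : ℝ) : Set (ℝ × ℝ) := Icc 0 L ×ˢ Icc (-1) 1

/-- The unit vectors `e₁`, `e₂` (indexed by `0`, `1`). -/
def e (i : Fin 2) : ℝ × ℝ := ![(1, 0), (0, 1)] i

/-- Partial derivative of a function that is differentiable up to the boundary of the nozzle. -/
def pd (L : ℝ) (i : Fin 2) (f : ℝ × ℝ → ℝ) (x : ℝ × ℝ) : ℝ :=
  fderivWithin ℝ f (OmBar L) x (e i)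

/-- Partial derivative in the whole plane (applied to test functions). -/
def tpd (i : Fin 2) (η : ℝ × ℝ → ℝ) (x : ℝ × ℝ) : ℝ := fderiv ℝ η x (e i)

/-- `∫_Ω f ∂₁^a ∂₂^b η = (-1)^{a+b} ∫_Ω g η` for all test functions `η ∈ C_c^∞(Ω_L)`. -/
def IsWeakPartial (L : ℝ) (a b : ℕ) (f g : ℝ × ℝ → ℝ) : Prop :=
  ∀ η : ℝ × ℝ → ℝ, ContDiff ℝ ∞ η → HasCompactSupport η → tsupport η ⊆ Om L →
    ∫ x in Om L, f x * ((tpd 0)^[a] ((tpd 1)^[b] η)) x =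
      (-1) ^ (a + b) * ∫ x in Om L, g x * η x

/-- Membership in `H^k(Ω_L)`. -/
def MemH (L : ℝ) (k : ℕ) (f : ℝ × ℝ → ℝ) : Prop :=
  MemLp f 2 (volume.restrict (Om L)) ∧
    ∀ a b : ℕ, a + b ≤ k →
      ∃ g, MemLp g 2 (volume.restrict (Om L)) ∧ IsWeakPartial L a b f g

open Classical in
/-- The weak derivative `∂₁^a ∂₂^b f ∈ L²(Ω_L)` (unique up to null sets), where it exists. -/
def wpd (L : ℝ) (a b : ℕ) (f : ℝ × ℝ → ℝ) : ℝ × ℝ → ℝ :=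
  if h : ∃ g, MemLp g 2 (volume.restrict (Om L)) ∧ IsWeakPartial L a b f g then
    h.choose else 0

/-- The `L²(Ω_L)` norm of a square-integrable function. -/
def L2norm (L : ℝ) (f : ℝ × ℝ → ℝ) : ℝ := √(∫ x in Om L, f x ^ 2)

/-- The `H^k(Ω_L)` norm `(∑_{a+b≤k} ‖∂₁^a ∂₂^b f‖²_{L²})^{1/2}`. -/
def Hnorm (L : ℝ) (k : ℕ) (f : ℝ × ℝ → ℝ) : ℝ :=
  √(∑ m ∈ Finset.range (k + 1), ∑ p ∈ Finset.HasAntidiagonal.antidiagonal m, L2norm L (wpd L p.1 p.2 f) ^ 2)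

/-- The trace of `∂₂^k f` on the wall `Γ_w = (0, L) × {-1, 1}` is zero, for `f ∈ H^{k+1}(Ω_L)`:
by Green's formula the integral below is the integral over `Γ_w` of `∂₂^k f η n₂`
with `n₂ = ±1` the outward normal, and the traces of the `η` are arbitrary test functions
on `Γ_w`. -/
def ZeroOnWall (L : ℝ) (k : ℕ) (f : ℝ × ℝ → ℝ) : Prop :=
  ∀ η : ℝ × ℝ → ℝ, ContDiff ℝ ∞ η → HasCompactSupport η →
    tsupport η ⊆ Ioo 0 L ×ˢ univ →
      ∫ x in Om L, (wpd L 0 k f x * tpd 1 η x + wpd L 0 (k + 1) f x * η x) = 0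

/-- The iteration set of (potentials of) vorticities. -/
def IterV (L r₂ : ℝ) : Set (ℝ × ℝ → ℝ) :=
  {φ | MemH L 5 φ ∧ Hnorm L 5 φ ≤ r₂ ∧
    ZeroOnWall L 0 φ ∧ ZeroOnWall L 2 φ ∧ ZeroOnWall L 4 φ}

/-- The iteration set of velocity and electric potential perturbations. -/
def IterP (L r₃ : ℝ) : Set ((ℝ × ℝ → ℝ) × (ℝ × ℝ → ℝ)) :=
  {p | MemH L 4 p.1 ∧ MemH L 4 p.2 ∧ Hnorm L 4 p.1 + Hnorm L 4 p.2 ≤ r₃ ∧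
    ZeroOnWall L 1 p.1 ∧ ZeroOnWall L 3 p.1 ∧ ZeroOnWall L 1 p.2 ∧ ZeroOnWall L 3 p.2}

/-! ### The coefficients and the linear boundary value problem -/

/-- `A_ij = (γ-1) (Φ̄ + z - |V|²/2) δ_ij - V_i V_j` with `V = (ū, 0) + p + q`. -/
def A (γ J S₀ : ℝ) (u E : ℝ → ℝ) (i j : Fin 2) (x : ℝ × ℝ) (z : ℝ) (p q : Fin 2 → ℝ) : ℝ :=
  let V : Fin 2 → ℝ := ![u x.1, 0] + p + q
  (γ - 1) * (PhiBar γ J S₀ u E x.1 + z - (∑ k, V k ^ 2) / 2) * (if i = j then 1 else 0) -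
    V i * V j

/-- `A_ij` evaluated along `P = (φ, ψ, Ψ)`: `z = Ψ`, `p = ∇ψ`, `q = ∇^⊥φ = (∂₂φ, -∂₁φ)`. -/
def AP (γ J S₀ L : ℝ) (u E : ℝ → ℝ) (φ ψ Ψ : ℝ × ℝ → ℝ) (i j : Fin 2) (x : ℝ × ℝ) : ℝ :=
  A γ J S₀ u E i j x (Ψ x) ![wpd L 1 0 ψ x, wpd L 0 1 ψ x] ![wpd L 0 1 φ x, -wpd L 1 0 φ x]

/-- The mixed-type operator
`𝔏₁^P(v, w) = ∑ a_ij ∂_ij v + a ∂₁v + b₁ ∂₁w + b₀ w` with `P = (φ, ψ, Ψ)`. -/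
def opL1 (γ J S₀ L : ℝ) (u E : ℝ → ℝ) (φ ψ Ψ : ℝ × ℝ → ℝ) (v w : ℝ × ℝ → ℝ) (x : ℝ × ℝ) : ℝ :=
  let A22 := AP γ J S₀ L u E φ ψ Ψ 1 1 x
  (∑ i, ∑ j, AP γ J S₀ L u E φ ψ Ψ i j x / A22 * pd L i (pd L j v) x) +
    (E x.1 - (γ + 1) * deriv u x.1 * u x.1) / A22 * pd L 0 v x +
    u x.1 / A22 * pd L 0 w x +
    (γ - 1) * deriv u x.1 / A22 * w x

/-- `c₀ = 1 / (γ S₀ ρ̄^{γ-2})`, `ρ̄ = J / ū`. -/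
def c0 (γ J S₀ : ℝ) (u : ℝ → ℝ) (x : ℝ × ℝ) : ℝ := 1 / (γ * S₀ * (J / u x.1) ^ (γ - 2))

/-- `c₁ = -ū / (γ S₀ ρ̄^{γ-2})`, `ρ̄ = J / ū`. -/
def c1 (γ J S₀ : ℝ) (u : ℝ → ℝ) (x : ℝ × ℝ) : ℝ := -u x.1 / (γ * S₀ * (J / u x.1) ^ (γ - 2))

/-- The elliptic operator `𝔏₂(v, w) = Δw - c₀ w - c₁ ∂₁v`. -/
def opL2 (γ J S₀ L : ℝ) (u : ℝ → ℝ) (v w : ℝ × ℝ → ℝ) (x : ℝ × ℝ) : ℝ :=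
  (∑ i, pd L i (pd L i w) x) - c0 γ J S₀ u x * w x - c1 γ J S₀ u x * pd L 0 v x

/-- `(v, w)` is a classical solution, `C²` up to the boundary, of the linear boundary value
problem for `P = (φ, ψ, Ψ)`. The coefficients are Sobolev functions, so the equations are
understood almost everywhere. -/
structure IsSolution (γ J S₀ L : ℝ) (u E : ℝ → ℝ) (φ ψ Ψ : ℝ × ℝ → ℝ)
    (f₁ f₂ v w : ℝ × ℝ → ℝ) : Prop where
  reg_v : ContDiffOn ℝ 2 v (OmBar L)
  reg_w : ContDiffOn ℝ 2 w (OmBar L)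
  eq₁ : ∀ᵐ x ∂(volume.restrict (Om L)), opL1 γ J S₀ L u E φ ψ Ψ v w x = f₁ x
  eq₂ : ∀ᵐ x ∂(volume.restrict (Om L)), opL2 γ J S₀ L u v w x = f₂ x
  entrance : ∀ y ∈ Icc (-1 : ℝ) 1, v (0, y) = 0 ∧ pd L 0 w (0, y) = 0
  wall : ∀ x ∈ Ioo 0 L, ∀ y ∈ ({-1, 1} : Set ℝ), pd L 1 v (x, y) = 0 ∧ pd L 1 w (x, y) = 0
  exit : ∀ y ∈ Icc (-1 : ℝ) 1, w (L, y) = 0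

/-- The norm in `L²({x₁} × [-1, 1])` of a function that is continuous there. -/
def L2line (x₁ : ℝ) (f : ℝ × ℝ → ℝ) : ℝ := √(∫ y in (-1 : ℝ)..1, f (x₁, y) ^ 2)

end

end EP

namespace EP

/-! ### Calculus on the rectangle -/

/-! The equation for `v` is elliptic where the flow is subsonic and hyperbolic where it is
supersonic, so the estimate rests on a single multiplier that works on both sides of the sonic line.
Write c² = γS₀ρ̄^(γ-1) and S = u_s^(γ+1). Bernoulli's law (`IsBackground.PhiBar_eq`) identifies the
background values of A₁₁ and A₂₂ as c² - ū² and c². Clear the division by A₂₂ and multiply by T∂₁v,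
with T(x₁) chosen so that G = Tc² is affine with slope -μ < 0; then P = T(c² - ū²) = G(1 -
ū^(γ+1)/S). Integration by parts produces the boundary quantities P(0)/2, -P(L)/2, G(L)/2, all
positive because the flow enters subsonic and leaves supersonic. In the interior, -G'/2 = μ/2
controls ∂₂v, and P'/2 minus the multiplied first-order coefficient controls ∂₁v because ū' is
bounded below. This is `mixed_energy_estimate`, with the multiplier from
`IsBackground.exists_multiplier`.

Testing the second equation with `w` bounds ∇w by ∂₁v and f₂ (`elliptic_energy_estimate`), and the
Poincaré inequality contributes a factor of L. Hence the coupling terms cost a multiple of L‖∂₁v‖²,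
which is absorbed when L is small (`coupled_closure`).

L is small because the flow is pinned near the sonic speed: it stays on the curve E²/2 = H(ū), and H
is comparable to (ū - u_s)² there, so the quotient defining ū' lies between positive constants κ and
Λ (`exists_acceleration_bounds`). Therefore κL ≤ ū(L) - ū(0) ≤ 2d·u_s, and a small d forces a small
L. This works for every J > 0.

The perturbed coefficients involve first derivatives of the potentials φ̃ and ψ̃ and the function Ψ̃
itself. By a Sobolev inequality these have Lipschitz representatives with small constants
(`MemH.exists_lipBdd`), so integrating by parts against them costs only ε times quantities already
on the left. On the walls the mixed coefficient must vanish; this follows from the compatibility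
conditions (`trace_snd_eq_zero`, `trace_fst_eq_zero`).

Finally, the constants may depend on E₀ and L but must precede the flow in the quantifiers;
uniqueness of the flow (`IsBackground.unique`) bridges the gap. -/

theorem isCompact_OmBar (L : ℝ) : IsCompact (OmBar L) := isCompact_Icc.prod isCompact_Icc

theorem Om_subset_OmBar (L : ℝ) : Om L ⊆ OmBar L :=
  prod_mono Ioo_subset_Icc_self Ioo_subset_Icc_self

theorem isOpen_Om (L : ℝ) : IsOpen (Om L) := isOpen_Ioo.prod isOpen_Ioo

theorem measurableSet_Om (L : ℝ) : MeasurableSet (Om L) := (isOpen_Om L).measurableSet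

theorem uniqueDiffOn_OmBar {L : ℝ} (hL : 0 < L) : UniqueDiffOn ℝ (OmBar L) :=
  (uniqueDiffOn_Icc hL).prod (uniqueDiffOn_Icc (by norm_num))

theorem volume_Om_ne_top (L : ℝ) : volume (Om L) ≠ ⊤ :=
  ((measure_mono (Om_subset_OmBar L)).trans_lt (isCompact_OmBar L).measure_lt_top).ne

instance isFiniteMeasure_Om (L : ℝ) : IsFiniteMeasure (volume.restrict (Om L)) :=
  ⟨by simpa using (volume_Om_ne_top L).lt_top⟩

theorem integrableOn_Om {L : ℝ} {F : ℝ × ℝ → ℝ} (hF : ContinuousOn F (OmBar L)) :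
    IntegrableOn F (Om L) :=
  (hF.integrableOn_compact (isCompact_OmBar L)).mono_set (Om_subset_OmBar L)

theorem continuousOn_pd {L : ℝ} (hL : 0 < L) {f : ℝ × ℝ → ℝ} (hf : ContDiffOn ℝ 1 f (OmBar L))
    (i : Fin 2) : ContinuousOn (pd L i f) (OmBar L) :=
  (hf.continuousOn_fderivWithin (uniqueDiffOn_OmBar hL) le_rfl).clm_apply continuousOn_const

theorem contDiffOn_pd {L : ℝ} (hL : 0 < L) {f : ℝ × ℝ → ℝ} (hf : ContDiffOn ℝ 2 f (OmBar L))
    (i : Fin 2) : ContDiffOn ℝ 1 (pd L i f) (OmBar L) :=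
  (hf.fderivWithin (uniqueDiffOn_OmBar hL) (by norm_num)).clm_apply contDiffOn_const

theorem pd_mul {L : ℝ} (hL : 0 < L) {f g : ℝ × ℝ → ℝ} (hf : ContDiffOn ℝ 1 f (OmBar L))
    (hg : ContDiffOn ℝ 1 g (OmBar L)) (i : Fin 2) {x : ℝ × ℝ} (hx : x ∈ OmBar L) :
    pd L i (fun z => f z * g z) x = f x * pd L i g x + pd L i f x * g x := by
  unfold pd
  rw [fderivWithin_fun_mul (uniqueDiffOn_OmBar hL x hx) (hf.differentiableOn one_ne_zero x hx)
    (hg.differentiableOn one_ne_zero x hx)]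
  simp [mul_comm]

theorem hasDerivWithinAt_fst {L : ℝ} {f : ℝ × ℝ → ℝ} (hf : ContDiffOn ℝ 1 f (OmBar L))
    {x y : ℝ} (hx : x ∈ Icc 0 L) (hy : y ∈ Icc (-1 : ℝ) 1) :
    HasDerivWithinAt (fun t => f (t, y)) (pd L 0 f (x, y)) (Icc 0 L) x := by
  have h1 := (hf.differentiableOn one_ne_zero (x, y) ⟨hx, hy⟩).hasFDerivWithinAt
  have h2 : HasDerivWithinAt (fun t : ℝ => (t, y)) ((1 : ℝ), (0 : ℝ)) (Icc 0 L) x :=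
    (hasDerivWithinAt_id x _).prodMk (hasDerivWithinAt_const x _ y)
  exact h1.comp_hasDerivWithinAt x h2 fun t ht => mk_mem_prod ht hy

theorem hasDerivWithinAt_snd {L : ℝ} {f : ℝ × ℝ → ℝ} (hf : ContDiffOn ℝ 1 f (OmBar L))
    {x y : ℝ} (hx : x ∈ Icc 0 L) (hy : y ∈ Icc (-1 : ℝ) 1) :
    HasDerivWithinAt (fun t => f (x, t)) (pd L 1 f (x, y)) (Icc (-1) 1) y := by
  have h1 := (hf.differentiableOn one_ne_zero (x, y) ⟨hx, hy⟩).hasFDerivWithinAt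
  have h2 : HasDerivWithinAt (fun t : ℝ => (x, t)) ((0 : ℝ), (1 : ℝ)) (Icc (-1) 1) y :=
    (hasDerivWithinAt_const y _ x).prodMk (hasDerivWithinAt_id y _)
  exact h1.comp_hasDerivWithinAt y h2 fun t ht => mk_mem_prod hx ht

/-- Symmetry of the second derivative within a set needs only that the point lie in the closure of
the interior; stating it on the open nozzle suffices, since it is used under integrals. -/
theorem pd_comm {L : ℝ} (hL : 0 < L) {f : ℝ × ℝ → ℝ} (hf : ContDiffOn ℝ 2 f (OmBar L))
    {x : ℝ × ℝ} (hx : x ∈ Om L) (i j : Fin 2) : pd L i (pd L j f) x = pd L j (pd L i f) x := by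
  have hx' := Om_subset_OmBar L hx
  have hs := (hf x hx').isSymmSndFDerivWithinAt (by simp) (uniqueDiffOn_OmBar hL)
    (subset_closure ((isOpen_Om L).subset_interior_iff.2 (Om_subset_OmBar L) hx)) hx'
  have hd : DifferentiableWithinAt ℝ (fderivWithin ℝ f (OmBar L)) (OmBar L) x :=
    (hf.fderivWithin (m := 1) (uniqueDiffOn_OmBar hL) (by norm_num)).differentiableOn
      one_ne_zero x hx'
  have key : ∀ i j : Fin 2, pd L i (pd L j f) x =
      fderivWithin ℝ (fderivWithin ℝ f (OmBar L)) (OmBar L) x (e i) (e j) := by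
    intro i j
    have := fderivWithin_clm_apply (uniqueDiffOn_OmBar hL x hx') hd
      (differentiableWithinAt_const (e j))
    unfold pd
    rw [this]
    simp
  rw [key, key]
  exact hs _ _

theorem integral_Om_eq {L : ℝ} (hL : 0 < L) {F : ℝ × ℝ → ℝ} (hF : IntegrableOn F (Om L)) :
    ∫ z in Om L, F z = ∫ x in (0 : ℝ)..L, ∫ y in (-1 : ℝ)..1, F (x, y) := by
  rw [Om, Measure.volume_eq_prod, setIntegral_prod _ (by rwa [← Measure.volume_eq_prod]),
    intervalIntegral.integral_of_le hL.le, integral_Ioc_eq_integral_Ioo]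
  refine integral_congr_ae (Eventually.of_forall fun x => ?_)
  simp only
  rw [intervalIntegral.integral_of_le (by norm_num), integral_Ioc_eq_integral_Ioo]

theorem integral_Om_eq' {L : ℝ} (hL : 0 < L) {F : ℝ × ℝ → ℝ} (hF : IntegrableOn F (Om L)) :
    ∫ z in Om L, F z = ∫ y in (-1 : ℝ)..1, ∫ x in (0 : ℝ)..L, F (x, y) := by
  have hF' : IntegrableOn (fun z : ℝ × ℝ => F z.swap) (Ioo (-1 : ℝ) 1 ×ˢ Ioo 0 L)
      (volume.prod volume) := by
    have := hF
    rw [IntegrableOn, Om, Measure.volume_eq_prod, ← Measure.prod_restrict] at this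
    rw [IntegrableOn, ← Measure.prod_restrict]
    exact this.swap
  rw [Om, Measure.volume_eq_prod, ← setIntegral_prod_swap, setIntegral_prod _ hF',
    intervalIntegral.integral_of_le (by norm_num), integral_Ioc_eq_integral_Ioo]
  refine integral_congr_ae (Eventually.of_forall fun x => ?_)
  simp only
  rw [intervalIntegral.integral_of_le hL.le, integral_Ioc_eq_integral_Ioo]
  rfl

theorem intervalIntegrable_integral_snd {L : ℝ} (hL : 0 < L) {F : ℝ × ℝ → ℝ}
    (hF : IntegrableOn F (Om L)) :
    IntervalIntegrable (fun x => ∫ y in (-1 : ℝ)..1, F (x, y)) volume 0 L := by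
  rw [intervalIntegrable_iff_integrableOn_Ioo_of_le hL.le]
  rw [IntegrableOn, Om, Measure.volume_eq_prod, ← Measure.prod_restrict] at hF
  refine hF.integral_prod_left.congr (Eventually.of_forall fun x => ?_)
  simp only
  rw [intervalIntegral.integral_of_le (by norm_num), integral_Ioc_eq_integral_Ioo]

theorem intervalIntegrable_integral_fst {L : ℝ} (hL : 0 < L) {F : ℝ × ℝ → ℝ}
    (hF : IntegrableOn F (Om L)) :
    IntervalIntegrable (fun y => ∫ x in (0 : ℝ)..L, F (x, y)) volume (-1) 1 := by
  rw [intervalIntegrable_iff_integrableOn_Ioo_of_le (by norm_num)]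
  rw [IntegrableOn, Om, Measure.volume_eq_prod, ← Measure.prod_restrict] at hF
  refine hF.integral_prod_right.congr (Eventually.of_forall fun x => ?_)
  simp only
  rw [intervalIntegral.integral_of_le hL.le, integral_Ioc_eq_integral_Ioo]

theorem continuousOn_line_fst {L : ℝ} {F : ℝ × ℝ → ℝ} (hF : ContinuousOn F (OmBar L)) {y : ℝ}
    (hy : y ∈ Icc (-1 : ℝ) 1) : ContinuousOn (fun x => F (x, y)) (Icc 0 L) :=
  hF.comp (by fun_prop) fun _ hx => ⟨hx, hy⟩

theorem continuousOn_line_snd {L : ℝ} {F : ℝ × ℝ → ℝ} (hF : ContinuousOn F (OmBar L)) {x : ℝ}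
    (hx : x ∈ Icc 0 L) : ContinuousOn (fun y => F (x, y)) (Icc (-1) 1) :=
  hF.comp (by fun_prop) fun _ hy => ⟨hx, hy⟩

/-! ### Integration by parts -/

theorem integral_mul_deriv_of_hasDerivWithinAt {a b : ℝ} (hab : a ≤ b) {p p' g g' : ℝ → ℝ}
    (hp : ∀ x ∈ Icc a b, HasDerivWithinAt p (p' x) (Icc a b) x)
    (hp' : ContinuousOn p' (Icc a b))
    (hg : ∀ x ∈ Icc a b, HasDerivWithinAt g (g' x) (Icc a b) x)
    (hg' : ContinuousOn g' (Icc a b)) :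
    ∫ x in a..b, p x * g' x = p b * g b - p a * g a - ∫ x in a..b, p' x * g x := by
  have key : ∀ {q q' : ℝ → ℝ}, (∀ x ∈ Icc a b, HasDerivWithinAt q (q' x) (Icc a b) x) →
      ∀ x ∈ Ioo (min a b) (max a b), HasDerivWithinAt q (q' x) (Ioi x) x := by
    intro q q' hq x hx
    rw [min_eq_left hab, max_eq_right hab] at hx
    exact ((hq x (Ioo_subset_Icc_self hx)).hasDerivAt
      (Icc_mem_nhds hx.1 hx.2)).hasDerivWithinAt
  refine intervalIntegral.integral_mul_deriv_eq_deriv_mul_of_hasDeriv_right ?_ ?_ (key hp)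
    (key hg) ?_ ?_
  · rw [uIcc_of_le hab]; exact fun x hx => (hp x hx).continuousWithinAt
  · rw [uIcc_of_le hab]; exact fun x hx => (hg x hx).continuousWithinAt
  · exact (by rwa [uIcc_of_le hab] : ContinuousOn p' (uIcc a b)).intervalIntegrable
  · exact (by rwa [uIcc_of_le hab] : ContinuousOn g' (uIcc a b)).intervalIntegrable

/-- A Lipschitz function is absolutely continuous, so integration by parts holds with its a.e.
derivative, which is bounded by `M`. Differentiability of `p` is deliberately not assumed: the
perturbed coefficients have no better than Lipschitz representatives. -/
theorem abs_integral_lipschitz_mul_deriv_le {a b M : ℝ} (hab : a ≤ b) (hM : 0 ≤ M)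
    {p g g' : ℝ → ℝ}
    (hp : ∀ x ∈ Icc a b, ∀ y ∈ Icc a b, |p x - p y| ≤ M * |x - y|)
    (hg : ∀ x ∈ Icc a b, HasDerivWithinAt g (g' x) (Icc a b) x)
    (hg' : ContinuousOn g' (Icc a b)) :
    |∫ x in a..b, p x * g' x| ≤ |p b * g b| + |p a * g a| + M * ∫ x in a..b, |g x| := by
  have hpl : LipschitzOnWith M.toNNReal p (Icc a b) := by
    refine LipschitzOnWith.of_dist_le_mul fun x hx y hy => ?_
    simpa [Real.dist_eq, hM] using hp x hx y hy
  have hpac : AbsolutelyContinuousOnInterval p a b :=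
    LipschitzOnWith.absolutelyContinuousOnInterval (K := M.toNNReal) (by rwa [uIcc_of_le hab])
  obtain ⟨C, hC⟩ := isCompact_Icc.exists_bound_of_continuousOn hg'
  have hgl : LipschitzOnWith (max C 0).toNNReal g (Icc a b) := by
    refine (convex_Icc a b).lipschitzOnWith_of_nnnorm_hasDerivWithin_le hg fun x hx => ?_
    rw [← NNReal.coe_le_coe, coe_nnnorm, Real.coe_toNNReal _ (le_max_right _ _)]
    exact (hC x hx).trans (le_max_left _ _)
  have hgac : AbsolutelyContinuousOnInterval g a b :=
    LipschitzOnWith.absolutelyContinuousOnInterval (K := (max C 0).toNNReal)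
      (by rwa [uIcc_of_le hab])
  have h1 : ∫ x in a..b, p x * g' x = ∫ x in a..b, p x * deriv g x := by
    rw [intervalIntegral.integral_of_le hab, intervalIntegral.integral_of_le hab,
      integral_Ioc_eq_integral_Ioo, integral_Ioc_eq_integral_Ioo]
    refine setIntegral_congr_fun measurableSet_Ioo fun x hx => ?_
    rw [((hg x (Ioo_subset_Icc_self hx)).hasDerivAt (Icc_mem_nhds hx.1 hx.2)).deriv]
  have hgc : ContinuousOn g (uIcc a b) := by
    rw [uIcc_of_le hab]; exact hgl.continuousOn
  have h2 : |∫ x in a..b, deriv p x * g x| ≤ M * ∫ x in a..b, |g x| := by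
    rw [← intervalIntegral.integral_const_mul, ← Real.norm_eq_abs]
    refine intervalIntegral.norm_integral_le_of_norm_le hab ?_
      (hgc.abs.intervalIntegrable.const_mul M)
    have hb : ∀ᵐ t : ℝ, t ≠ b := by simp [ae_iff]
    filter_upwards [hb] with t htb ht
    have := norm_deriv_le_of_lipschitzOn (Icc_mem_nhds ht.1 (lt_of_le_of_ne ht.2 htb)) hpl
    rw [norm_mul, Real.norm_eq_abs (g t)]
    rw [Real.coe_toNNReal _ hM] at this
    gcongr
  rw [h1, hpac.integral_mul_deriv_eq_deriv_mul hgac]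
  calc _ ≤ |p b * g b| + |p a * g a| + |∫ x in a..b, deriv p x * g x| := by
        refine (abs_sub _ _).trans ?_
        gcongr
        exact abs_sub _ _
    _ ≤ _ := by gcongr

/-- `p` is bounded by `M` and `M`-Lipschitz on the closed nozzle. -/
def LipBdd (L M : ℝ) (p : ℝ × ℝ → ℝ) : Prop :=
  (∀ x ∈ OmBar L, |p x| ≤ M) ∧ ∀ x ∈ OmBar L, ∀ y ∈ OmBar L, |p x - p y| ≤ M * dist x y

theorem LipBdd.continuousOn {L M : ℝ} {p : ℝ × ℝ → ℝ} (hp : LipBdd L M p) :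
    ContinuousOn p (OmBar L) := by
  have : LipschitzOnWith M.toNNReal p (OmBar L) := by
    refine LipschitzOnWith.of_dist_le_mul fun x hx y hy => (hp.2 x hx y hy).trans ?_
    gcongr
    exact Real.le_coe_toNNReal M
  exact this.continuousOn

/-- One-dimensional integration by parts on each horizontal slice. The entrance and exit terms are
kept, because the energy estimate controls squares of derivatives of `v` there. -/
theorem abs_integral_lipBdd_mul_pd_fst_le {L M : ℝ} (hL : 0 < L) (hM : 0 ≤ M)
    {p g : ℝ × ℝ → ℝ} (hp : LipBdd L M p) (hg : ContDiffOn ℝ 1 g (OmBar L)) :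
    |∫ z in Om L, p z * pd L 0 g z| ≤
      M * ((∫ y in (-1 : ℝ)..1, |g (0, y)|) + (∫ y in (-1 : ℝ)..1, |g (L, y)|) +
        ∫ z in Om L, |g z|) := by
  have h0 : (0 : ℝ) ∈ Icc 0 L := ⟨le_rfl, hL.le⟩
  have h1 : L ∈ Icc 0 L := ⟨hL.le, le_rfl⟩
  have hpg := hp.continuousOn.fun_mul (continuousOn_pd hL hg 0)
  have hi := integrableOn_Om hg.continuousOn.abs
  have hu : uIcc (-1 : ℝ) 1 = Icc (-1) 1 := uIcc_of_le (by norm_num)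
  have hb : ∀ x ∈ Icc 0 L, IntervalIntegrable (fun y => |g (x, y)|) volume (-1) 1 := fun x hx =>
    ContinuousOn.intervalIntegrable (by
      rw [hu]; exact continuousOn_line_snd hg.continuousOn.abs hx)
  rw [integral_Om_eq' hL (integrableOn_Om hpg), integral_Om_eq' hL hi, mul_add, mul_add,
    ← intervalIntegral.integral_const_mul, ← intervalIntegral.integral_const_mul,
    ← intervalIntegral.integral_const_mul,
    ← intervalIntegral.integral_add ((hb 0 h0).const_mul M) ((hb L h1).const_mul M),
    ← intervalIntegral.integral_add (((hb 0 h0).const_mul M).add ((hb L h1).const_mul M))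
      ((intervalIntegrable_integral_fst hL hi).const_mul M), ← Real.norm_eq_abs]
  refine intervalIntegral.norm_integral_le_of_norm_le (by norm_num)
    (Eventually.of_forall fun y hy => ?_)
    ((((hb 0 h0).const_mul M).add ((hb L h1).const_mul M)).add
      ((intervalIntegrable_integral_fst hL hi).const_mul M))
  have hy' : y ∈ Icc (-1 : ℝ) 1 := Ioc_subset_Icc_self hy
  refine (abs_integral_lipschitz_mul_deriv_le (p := fun x => p (x, y)) hL.le hM
    (fun x hx x' hx' => ?_)
    (fun x hx => hasDerivWithinAt_fst hg hx hy')
    (continuousOn_line_fst (continuousOn_pd hL hg 0) hy')).trans ?_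
  · refine (hp.2 (x, y) ⟨hx, hy'⟩ (x', y) ⟨hx', hy'⟩).trans_eq ?_
    rw [dist_prod_same_right, Real.dist_eq]
  · rw [abs_mul, abs_mul, add_comm (|p (L, y)| * _)]
    gcongr
    · exact hp.1 _ ⟨h0, hy'⟩
    · exact hp.1 _ ⟨h1, hy'⟩

/-- The same on vertical slices. Nothing on the walls is controlled by the energy, so the product
has to vanish there; either factor may be responsible. -/
theorem abs_integral_lipBdd_mul_pd_snd_le {L M : ℝ} (hL : 0 < L) (hM : 0 ≤ M)
    {p g : ℝ × ℝ → ℝ} (hp : LipBdd L M p) (hg : ContDiffOn ℝ 1 g (OmBar L))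
    (hw : ∀ x ∈ Ioo 0 L, ∀ y ∈ ({-1, 1} : Set ℝ), p (x, y) * g (x, y) = 0) :
    |∫ z in Om L, p z * pd L 1 g z| ≤ M * ∫ z in Om L, |g z| := by
  have hpg := hp.continuousOn.fun_mul (continuousOn_pd hL hg 1)
  have hi := integrableOn_Om hg.continuousOn.abs
  rw [integral_Om_eq hL (integrableOn_Om hpg), integral_Om_eq hL hi,
    ← intervalIntegral.integral_const_mul, ← Real.norm_eq_abs]
  refine intervalIntegral.norm_integral_le_of_norm_le hL.le ?_
    ((intervalIntegrable_integral_snd hL hi).const_mul M)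
  have hb : ∀ᵐ t : ℝ, t ≠ L := by simp [ae_iff]
  filter_upwards [hb] with x hxL hx
  have hx' : x ∈ Icc 0 L := Ioc_subset_Icc_self hx
  have hx'' : x ∈ Ioo 0 L := ⟨hx.1, lt_of_le_of_ne hx.2 hxL⟩
  refine (abs_integral_lipschitz_mul_deriv_le (p := fun y => p (x, y)) (by norm_num) hM
    (fun y hy y' hy' => ?_)
    (fun y hy => hasDerivWithinAt_snd hg hx' hy)
    (continuousOn_line_snd (continuousOn_pd hL hg 1) hx')).trans ?_
  · refine (hp.2 (x, y) ⟨hx', hy⟩ (x, y') ⟨hx', hy'⟩).trans_eq ?_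
    rw [dist_prod_same_left, Real.dist_eq]
  · rw [hw x hx'' 1 (by simp), hw x hx'' (-1) (by simp)]
    simp

theorem integral_mul_pd_fst {L : ℝ} (hL : 0 < L) {P P' : ℝ → ℝ} {g : ℝ × ℝ → ℝ}
    (hP : ∀ x ∈ Icc 0 L, HasDerivWithinAt P (P' x) (Icc 0 L) x)
    (hP' : ContinuousOn P' (Icc 0 L)) (hg : ContDiffOn ℝ 1 g (OmBar L)) :
    ∫ z in Om L, P z.1 * pd L 0 g z =
      P L * (∫ y in (-1 : ℝ)..1, g (L, y)) - P 0 * (∫ y in (-1 : ℝ)..1, g (0, y)) -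
        ∫ z in Om L, P' z.1 * g z := by
  have h0 : (0 : ℝ) ∈ Icc 0 L := ⟨le_rfl, hL.le⟩
  have h1 : L ∈ Icc 0 L := ⟨hL.le, le_rfl⟩
  have hPc : ContinuousOn P (Icc 0 L) := fun x hx => (hP x hx).continuousWithinAt
  have hfst : ∀ {Q : ℝ → ℝ}, ContinuousOn Q (Icc 0 L) →
      ContinuousOn (fun z : ℝ × ℝ => Q z.1) (OmBar L) := fun hQ =>
    hQ.comp continuousOn_fst fun z hz => hz.1
  have hu : uIcc (-1 : ℝ) 1 = Icc (-1) 1 := uIcc_of_le (by norm_num)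
  have hb : ∀ x ∈ Icc 0 L, IntervalIntegrable (fun y => g (x, y)) volume (-1) 1 := fun x hx =>
    ContinuousOn.intervalIntegrable (by
      rw [hu]; exact continuousOn_line_snd hg.continuousOn hx)
  have hi := integrableOn_Om ((hfst hP').fun_mul hg.continuousOn)
  have hpg := integrableOn_Om ((hfst hPc).fun_mul (continuousOn_pd hL hg 0))
  rw [integral_Om_eq' hL hpg, integral_Om_eq' hL hi, ← intervalIntegral.integral_const_mul,
    ← intervalIntegral.integral_const_mul,
    ← intervalIntegral.integral_sub ((hb L h1).const_mul _) ((hb 0 h0).const_mul _),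
    ← intervalIntegral.integral_sub (((hb L h1).const_mul _).sub ((hb 0 h0).const_mul _))
      (intervalIntegrable_integral_fst hL hi)]
  refine intervalIntegral.integral_congr fun y hy => ?_
  rw [hu] at hy
  exact integral_mul_deriv_of_hasDerivWithinAt hL.le hP hP'
    (fun x hx => hasDerivWithinAt_fst hg hx hy)
    (continuousOn_line_fst (continuousOn_pd hL hg 0) hy)

theorem integral_mul_pd_snd {L : ℝ} (hL : 0 < L) {P : ℝ → ℝ} {g : ℝ × ℝ → ℝ}
    (hP : ContinuousOn P (Icc 0 L)) (hg : ContDiffOn ℝ 1 g (OmBar L))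
    (hw : ∀ x ∈ Ioo 0 L, ∀ y ∈ ({-1, 1} : Set ℝ), g (x, y) = 0) :
    ∫ z in Om L, P z.1 * pd L 1 g z = 0 := by
  have hPc : ContinuousOn (fun z : ℝ × ℝ => P z.1) (OmBar L) :=
    hP.comp continuousOn_fst fun z hz => hz.1
  rw [integral_Om_eq hL (integrableOn_Om (hPc.fun_mul (continuousOn_pd hL hg 1))),
    intervalIntegral.integral_of_le hL.le, integral_Ioc_eq_integral_Ioo]
  refine setIntegral_eq_zero_of_forall_eq_zero fun x hx => ?_
  have hx' := Ioo_subset_Icc_self hx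
  have h := integral_mul_deriv_of_hasDerivWithinAt (a := -1) (b := 1) (by norm_num)
    (p := fun _ => P x) (p' := fun _ => 0)
    (fun y _ => hasDerivWithinAt_const y _ _) continuousOn_const
    (fun y hy => hasDerivWithinAt_snd hg hx' hy)
    (continuousOn_line_snd (continuousOn_pd hL hg 1) hx')
  simp only at h ⊢
  rw [h, hw x hx 1 (by simp), hw x hx (-1) (by simp)]
  simp

/-! ### `L²` norms on the nozzle -/

theorem memLp_Om {L : ℝ} {F : ℝ × ℝ → ℝ} (hF : ContinuousOn F (OmBar L)) :
    MemLp F 2 (volume.restrict (Om L)) := by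
  rw [memLp_two_iff_integrable_sq
    ((hF.mono (Om_subset_OmBar L)).aestronglyMeasurable (measurableSet_Om L))]
  exact integrableOn_Om (hF.pow 2)

theorem L2norm_nonneg (L : ℝ) (f : ℝ × ℝ → ℝ) : 0 ≤ L2norm L f := Real.sqrt_nonneg _

theorem L2line_nonneg (x : ℝ) (f : ℝ × ℝ → ℝ) : 0 ≤ L2line x f := Real.sqrt_nonneg _

theorem L2norm_sq (L : ℝ) (f : ℝ × ℝ → ℝ) : L2norm L f ^ 2 = ∫ z in Om L, f z ^ 2 :=
  Real.sq_sqrt (integral_nonneg fun _ => sq_nonneg _)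

theorem L2line_sq (x : ℝ) (f : ℝ × ℝ → ℝ) : L2line x f ^ 2 = ∫ y in (-1 : ℝ)..1, f (x, y) ^ 2 :=
  Real.sq_sqrt (intervalIntegral.integral_nonneg (by norm_num) fun _ _ => sq_nonneg _)

theorem integral_abs_mul_le_L2norm {L : ℝ} {f g : ℝ × ℝ → ℝ}
    (hf : MemLp f 2 (volume.restrict (Om L))) (hg : MemLp g 2 (volume.restrict (Om L))) :
    ∫ z in Om L, |f z * g z| ≤ L2norm L f * L2norm L g := by
  have h := integral_mul_le_Lp_mul_Lq_of_nonneg (μ := volume.restrict (Om L)) (p := 2) (q := 2)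
    Real.HolderConjugate.two_two (f := fun z => |f z|) (g := fun z => |g z|)
    (Eventually.of_forall fun _ => abs_nonneg _) (Eventually.of_forall fun _ => abs_nonneg _)
    (by simpa using hf.norm) (by simpa using hg.norm)
  simp only [abs_mul, L2norm, Real.sqrt_eq_rpow]
  simpa using h

theorem abs_integral_mul_le_L2norm {L : ℝ} {f g : ℝ × ℝ → ℝ}
    (hf : MemLp f 2 (volume.restrict (Om L))) (hg : MemLp g 2 (volume.restrict (Om L))) :
    |∫ z in Om L, f z * g z| ≤ L2norm L f * L2norm L g :=
  (abs_integral_le_integral_abs).trans (integral_abs_mul_le_L2norm hf hg)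

theorem abs_integral_mul_mul_le_L2norm {L B : ℝ} {b f g : ℝ × ℝ → ℝ}
    (hb : ∀ z ∈ Om L, |b z| ≤ B)
    (hf : MemLp f 2 (volume.restrict (Om L))) (hg : MemLp g 2 (volume.restrict (Om L))) :
    |∫ z in Om L, b z * (f z * g z)| ≤ B * (L2norm L f * L2norm L g) := by
  by_cases hne : (Om L).Nonempty
  swap
  · rw [not_nonempty_iff_eq_empty] at hne
    simp [hne, L2norm]
  have hB : 0 ≤ B := (abs_nonneg _).trans (hb _ hne.some_mem)
  refine le_trans ?_ (mul_le_mul_of_nonneg_left (integral_abs_mul_le_L2norm hf hg) hB)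
  rw [← integral_const_mul, ← Real.norm_eq_abs]
  refine norm_integral_le_of_norm_le ((hf.integrable_mul hg).abs.const_mul B) ?_
  filter_upwards [ae_restrict_mem (measurableSet_Om L)] with z hz
  rw [norm_mul, Real.norm_eq_abs, Real.norm_eq_abs]
  exact mul_le_mul_of_nonneg_right (hb z hz) (abs_nonneg _)

/-- Poincaré inequality: integrate (x₁ - c)∂₁(v²) by parts. At each end either the weight or `v`
vanishes, so a condition at only one end is needed: c = L serves functions vanishing at the
entrance, c = 0 those vanishing at the exit. -/
theorem L2norm_le_of_sq_eq {L c : ℝ} (hL : 0 < L) {v : ℝ × ℝ → ℝ} (hv : ContDiffOn ℝ 1 v (OmBar L))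
    (hc : ∀ x ∈ Icc 0 L, |x - c| ≤ L)
    (hb : ∀ y ∈ Icc (-1 : ℝ) 1, (L - c) * v (L, y) = 0 ∧ (0 - c) * v (0, y) = 0) :
    L2norm L v ≤ 2 * L * L2norm L (pd L 0 v) := by
  have hv1 := continuousOn_pd hL hv 0
  have hid : ContinuousOn (fun z : ℝ × ℝ => z.1 - c) (OmBar L) := by fun_prop
  have h := integral_mul_pd_fst hL (P := fun x => x - c) (P' := fun _ => 1)
    (fun x _ => (hasDerivWithinAt_id x _).sub_const c) continuousOn_const (hv.mul hv)
  have hline : ∀ x, (∀ y ∈ Icc (-1 : ℝ) 1, (x - c) * v (x, y) = 0) →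
      (x - c) * ∫ y in (-1 : ℝ)..1, v (x, y) * v (x, y) = 0 := by
    intro x hx
    rw [← intervalIntegral.integral_const_mul]
    refine (intervalIntegral.integral_congr (g := fun _ => 0) fun y hy => ?_).trans (by simp)
    rw [uIcc_of_le (by norm_num)] at hy
    simp only [← mul_assoc, hx y hy, zero_mul]
  rw [hline L fun y hy => (hb y hy).1, hline 0 fun y hy => (hb y hy).2] at h
  have e1 : ∫ z in Om L, (z.1 - c) * pd L 0 (fun z => v z * v z) z =
      2 * ∫ z in Om L, (z.1 - c) * (v z * pd L 0 v z) := by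
    rw [← integral_const_mul]
    refine setIntegral_congr_fun (measurableSet_Om L) fun z hz => ?_
    have := pd_mul hL hv hv 0 (Om_subset_OmBar L hz)
    simp only [this]; ring
  have e2 : ∫ z in Om L, 1 * (v z * v z) = L2norm L v ^ 2 := by
    rw [L2norm_sq]; simp [sq]
  rw [e1, e2] at h
  have h3 := abs_integral_mul_mul_le_L2norm (b := fun z => z.1 - c) (B := L)
    (fun z hz => hc z.1 (Om_subset_OmBar L hz).1) (memLp_Om hv.continuousOn) (memLp_Om hv1)
  have h4 := neg_le_of_abs_le h3
  rcases (L2norm_nonneg L v).eq_or_lt with h0 | h0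
  · rw [← h0]
    have := L2norm_nonneg L (pd L 0 v)
    positivity
  · refine le_of_mul_le_mul_left ?_ h0
    nlinarith

theorem L2norm_le_of_entrance {L : ℝ} (hL : 0 < L) {v : ℝ × ℝ → ℝ}
    (hv : ContDiffOn ℝ 1 v (OmBar L)) (hb : ∀ y ∈ Icc (-1 : ℝ) 1, v (0, y) = 0) :
    L2norm L v ≤ 2 * L * L2norm L (pd L 0 v) :=
  L2norm_le_of_sq_eq (c := L) hL hv
    (fun x hx => by rw [abs_le]; constructor <;> linarith [hx.1, hx.2])
    fun y hy => ⟨by simp, by simp [hb y hy]⟩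

theorem L2norm_le_of_exit {L : ℝ} (hL : 0 < L) {v : ℝ × ℝ → ℝ}
    (hv : ContDiffOn ℝ 1 v (OmBar L)) (hb : ∀ y ∈ Icc (-1 : ℝ) 1, v (L, y) = 0) :
    L2norm L v ≤ 2 * L * L2norm L (pd L 0 v) :=
  L2norm_le_of_sq_eq (c := 0) hL hv
    (fun x hx => by rw [abs_le]; constructor <;> linarith [hx.1, hx.2])
    fun y hy => ⟨by simp [hb y hy], by simp⟩

/-! ### The energy estimate for the potential equation -/

/-- Test the equation with `w`: every boundary term vanishes, the c₀ term has the favourable sign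
and is dropped, and the Poincaré inequality from the exit replaces ‖w‖ by 2L‖∂₁w‖. The explicit
factor L is what later makes the coupling small. -/
theorem elliptic_energy_estimate {L B : ℝ} (hL : 0 < L) {c₀ c₁ f g w : ℝ × ℝ → ℝ}
    (hc₀ : ContinuousOn c₀ (OmBar L)) (hc₁ : ContinuousOn c₁ (OmBar L))
    (hc₀_nonneg : ∀ z ∈ OmBar L, 0 ≤ c₀ z) (hB : ∀ z ∈ OmBar L, |c₁ z| ≤ B)
    (hf : MemLp f 2 (volume.restrict (Om L))) (hg : ContinuousOn g (OmBar L))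
    (hw : ContDiffOn ℝ 2 w (OmBar L))
    (heq : ∀ᵐ z ∂(volume.restrict (Om L)),
      pd L 0 (pd L 0 w) z + pd L 1 (pd L 1 w) z - c₀ z * w z - c₁ z * g z = f z)
    (hent : ∀ y ∈ Icc (-1 : ℝ) 1, pd L 0 w (0, y) = 0)
    (hwall : ∀ x ∈ Ioo 0 L, ∀ y ∈ ({-1, 1} : Set ℝ), pd L 1 w (x, y) = 0)
    (hexit : ∀ y ∈ Icc (-1 : ℝ) 1, w (L, y) = 0) :
    L2norm L (pd L 0 w) ^ 2 + L2norm L (pd L 1 w) ^ 2 ≤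
      (B * L2norm L g + L2norm L f) * (2 * L * L2norm L (pd L 0 w)) := by
  have hw1 : ContDiffOn ℝ 1 w (OmBar L) := hw.of_le (by norm_num)
  have hp0 := contDiffOn_pd hL hw 0
  have hp1 := contDiffOn_pd hL hw 1
  have cw := hw.continuousOn
  have c0 := hp0.continuousOn
  have c1 := hp1.continuousOn
  have c00 := continuousOn_pd hL hp0 0
  have c11 := continuousOn_pd hL hp1 1
  have hpo := L2norm_le_of_exit hL hw1 hexit
  -- the two divergence terms vanish
  have i0 : ∫ z in Om L, pd L 0 (fun z => w z * pd L 0 w z) z = 0 := by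
    have h := integral_mul_pd_fst hL (P := fun _ => 1) (P' := fun _ => 0)
      (fun x _ => hasDerivWithinAt_const x _ _) continuousOn_const (hw1.mul hp0)
    simp only [one_mul, zero_mul, integral_zero, sub_zero] at h
    have hl : ∀ x, (∀ y ∈ Icc (-1 : ℝ) 1, w (x, y) * pd L 0 w (x, y) = 0) →
        ∫ y in (-1 : ℝ)..1, w (x, y) * pd L 0 w (x, y) = 0 := fun x hx =>
      (intervalIntegral.integral_congr (g := fun _ => 0) fun y hy => hx y (by
        rwa [uIcc_of_le (by norm_num)] at hy)).trans (by simp)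
    rw [hl L fun y hy => by rw [hexit y hy, zero_mul],
      hl 0 fun y hy => by rw [hent y hy, mul_zero], sub_zero] at h
    exact h
  have i1 : ∫ z in Om L, pd L 1 (fun z => w z * pd L 1 w z) z = 0 := by
    have h := integral_mul_pd_snd hL (P := fun _ => 1) continuousOn_const (hw1.mul hp1)
      (fun x hx y hy => by simp [hwall x hx y hy])
    simpa only [one_mul] using h
  have hFw : ∫ z in Om L, f z * w z =
      ∫ z in Om L, (pd L 0 (fun z => w z * pd L 0 w z) z +
        pd L 1 (fun z => w z * pd L 1 w z) z - pd L 0 w z ^ 2 - pd L 1 w z ^ 2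
        - c₀ z * w z ^ 2 - c₁ z * (g z * w z)) := by
    refine integral_congr_ae ?_
    filter_upwards [heq, ae_restrict_mem (measurableSet_Om L)] with z hz hzm
    rw [pd_mul hL hw1 hp0 0 (Om_subset_OmBar L hzm), pd_mul hL hw1 hp1 1 (Om_subset_OmBar L hzm),
      ← hz]
    ring
  have j0 : ContinuousOn (fun z => pd L 0 (fun z => w z * pd L 0 w z) z) (OmBar L) :=
    continuousOn_pd hL (hw1.mul hp0) 0
  have j1 : ContinuousOn (fun z => pd L 1 (fun z => w z * pd L 1 w z) z) (OmBar L) :=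
    continuousOn_pd hL (hw1.mul hp1) 1
  rw [integral_sub, integral_sub, integral_sub, integral_sub, integral_add, i0, i1,
    ← L2norm_sq, ← L2norm_sq] at hFw
  rotate_left
  iterate 10 exact integrableOn_Om (by fun_prop)
  have hpos : 0 ≤ ∫ z in Om L, c₀ z * w z ^ 2 := by
    refine setIntegral_nonneg (measurableSet_Om L) fun z hz => ?_
    exact mul_nonneg (hc₀_nonneg _ (Om_subset_OmBar L hz)) (sq_nonneg _)
  have b1 := neg_le_of_abs_le <| abs_integral_mul_mul_le_L2norm (b := c₁) (B := B)
    (fun z hz => hB z (Om_subset_OmBar L hz)) (memLp_Om hg) (memLp_Om cw)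
  have b2 := neg_le_of_abs_le <| abs_integral_mul_le_L2norm hf (memLp_Om cw)
  have hB0 : 0 ≤ B := (abs_nonneg _).trans (hB (0, 0) (by simp [OmBar, hL.le]))
  have hng := L2norm_nonneg L g
  have hnf := L2norm_nonneg L f
  calc _ ≤ (B * L2norm L g + L2norm L f) * L2norm L w := by linarith
    _ ≤ _ := by gcongr

/-! ### The energy estimate for the mixed-type equation -/

/-- The derivative is tangential to the entrance. It removes the boundary term in (∂₂v)² there,
which would otherwise enter with the wrong sign. -/
theorem pd_snd_eq_zero_of_entrance {L : ℝ} (hL : 0 < L) {v : ℝ × ℝ → ℝ}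
    (hv : ContDiffOn ℝ 1 v (OmBar L)) (hent : ∀ y ∈ Icc (-1 : ℝ) 1, v (0, y) = 0) :
    ∀ y ∈ Icc (-1 : ℝ) 1, pd L 1 v (0, y) = 0 := by
  intro y hy
  have h1 := hasDerivWithinAt_snd hv (x := 0) ⟨le_rfl, hL.le⟩ hy
  have h2 : HasDerivWithinAt (fun t => v (0, t)) 0 (Icc (-1) 1) y :=
    (hasDerivWithinAt_const y _ (0 : ℝ)).congr hent (hent y hy)
  exact (uniqueDiffOn_Icc (by norm_num) y hy).eq_deriv _ h1 h2

theorem line_integral_congr_zero {x : ℝ} {q : ℝ × ℝ → ℝ}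
    (h : ∀ y ∈ Icc (-1 : ℝ) 1, q (x, y) = 0) : ∫ y in (-1 : ℝ)..1, q (x, y) = 0 :=
  (intervalIntegral.integral_congr (g := fun _ => 0) fun y hy => h y (by
    rwa [uIcc_of_le (by norm_num)] at hy)).trans (by simp)

/-- Multiply by ∂₁v and integrate. The signs of `P` at the two ends and of `G` at the exit make all
background boundary terms coercive, the slope -μ of `G` yields (∂₂v)², and `hk` yields (∂₁v)². The
Lipschitz perturbations contribute only the terms with `ε`. -/
theorem mixed_energy_estimate {L β μ k ε B₀ B₁ : ℝ} (hL : 0 < L) (hε : 0 ≤ ε)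
    {P P' G : ℝ → ℝ} {a b₀ b₁ p₁₁ p₁₂ p₂₂ f v w : ℝ × ℝ → ℝ}
    (hP : ∀ x ∈ Icc 0 L, HasDerivWithinAt P (P' x) (Icc 0 L) x) (hP' : ContinuousOn P' (Icc 0 L))
    (hG : ∀ x ∈ Icc 0 L, HasDerivWithinAt G (-μ) (Icc 0 L) x)
    (hP0 : β ≤ P 0) (hPL : P L ≤ -β) (hGL : β ≤ G L)
    (ha : ContinuousOn a (OmBar L)) (hb₀ : ContinuousOn b₀ (OmBar L))
    (hb₁ : ContinuousOn b₁ (OmBar L))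
    (hk : ∀ z ∈ Om L, k ≤ P' z.1 / 2 - a z)
    (hB₀ : ∀ z ∈ OmBar L, |b₀ z| ≤ B₀) (hB₁ : ∀ z ∈ OmBar L, |b₁ z| ≤ B₁)
    (hp₁₁ : LipBdd L ε p₁₁) (hp₁₂ : LipBdd L ε p₁₂) (hp₂₂ : LipBdd L ε p₂₂)
    (hp₁₂w : ∀ x ∈ Ioo 0 L, ∀ y ∈ ({-1, 1} : Set ℝ), p₁₂ (x, y) = 0)
    (hf : MemLp f 2 (volume.restrict (Om L)))
    (hv : ContDiffOn ℝ 2 v (OmBar L)) (hw : ContDiffOn ℝ 2 w (OmBar L))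
    (heq : ∀ᵐ z ∂(volume.restrict (Om L)),
      (P z.1 + p₁₁ z) * pd L 0 (pd L 0 v) z + 2 * p₁₂ z * pd L 1 (pd L 0 v) z +
        (G z.1 + p₂₂ z) * pd L 1 (pd L 1 v) z + a z * pd L 0 v z + b₁ z * pd L 0 w z +
        b₀ z * w z = f z)
    (hent : ∀ y ∈ Icc (-1 : ℝ) 1, v (0, y) = 0)
    (hwall : ∀ x ∈ Ioo 0 L, ∀ y ∈ ({-1, 1} : Set ℝ), pd L 1 v (x, y) = 0) :
    β / 2 * (L2line 0 (pd L 0 v) ^ 2 + L2line L (pd L 0 v) ^ 2 + L2line L (pd L 1 v) ^ 2) +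
        μ / 2 * L2norm L (pd L 1 v) ^ 2 + k * L2norm L (pd L 0 v) ^ 2 ≤
      B₁ * (L2norm L (pd L 0 w) * L2norm L (pd L 0 v)) +
        B₀ * (L2norm L w * L2norm L (pd L 0 v)) +
        2 * ε * (L2line 0 (pd L 0 v) ^ 2 + L2line L (pd L 0 v) ^ 2 + L2line L (pd L 1 v) ^ 2 +
          L2norm L (pd L 0 v) ^ 2 + L2norm L (pd L 1 v) ^ 2) +
        L2norm L f * L2norm L (pd L 0 v) := by
  have hw1 : ContDiffOn ℝ 1 w (OmBar L) := hw.of_le (by norm_num)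
  have hv1 : ContDiffOn ℝ 1 v (OmBar L) := hv.of_le (by norm_num)
  have d0 := contDiffOn_pd hL hv 0
  have d1 := contDiffOn_pd hL hv 1
  have cw := hw.continuousOn
  have cw0 := continuousOn_pd hL hw1 0
  have cv0 := d0.continuousOn
  have cv1 := d1.continuousOn
  have hPc : ContinuousOn P (Icc 0 L) := fun x hx => (hP x hx).continuousWithinAt
  have hGc : ContinuousOn G (Icc 0 L) := fun x hx => (hG x hx).continuousWithinAt
  have lift : ∀ {Q : ℝ → ℝ}, ContinuousOn Q (Icc 0 L) →
      ContinuousOn (fun z : ℝ × ℝ => Q z.1) (OmBar L) := fun hQ =>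
    hQ.comp continuousOn_fst fun z hz => hz.1
  have cP' := lift hP'
  have c₁₁ := hp₁₁.continuousOn
  have c₁₂ := hp₁₂.continuousOn
  have c₂₂ := hp₂₂.continuousOn
  set q₁₁ : ℝ × ℝ → ℝ := fun z => pd L 0 v z * pd L 0 v z with hq₁₁
  set q₁₂ : ℝ × ℝ → ℝ := fun z => pd L 1 v z * pd L 0 v z with hq₁₂
  set q₂₂ : ℝ × ℝ → ℝ := fun z => pd L 1 v z * pd L 1 v z with hq₂₂
  have D₁₁ : ContDiffOn ℝ 1 q₁₁ (OmBar L) := d0.mul d0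
  have D₁₂ : ContDiffOn ℝ 1 q₁₂ (OmBar L) := d1.mul d0
  have D₂₂ : ContDiffOn ℝ 1 q₂₂ (OmBar L) := d1.mul d1
  have cq₁₁ := D₁₁.continuousOn
  have r₁₁ : ∀ i, ContinuousOn (pd L i q₁₁) (OmBar L) := continuousOn_pd hL D₁₁
  have r₁₂ : ∀ i, ContinuousOn (pd L i q₁₂) (OmBar L) := continuousOn_pd hL D₁₂
  have r₂₂ : ∀ i, ContinuousOn (pd L i q₂₂) (OmBar L) := continuousOn_pd hL D₂₂
  -- Each second-order term becomes a derivative of a quadratic: v₁₁v₁ = ½∂₁(v₁²), 2v₁₂v₁ = ∂₂(v₁²),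
  -- and v₂₂v₁ = ∂₂(v₁v₂) - ½∂₁(v₂²).
  have hFv : ∫ z in Om L, f z * pd L 0 v z =
      ∫ z in Om L, (1 / 2 * (P z.1 * pd L 0 q₁₁ z) + 1 / 2 * (p₁₁ z * pd L 0 q₁₁ z) +
        p₁₂ z * pd L 1 q₁₁ z + G z.1 * pd L 1 q₁₂ z + p₂₂ z * pd L 1 q₁₂ z
        + -1 / 2 * (G z.1 * pd L 0 q₂₂ z) + -1 / 2 * (p₂₂ z * pd L 0 q₂₂ z) + a z * q₁₁ z +
        b₁ z * (pd L 0 w z * pd L 0 v z) + b₀ z * (w z * pd L 0 v z)) := by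
    refine integral_congr_ae ?_
    filter_upwards [heq, ae_restrict_mem (measurableSet_Om L)] with z hz hzm
    have hz' := Om_subset_OmBar L hzm
    rw [hq₁₁, hq₁₂, hq₂₂, pd_mul hL d0 d0 0 hz', pd_mul hL d0 d0 1 hz', pd_mul hL d1 d0 1 hz',
      pd_mul hL d1 d1 0 hz', ← hz, pd_comm hL hv hzm 0 1]
    ring
  have s1 : ContinuousOn (fun z => P z.1 * pd L 0 q₁₁ z) (OmBar L) := (lift hPc).mul (r₁₁ 0)
  have s2 : ContinuousOn (fun z => p₁₁ z * pd L 0 q₁₁ z) (OmBar L) := c₁₁.mul (r₁₁ 0)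
  have s3 : ContinuousOn (fun z => p₁₂ z * pd L 1 q₁₁ z) (OmBar L) := c₁₂.mul (r₁₁ 1)
  have s4 : ContinuousOn (fun z => G z.1 * pd L 1 q₁₂ z) (OmBar L) := (lift hGc).mul (r₁₂ 1)
  have s5 : ContinuousOn (fun z => p₂₂ z * pd L 1 q₁₂ z) (OmBar L) := c₂₂.mul (r₁₂ 1)
  have s6 : ContinuousOn (fun z => G z.1 * pd L 0 q₂₂ z) (OmBar L) := (lift hGc).mul (r₂₂ 0)
  have s7 : ContinuousOn (fun z => p₂₂ z * pd L 0 q₂₂ z) (OmBar L) := c₂₂.mul (r₂₂ 0)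
  have t1 := (integrableOn_Om s1).const_mul (1 / 2 : ℝ)
  have t2 := (integrableOn_Om s2).const_mul (1 / 2 : ℝ)
  have t6 := (integrableOn_Om s6).const_mul (-1 / 2 : ℝ)
  have t7 := (integrableOn_Om s7).const_mul (-1 / 2 : ℝ)
  have t3 := integrableOn_Om s3
  have t4 := integrableOn_Om s4
  have t5 := integrableOn_Om s5
  have t8 : IntegrableOn (fun z => a z * q₁₁ z) (Om L) := integrableOn_Om (by fun_prop)
  have t9 : IntegrableOn (fun z => b₁ z * (pd L 0 w z * pd L 0 v z)) (Om L) :=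
    integrableOn_Om (by fun_prop)
  have t10 : IntegrableOn (fun z => b₀ z * (w z * pd L 0 v z)) (Om L) :=
    integrableOn_Om (by fun_prop)
  have t12 := Integrable.fun_add t1 t2
  have t13 := Integrable.fun_add t12 t3
  have t14 := Integrable.fun_add t13 t4
  have t15 := Integrable.fun_add t14 t5
  have t16 := Integrable.fun_add t15 t6
  have t17 := Integrable.fun_add t16 t7
  have t18 := Integrable.fun_add t17 t8
  have t19 := Integrable.fun_add t18 t9
  rw [integral_add t19 t10, integral_add t18 t9, integral_add t17 t8, integral_add t16 t7,
    integral_add t15 t6, integral_add t14 t5, integral_add t13 t4, integral_add t12 t3,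
    integral_add t1 t2, integral_const_mul, integral_const_mul, integral_const_mul,
    integral_const_mul] at hFv
  have e1 := integral_mul_pd_fst hL hP hP' D₁₁
  have e2 := integral_mul_pd_fst hL hG continuousOn_const D₂₂
  have e3 := integral_mul_pd_snd hL hGc D₁₂
    (fun x hx y hy => by simp [hq₁₂, hwall x hx y hy])
  rw [line_integral_congr_zero (q := q₂₂) (x := 0)
    (fun y hy => by simp [hq₂₂, pd_snd_eq_zero_of_entrance hL hv1 hent y hy]),
    integral_const_mul] at e2
  have E1 := abs_integral_lipBdd_mul_pd_fst_le hL hε hp₁₁ D₁₁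
  have E2 := abs_integral_lipBdd_mul_pd_snd_le hL hε hp₁₂ D₁₁
    (fun x hx y hy => by simp [hp₁₂w x hx y hy])
  -- Here the wall term dies because ∂₂v = 0, whereas for the mixed coefficient in `E2` it is the
  -- coefficient itself that vanishes.
  have E3 := abs_integral_lipBdd_mul_pd_snd_le hL hε hp₂₂ D₁₂
    (fun x hx y hy => by simp [hq₁₂, hwall x hx y hy])
  have E4 := abs_integral_lipBdd_mul_pd_fst_le hL hε hp₂₂ D₂₂
  have a₁₁ : ∀ z, |q₁₁ z| = q₁₁ z := fun z => abs_of_nonneg (mul_self_nonneg _)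
  have a₂₂ : ∀ z, |q₂₂ z| = q₂₂ z := fun z => abs_of_nonneg (mul_self_nonneg _)
  simp only [a₁₁, a₂₂] at E1 E2 E4
  rw [line_integral_congr_zero (q := q₂₂) (x := 0)
    (fun y hy => by simp [hq₂₂, pd_snd_eq_zero_of_entrance hL hv1 hent y hy])] at E4
  have l0 : ∫ y in (-1 : ℝ)..1, q₁₁ (0, y) = L2line 0 (pd L 0 v) ^ 2 := by
    rw [L2line_sq]; simp only [hq₁₁, sq]
  have l1 : ∫ y in (-1 : ℝ)..1, q₁₁ (L, y) = L2line L (pd L 0 v) ^ 2 := by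
    rw [L2line_sq]; simp only [hq₁₁, sq]
  have l2 : ∫ y in (-1 : ℝ)..1, q₂₂ (L, y) = L2line L (pd L 1 v) ^ 2 := by
    rw [L2line_sq]; simp only [hq₂₂, sq]
  have n1 : ∫ z in Om L, q₁₁ z = L2norm L (pd L 0 v) ^ 2 := by
    rw [L2norm_sq]; simp only [hq₁₁, sq]
  have n2 : ∫ z in Om L, q₂₂ z = L2norm L (pd L 1 v) ^ 2 := by
    rw [L2norm_sq]; simp only [hq₂₂, sq]
  have n3 : ∫ z in Om L, |q₁₂ z| ≤ L2norm L (pd L 1 v) * L2norm L (pd L 0 v) :=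
    integral_abs_mul_le_L2norm (memLp_Om cv1) (memLp_Om cv0)
  have cP'q : ContinuousOn (fun z => P' z.1 * q₁₁ z) (OmBar L) := cP'.mul cq₁₁
  have t11 := (integrableOn_Om cP'q).const_mul (1 / 2 : ℝ)
  have hK : k * ∫ z in Om L, q₁₁ z ≤
      1 / 2 * (∫ z in Om L, P' z.1 * q₁₁ z) - ∫ z in Om L, a z * q₁₁ z := by
    rw [← integral_const_mul, ← integral_const_mul, ← integral_sub t11 t8]
    refine setIntegral_mono_on (integrableOn_Om (by fun_prop)) (t11.sub t8)
      (measurableSet_Om L) fun z hz => ?_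
    have := mul_le_mul_of_nonneg_right (hk z hz) (mul_self_nonneg (pd L 0 v z))
    simp only [hq₁₁]
    linarith
  have S1 := le_of_abs_le <| abs_integral_mul_mul_le_L2norm (b := b₁) (B := B₁)
    (fun z hz => hB₁ z (Om_subset_OmBar L hz)) (memLp_Om cw0) (memLp_Om cv0)
  have S0 := le_of_abs_le <| abs_integral_mul_mul_le_L2norm (b := b₀) (B := B₀)
    (fun z hz => hB₀ z (Om_subset_OmBar L hz)) (memLp_Om cw) (memLp_Om cv0)
  have SF := neg_le_of_abs_le <| abs_integral_mul_le_L2norm hf (memLp_Om cv0)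
  rw [l0, l1] at e1 E1
  rw [n1] at E1
  rw [n1] at E2 hK
  rw [l2, n2] at e2 E4
  have E3' := E3.trans (mul_le_mul_of_nonneg_left n3 hε)
  have h1 := le_of_abs_le E1
  have h2 := le_of_abs_le E2
  have h3 := le_of_abs_le E3'
  have h4 := neg_le_of_abs_le E4
  rw [e1, e2, e3] at hFv
  have m0 := mul_le_mul_of_nonneg_right hP0 (sq_nonneg (L2line 0 (pd L 0 v)))
  have m1 := mul_le_mul_of_nonneg_right hPL (sq_nonneg (L2line L (pd L 0 v)))
  have m2 := mul_le_mul_of_nonneg_right hGL (sq_nonneg (L2line L (pd L 1 v)))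
  -- Splits the product ‖∂₂v‖‖∂₁v‖ from `E3`. Counting all errors, ‖∂₁v‖² receives ½ + 1 + ½ = 2
  -- times `ε`, the largest coefficient.
  have y1 := mul_nonneg hε (sq_nonneg (L2norm L (pd L 1 v) - L2norm L (pd L 0 v)))
  have y2 := mul_nonneg hε (sq_nonneg (L2line 0 (pd L 0 v)))
  have y3 := mul_nonneg hε (sq_nonneg (L2line L (pd L 0 v)))
  have y4 := mul_nonneg hε (sq_nonneg (L2line L (pd L 1 v)))
  have y5 := mul_nonneg hε (sq_nonneg (L2norm L (pd L 1 v)))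
  nlinarith

set_option maxHeartbeats 1000000 in
/-- The elementary inequality that closes the coupled energy estimates. -/
theorem coupled_closure {β μ k ε D M B₃ X V W W₂ c₁ c₂ c₃ f g : ℝ}
    (hβ : 0 < β) (hμ : 0 < μ) (hk : 0 < k) (hD : 0 ≤ D) (hM : 0 ≤ M) (hB₃ : 0 ≤ B₃)
    (hεβ : 8 * ε ≤ β) (hεμ : 8 * ε ≤ μ) (hεk : 8 * ε ≤ k) (hsmall : D * M * B₃ ≤ k / 4)
    (hX : 0 ≤ X) (hV : 0 ≤ V) (hW : 0 ≤ W) (hW₂ : 0 ≤ W₂) (hc₁ : 0 ≤ c₁) (hc₂ : 0 ≤ c₂)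
    (hc₃ : 0 ≤ c₃) (hf : 0 ≤ f) (hg : 0 ≤ g)
    (h₁ : β / 2 * (c₁ ^ 2 + c₂ ^ 2 + c₃ ^ 2) + μ / 2 * V ^ 2 + k * X ^ 2 ≤
      D * W * X + 2 * ε * (c₁ ^ 2 + c₂ ^ 2 + c₃ ^ 2 + X ^ 2 + V ^ 2) + f * X)
    (h₂ : W ^ 2 + W₂ ^ 2 ≤ (B₃ * X + g) * (M * W)) :
    c₁ + c₂ + c₃ + X + V + W + W₂ ≤
      ((9 / √(β * k) + 3 / √(μ * k) + 2 / k) * (1 + D * M) +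
        2 * M * (B₃ * (2 / k * (1 + D * M)) + 1)) * (f + g) := by
  obtain ⟨T, hT⟩ : ∃ T, T = B₃ * X + g := ⟨_, rfl⟩
  rw [← hT] at h₂
  have hT0 : 0 ≤ T := by rw [hT]; positivity
  -- Divide the elliptic estimate by `W`; the case `W = 0` is trivial.
  have hWle : W ≤ M * T := by
    rcases hW.eq_or_lt with h0 | h0
    · rw [← h0]; positivity
    · nlinarith [sq_nonneg W₂]
  have hW₂le : W₂ ≤ M * T := by
    have h3 : W₂ ^ 2 ≤ (M * T) ^ 2 := by
      have : W₂ ^ 2 ≤ T * (M * W) := by nlinarith [sq_nonneg W]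
      have h4 : T * (M * W) ≤ T * (M * (M * T)) := by gcongr
      nlinarith
    exact (sq_le_sq₀ hW₂ (by positivity)).1 h3
  obtain ⟨S, hS⟩ : ∃ S, S = (1 + D * M) * (f + g) := ⟨_, rfl⟩
  have hDM : 0 ≤ D * M := by positivity
  have hS0 : 0 ≤ S := by rw [hS]; positivity
  have hDg : D * M * g + f ≤ S := by rw [hS]; nlinarith [mul_nonneg hDM hf]
  -- The coupling is absorbed here: substituting the bound for `W` leaves `D * M * B₃ * X²`, at most
  -- a quarter of the coercive term. The `ε` terms take another quarter, leaving k/2.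
  have hDWX : D * W * X ≤ k / 4 * X ^ 2 + D * M * g * X := by
    have h5 : D * W * X ≤ D * (M * T) * X := by gcongr
    have h6 : D * M * B₃ * X ^ 2 ≤ k / 4 * X ^ 2 := by gcongr
    have h7 : D * (M * T) * X = D * M * B₃ * X ^ 2 + D * M * g * X := by rw [hT]; ring
    linarith
  have hmain : β / 4 * (c₁ ^ 2 + c₂ ^ 2 + c₃ ^ 2) + μ / 4 * V ^ 2 + k / 2 * X ^ 2 ≤ S * X := by
    have h7 : (D * M * g + f) * X ≤ S * X := by gcongr
    rw [add_mul] at h7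
    have h8 := mul_le_mul_of_nonneg_right hεβ (by positivity : 0 ≤ c₁ ^ 2 + c₂ ^ 2 + c₃ ^ 2)
    have h9 := mul_le_mul_of_nonneg_right hεμ (sq_nonneg V)
    have h10 := mul_le_mul_of_nonneg_right hεk (sq_nonneg X)
    linarith
  have hXle : X ≤ 2 / k * S := by
    rcases hX.eq_or_lt with h0 | h0
    · rw [← h0]; positivity
    · have : k / 2 * X ^ 2 ≤ S * X := le_trans (by
        have : 0 ≤ β / 4 * (c₁ ^ 2 + c₂ ^ 2 + c₃ ^ 2) + μ / 4 * V ^ 2 := by positivity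
        linarith) hmain
      have h11 : k / 2 * X ≤ S := by nlinarith
      rw [div_mul_eq_mul_div, le_div_iff₀ hk]; linarith
  have hSX : S * X ≤ 2 / k * S ^ 2 := by
    calc S * X ≤ S * (2 / k * S) := by gcongr
      _ = _ := by ring
  -- The constant 3 is a convenient upper bound for √8.
  have hroot : ∀ {c r : ℝ}, 0 ≤ c → 0 < r → r / 4 * c ^ 2 ≤ 2 / k * S ^ 2 →
      c ≤ 3 / √(r * k) * S := by
    intro c r hc hr h
    have hs : 0 < √(r * k) := Real.sqrt_pos.2 (by positivity)
    have hs2 : √(r * k) ^ 2 = r * k := Real.sq_sqrt (by positivity)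
    rw [div_mul_eq_mul_div, le_div_iff₀ hs]
    refine (sq_le_sq₀ (by positivity) (by positivity)).1 ?_
    rw [mul_pow, hs2]
    have : c ^ 2 * (r * k) = 4 * k * (r / 4 * c ^ 2) := by ring
    rw [this]
    calc 4 * k * (r / 4 * c ^ 2) ≤ 4 * k * (2 / k * S ^ 2) := by gcongr
      _ = 8 * S ^ 2 := by field_simp; ring
      _ ≤ (3 * S) ^ 2 := by nlinarith [sq_nonneg S]
  have hsum : β / 4 * (c₁ ^ 2 + c₂ ^ 2 + c₃ ^ 2) + μ / 4 * V ^ 2 ≤ 2 / k * S ^ 2 := by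
    have : 0 ≤ k / 2 * X ^ 2 := by positivity
    linarith
  have p₁ : 0 ≤ β / 4 * c₁ ^ 2 := by positivity
  have p₂ : 0 ≤ β / 4 * c₂ ^ 2 := by positivity
  have p₃ : 0 ≤ β / 4 * c₃ ^ 2 := by positivity
  have p₄ : 0 ≤ μ / 4 * V ^ 2 := by positivity
  have l₁ := hroot hc₁ hβ (by linarith)
  have l₂ := hroot hc₂ hβ (by linarith)
  have l₃ := hroot hc₃ hβ (by linarith)
  have l₄ := hroot hV hμ (by linarith)
  have hTle : T ≤ (B₃ * (2 / k * (1 + D * M)) + 1) * (f + g) := by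
    have : B₃ * X ≤ B₃ * (2 / k * S) := by gcongr
    have h12 : B₃ * (2 / k * S) = B₃ * (2 / k * (1 + D * M)) * (f + g) := by rw [hS]; ring
    rw [hT]
    linarith
  have hMT : M * T ≤ M * ((B₃ * (2 / k * (1 + D * M)) + 1) * (f + g)) := by gcongr
  calc c₁ + c₂ + c₃ + X + V + W + W₂ ≤
        9 / √(β * k) * S + 3 / √(μ * k) * S + 2 / k * S +
          2 * (M * ((B₃ * (2 / k * (1 + D * M)) + 1) * (f + g))) := by
        have : 9 / √(β * k) * S = 3 * (3 / √(β * k) * S) := by ring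
        linarith
    _ = _ := by rw [hS]; ring

/-! ### Weak derivatives -/

theorem contDiff_tpd {η : ℝ × ℝ → ℝ} (hη : ContDiff ℝ ∞ η) (i : Fin 2) : ContDiff ℝ ∞ (tpd i η) :=
  (hη.fderiv_right (m := ∞) (by simp)).clm_apply contDiff_const

theorem hasCompactSupport_tpd {η : ℝ × ℝ → ℝ} (hη : HasCompactSupport η) (i : Fin 2) :
    HasCompactSupport (tpd i η) :=
  hη.fderiv_apply (𝕜 := ℝ) (e i)

theorem tsupport_tpd_subset (η : ℝ × ℝ → ℝ) (i : Fin 2) : tsupport (tpd i η) ⊆ tsupport η :=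
  tsupport_fderiv_apply_subset ℝ (e i)

theorem tpd_comm {η : ℝ × ℝ → ℝ} (hη : ContDiff ℝ ∞ η) (i j : Fin 2) :
    tpd i (tpd j η) = tpd j (tpd i η) := by
  have key : ∀ i j x, tpd i (tpd j η) x = fderiv ℝ (fderiv ℝ η) x (e i) (e j) := by
    intro i j x
    have hd : DifferentiableAt ℝ (fderiv ℝ η) x :=
      ((hη.fderiv_right (m := ∞) (by simp)).differentiable (by simp)) x
    have := fderiv_clm_apply hd (differentiableAt_const (e j))
    unfold tpd
    rw [this]
    simp
  ext x
  rw [key, key]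
  exact ((contDiff_infty.1 hη 2).contDiffAt.isSymmSndFDerivAt (by simp)) _ _

theorem contDiff_tpd_iterate {η : ℝ × ℝ → ℝ} (hη : ContDiff ℝ ∞ η) (i : Fin 2) (b : ℕ) :
    ContDiff ℝ ∞ ((tpd i)^[b] η) := by
  induction b with
  | zero => simpa
  | succ b ih => rw [Function.iterate_succ_apply']; exact contDiff_tpd ih i

theorem tpd_iterate_comm {η : ℝ × ℝ → ℝ} (hη : ContDiff ℝ ∞ η) (i j : Fin 2) (b : ℕ) :
    (tpd i)^[b] (tpd j η) = tpd j ((tpd i)^[b] η) := by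
  induction b with
  | zero => simp
  | succ b ih =>
    rw [Function.iterate_succ_apply', ih, Function.iterate_succ_apply',
      tpd_comm (contDiff_tpd_iterate hη i b)]

/-- The fundamental lemma of the calculus of variations. It makes the arbitrary choice inside `wpd`
harmless. -/
theorem IsWeakPartial.ae_eq {L : ℝ} {a b : ℕ} {f g h : ℝ × ℝ → ℝ}
    (hg : MemLp g 2 (volume.restrict (Om L))) (hh : MemLp h 2 (volume.restrict (Om L)))
    (h₁ : IsWeakPartial L a b f g) (h₂ : IsWeakPartial L a b f h) :
    g =ᵐ[volume.restrict (Om L)] h := by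
  have hgi : IntegrableOn g (Om L) := hg.integrable (by norm_num)
  have hhi : IntegrableOn h (Om L) := hh.integrable (by norm_num)
  have key := (isOpen_Om L).ae_eq_zero_of_integral_contDiff_smul_eq_zero
    (f := fun x => g x - h x) (hgi.sub hhi).locallyIntegrableOn (μ := volume) ?_
  · rw [Filter.EventuallyEq, ae_restrict_iff' (measurableSet_Om L)]
    filter_upwards [key] with x hx hm
    linarith [hx hm]
  · intro η hη hc hs
    have e := (h₁ η hη hc hs).symm.trans (h₂ η hη hc hs)
    have e' : ∫ x in Om L, g x * η x = ∫ x in Om L, h x * η x :=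
      mul_left_cancel₀ (pow_ne_zero _ (by norm_num)) e
    obtain ⟨C, hC⟩ := hη.continuous.bounded_above_of_compact_support hc
    have hηm : AEStronglyMeasurable η (volume.restrict (Om L)) :=
      hη.continuous.aestronglyMeasurable
    have ig : IntegrableOn (fun x => g x * η x) (Om L) :=
      Integrable.mul_bdd hgi hηm (Eventually.of_forall hC)
    have ih : IntegrableOn (fun x => h x * η x) (Om L) :=
      Integrable.mul_bdd hhi hηm (Eventually.of_forall hC)
    have e1 : ∫ x, η x • (g x - h x) = ∫ x in Om L, (g x * η x - h x * η x) := by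
      rw [← setIntegral_eq_integral_of_forall_compl_eq_zero (s := Om L)]
      · refine integral_congr_ae (Eventually.of_forall fun x => ?_)
        simp only [smul_eq_mul]; ring
      · intro x hx
        have : η x = 0 := by
          by_contra hne
          exact hx (hs (subset_tsupport η hne))
        simp [this]
    rw [e1, integral_sub ig ih, e', sub_self]

theorem isWeakPartial_zero (L : ℝ) (f : ℝ × ℝ → ℝ) : IsWeakPartial L 0 0 f f := by
  intro η _ _ _; simp

theorem wpd_spec {L : ℝ} {a b : ℕ} {f g : ℝ × ℝ → ℝ}
    (hg : MemLp g 2 (volume.restrict (Om L))) (h : IsWeakPartial L a b f g) :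
    MemLp (wpd L a b f) 2 (volume.restrict (Om L)) ∧ IsWeakPartial L a b f (wpd L a b f) := by
  have hex : ∃ g, MemLp g 2 (volume.restrict (Om L)) ∧ IsWeakPartial L a b f g := ⟨g, hg, h⟩
  rw [wpd, dif_pos hex]
  exact hex.choose_spec

theorem wpd_ae_eq {L : ℝ} {a b : ℕ} {f g : ℝ × ℝ → ℝ}
    (hg : MemLp g 2 (volume.restrict (Om L))) (h : IsWeakPartial L a b f g) :
    wpd L a b f =ᵐ[volume.restrict (Om L)] g :=
  (wpd_spec hg h).2.ae_eq (wpd_spec hg h).1 hg h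

theorem L2norm_congr {L : ℝ} {f g : ℝ × ℝ → ℝ} (h : f =ᵐ[volume.restrict (Om L)] g) :
    L2norm L f = L2norm L g := by
  unfold L2norm
  congr 1
  refine integral_congr_ae ?_
  filter_upwards [h] with x hx
  rw [hx]

theorem MemH.memLp_wpd {L : ℝ} {k : ℕ} {f : ℝ × ℝ → ℝ} (hf : MemH L k f) {a b : ℕ}
    (hab : a + b ≤ k) : MemLp (wpd L a b f) 2 (volume.restrict (Om L)) := by
  obtain ⟨g, hg, h⟩ := hf.2 a b hab
  exact (wpd_spec hg h).1

theorem MemH.isWeakPartial_wpd {L : ℝ} {k : ℕ} {f : ℝ × ℝ → ℝ} (hf : MemH L k f) {a b : ℕ}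
    (hab : a + b ≤ k) : IsWeakPartial L a b f (wpd L a b f) := by
  obtain ⟨g, hg, h⟩ := hf.2 a b hab
  exact (wpd_spec hg h).2

theorem L2norm_wpd_le_Hnorm {L : ℝ} {k : ℕ} (f : ℝ × ℝ → ℝ) {a b : ℕ} (hab : a + b ≤ k) :
    L2norm L (wpd L a b f) ≤ Hnorm L k f := by
  refine Real.le_sqrt_of_sq_le ?_
  have h1 : L2norm L (wpd L a b f) ^ 2 ≤
      ∑ p ∈ Finset.HasAntidiagonal.antidiagonal (a + b), L2norm L (wpd L p.1 p.2 f) ^ 2 :=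
    Finset.single_le_sum (f := fun p : ℕ × ℕ => L2norm L (wpd L p.1 p.2 f) ^ 2)
      (fun _ _ => sq_nonneg _) (a := (a, b)) (by simp)
  refine h1.trans ?_
  exact Finset.single_le_sum (f := fun m => ∑ p ∈ Finset.HasAntidiagonal.antidiagonal m,
      L2norm L (wpd L p.1 p.2 f) ^ 2)
    (fun _ _ => Finset.sum_nonneg fun _ _ => sq_nonneg _) (by simp; omega)

theorem Hnorm_nonneg (L : ℝ) (k : ℕ) (f : ℝ × ℝ → ℝ) : 0 ≤ Hnorm L k f := Real.sqrt_nonneg _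

/-- Use ∂₁η as test function in the definition for (a, b). The derivatives of η must then be
commuted, since ∂₁ is applied after ∂₂ in `IsWeakPartial`; the analogous step in the second variable
needs no commutation. -/
theorem MemH.isWeakPartial_fst {L : ℝ} {k : ℕ} {f : ℝ × ℝ → ℝ} (hf : MemH L k f) {a b : ℕ}
    (hab : a + b + 1 ≤ k) : IsWeakPartial L 1 0 (wpd L a b f) (wpd L (a + 1) b f) := by
  intro η hη hc hs
  have h1 := hf.isWeakPartial_wpd (a := a) (b := b) (by omega) (tpd 0 η) (contDiff_tpd hη 0)
    (hasCompactSupport_tpd hc 0) ((tsupport_tpd_subset η 0).trans hs)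
  have h2 := hf.isWeakPartial_wpd (a := a + 1) (b := b) (by omega) η hη hc hs
  rw [tpd_iterate_comm hη] at h1
  rw [Function.iterate_succ_apply, h1] at h2
  simp only [Function.iterate_one, Function.iterate_zero, id_eq]
  refine mul_left_cancel₀ (pow_ne_zero (a + b) (by norm_num : (-1 : ℝ) ≠ 0)) (h2.trans ?_)
  ring

theorem MemH.isWeakPartial_snd {L : ℝ} {k : ℕ} {f : ℝ × ℝ → ℝ} (hf : MemH L k f) {a b : ℕ}
    (hab : a + b + 1 ≤ k) : IsWeakPartial L 0 1 (wpd L a b f) (wpd L a (b + 1) f) := by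
  intro η hη hc hs
  have h1 := hf.isWeakPartial_wpd (a := a) (b := b) (by omega) (tpd 1 η) (contDiff_tpd hη 1)
    (hasCompactSupport_tpd hc 1) ((tsupport_tpd_subset η 1).trans hs)
  have h2 := hf.isWeakPartial_wpd (a := a) (b := b + 1) (by omega) η hη hc hs
  rw [Function.iterate_succ_apply, h1] at h2
  simp only [Function.iterate_one, Function.iterate_zero, id_eq]
  refine mul_left_cancel₀ (pow_ne_zero (a + b) (by norm_num : (-1 : ℝ) ≠ 0)) (h2.trans ?_)
  ring

/-! ### Classical derivatives are weak derivatives -/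

theorem pd_eq_tpd {L : ℝ} (hL : 0 < L) {η : ℝ × ℝ → ℝ} (hη : ContDiff ℝ ∞ η) (i : Fin 2)
    {x : ℝ × ℝ} (hx : x ∈ OmBar L) : pd L i η x = tpd i η x := by
  unfold pd tpd
  rw [(hη.differentiable (by simp) x).fderivWithin (uniqueDiffOn_OmBar hL x hx)]

theorem eq_zero_of_notMem_Om {L : ℝ} {η : ℝ × ℝ → ℝ} (hs : tsupport η ⊆ Om L) {x : ℝ × ℝ}
    (hx : x ∉ Om L) : η x = 0 := by
  by_contra hne
  exact hx (hs (subset_tsupport η hne))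

theorem integral_pd_mul_test_eq_zero {L : ℝ} (hL : 0 < L) {v η : ℝ × ℝ → ℝ}
    (hv : ContDiffOn ℝ 1 v (OmBar L)) (hη : ContDiff ℝ ∞ η) (hs : tsupport η ⊆ Om L) (i : Fin 2) :
    ∫ z in Om L, pd L i (fun z => v z * η z) z = 0 := by
  have hη1 : ContDiffOn ℝ 1 η (OmBar L) := (hη.of_le (by simp)).contDiffOn
  have hz : ∀ x y, (x ∉ Ioo 0 L ∨ y ∉ Ioo (-1 : ℝ) 1) → v (x, y) * η (x, y) = 0 := by
    intro x y h
    rw [eq_zero_of_notMem_Om hs, mul_zero]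
    rintro ⟨h1, h2⟩
    exact h.elim (fun h => h h1) (fun h => h h2)
  fin_cases i
  · have h := integral_mul_pd_fst hL (P := fun _ => 1) (P' := fun _ => 0)
      (fun x _ => hasDerivWithinAt_const x _ _) continuousOn_const (hv.mul hη1)
    simp only [one_mul, zero_mul, integral_zero, sub_zero] at h
    rw [line_integral_congr_zero (q := fun z => v z * η z) fun y _ => hz L y (by simp),
      line_integral_congr_zero (q := fun z => v z * η z) fun y _ => hz 0 y (by simp), sub_zero] at h
    exact h
  · have h := integral_mul_pd_snd hL (P := fun _ => 1) continuousOn_const (hv.mul hη1)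
      (fun x hx y hy => hz x y (by
        rcases hy with rfl | rfl <;> simp))
    simp only [one_mul] at h
    exact h

theorem integral_mul_tpd_eq_neg {L : ℝ} (hL : 0 < L) {v η : ℝ × ℝ → ℝ}
    (hv : ContDiffOn ℝ 1 v (OmBar L)) (hη : ContDiff ℝ ∞ η) (hs : tsupport η ⊆ Om L) (i : Fin 2) :
    ∫ z in Om L, v z * tpd i η z = - ∫ z in Om L, pd L i v z * η z := by
  have hη1 : ContDiffOn ℝ 1 η (OmBar L) := (hη.of_le (by simp)).contDiffOn
  have h0 := integral_pd_mul_test_eq_zero hL hv hη hs i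
  have c1 : IntegrableOn (fun z => v z * tpd i η z) (Om L) :=
    integrableOn_Om (hv.continuousOn.fun_mul (contDiff_tpd hη i).continuous.continuousOn)
  have c2 : IntegrableOn (fun z => pd L i v z * η z) (Om L) :=
    integrableOn_Om ((continuousOn_pd hL hv i).fun_mul hη.continuous.continuousOn)
  rw [eq_neg_iff_add_eq_zero, ← integral_add c1 c2, ← h0]
  refine setIntegral_congr_fun (measurableSet_Om L) fun z hz => ?_
  have hz' := Om_subset_OmBar L hz
  rw [pd_mul hL hv hη1 i hz', pd_eq_tpd hL hη i hz']

/-- The norm in the conclusion is built from weak derivatives, the energy estimates from classical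
ones; uniqueness of weak derivatives identifies them. -/
theorem Hnorm_one_le {L : ℝ} (hL : 0 < L) {v : ℝ × ℝ → ℝ} (hv : ContDiffOn ℝ 1 v (OmBar L)) :
    Hnorm L 1 v ≤ L2norm L v + L2norm L (pd L 0 v) + L2norm L (pd L 1 v) := by
  have e0 : L2norm L (wpd L 0 0 v) = L2norm L v :=
    L2norm_congr (wpd_ae_eq (memLp_Om hv.continuousOn) (isWeakPartial_zero L v))
  have e1 : L2norm L (wpd L 1 0 v) = L2norm L (pd L 0 v) := by
    refine L2norm_congr (wpd_ae_eq (memLp_Om (continuousOn_pd hL hv 0)) fun η hη _ hs => ?_)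
    simpa using integral_mul_tpd_eq_neg hL hv hη hs 0
  have e2 : L2norm L (wpd L 0 1 v) = L2norm L (pd L 1 v) := by
    refine L2norm_congr (wpd_ae_eq (memLp_Om (continuousOn_pd hL hv 1)) fun η hη _ hs => ?_)
    simpa using integral_mul_tpd_eq_neg hL hv hη hs 1
  have n0 := L2norm_nonneg L v
  have n1 := L2norm_nonneg L (pd L 0 v)
  have n2 := L2norm_nonneg L (pd L 1 v)
  unfold Hnorm
  refine Real.sqrt_le_iff.2 ⟨by positivity, ?_⟩
  have hanti : Finset.HasAntidiagonal.antidiagonal 1 = {((0 : ℕ), (1 : ℕ)), (1, 0)} := by decide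
  rw [Finset.sum_range_succ, Finset.sum_range_succ, Finset.range_zero, Finset.sum_empty, hanti]
  simp only [Finset.HasAntidiagonal.antidiagonal_zero, Finset.sum_singleton, zero_add]
  rw [Finset.sum_pair (by simp)]
  simp only [e0, e1, e2]
  nlinarith [mul_nonneg n0 n1, mul_nonneg n0 n2, mul_nonneg n1 n2]

/-! ### Mollification -/

/-- The mollification by `k` of the extension by zero of a function on the nozzle. -/
noncomputable def mollify (L : ℝ) (k F : ℝ × ℝ → ℝ) : ℝ × ℝ → ℝ :=
  convolution k ((Om L).indicator F) (ContinuousLinearMap.lsmul ℝ ℝ) volume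

theorem integrable_indicator_Om {L : ℝ} {F : ℝ × ℝ → ℝ} (hF : IntegrableOn F (Om L)) :
    Integrable ((Om L).indicator F) :=
  (integrable_indicator_iff (measurableSet_Om L)).2 hF

theorem mollify_eq {L : ℝ} (k F : ℝ × ℝ → ℝ) (x : ℝ × ℝ) :
    mollify L k F x = ∫ t in Om L, F t * k (x - t) := by
  rw [mollify, convolution_eq_swap, ← integral_indicator (measurableSet_Om L)]
  refine integral_congr_ae (Eventually.of_forall fun t => ?_)
  by_cases ht : t ∈ Om L <;> simp [ht, mul_comm]

theorem contDiff_mollify {L : ℝ} {k F : ℝ × ℝ → ℝ} (hk : ContDiff ℝ ∞ k)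
    (hc : HasCompactSupport k) (hF : IntegrableOn F (Om L)) : ContDiff ℝ ∞ (mollify L k F) :=
  hc.contDiff_convolution_left _ hk (integrable_indicator_Om hF).locallyIntegrable

/-- Differentiate the kernel: k(x - ·) is an admissible test function as soon as the ball of radius
`r` about `x` lies in the nozzle, so the extension by zero causes no boundary contribution at such
points. -/
theorem tpd_mollify {L r : ℝ} {k F G : ℝ × ℝ → ℝ} {i : Fin 2} (hk : ContDiff ℝ ∞ k)
    (hc : HasCompactSupport k) (hr : tsupport k ⊆ Metric.closedBall 0 r)
    (hF : IntegrableOn F (Om L))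
    (hFG : ∀ η : ℝ × ℝ → ℝ, ContDiff ℝ ∞ η → HasCompactSupport η → tsupport η ⊆ Om L →
      ∫ x in Om L, F x * tpd i η x = - ∫ x in Om L, G x * η x)
    {x : ℝ × ℝ} (hx : Metric.closedBall x r ⊆ Om L) :
    tpd i (mollify L k F) x = mollify L k G x := by
  have hd := hc.hasFDerivAt_convolution_left (ContinuousLinearMap.lsmul ℝ ℝ) (hk.of_le (by simp))
    (integrable_indicator_Om hF).locallyIntegrable (μ := volume) x
  have hex : ConvolutionExistsAt (fderiv ℝ k) ((Om L).indicator F) x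
      (ContinuousLinearMap.precompL (ℝ × ℝ) (ContinuousLinearMap.lsmul ℝ ℝ)) volume :=
    (hc.fderiv ℝ).convolutionExists_left _ (hk.continuous_fderiv (by simp))
      (integrable_indicator_Om hF).locallyIntegrable x
  have hη : ContDiff ℝ ∞ (fun t => k (x - t)) := hk.comp (contDiff_const.sub contDiff_id)
  have hηd : ∀ t, tpd i (fun t => k (x - t)) t = - tpd i k (x - t) := by
    intro t
    have h1 : HasFDerivAt k (fderiv ℝ k (x - t)) (x - t) :=
      (hk.differentiable (by simp) _).hasFDerivAt
    have h2 : HasFDerivAt (fun t => x - t) (-(ContinuousLinearMap.id ℝ (ℝ × ℝ))) t :=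
      (hasFDerivAt_id t).const_sub x
    have h3 := h1.comp t h2
    unfold tpd
    change fderiv ℝ (k ∘ fun t => x - t) t (e i) = _
    rw [h3.fderiv]
    simp
  have hηs : tsupport (fun t => k (x - t)) ⊆ Metric.closedBall x r := by
    refine closure_minimal (fun t ht => ?_) Metric.isClosed_closedBall
    have : x - t ∈ Metric.closedBall (0 : ℝ × ℝ) r := hr (subset_tsupport k ht)
    rwa [mem_closedBall_zero_iff, ← dist_eq_norm, dist_comm] at this
  have hηc : HasCompactSupport (fun t => k (x - t)) :=
    (isCompact_closedBall x r).of_isClosed_subset (isClosed_tsupport _) hηs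
  have h := hFG _ hη hηc (hηs.trans hx)
  rw [mollify_eq]
  have e1 : ∫ t in Om L, F t * tpd i (fun t => k (x - t)) t =
      - ∫ t in Om L, F t * tpd i k (x - t) := by
    rw [← integral_neg]
    refine integral_congr_ae (Eventually.of_forall fun t => ?_)
    simp only [hηd]; ring
  rw [e1, neg_inj] at h
  rw [← h, ← integral_indicator (measurableSet_Om L)]
  change fderiv ℝ (convolution k ((Om L).indicator F) (ContinuousLinearMap.lsmul ℝ ℝ) volume) x
    (e i) = _
  rw [hd.fderiv, convolution_def, ContinuousLinearMap.integral_apply hex,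
    ← integral_sub_left_eq_self _ volume x]
  refine integral_congr_ae (Eventually.of_forall fun t => ?_)
  by_cases ht : t ∈ Om L <;> simp [ht, mul_comm, tpd]

/-- Young's inequality in L¹ for a nonnegative kernel of mass one; the bound does not depend on the
kernel. -/
theorem integral_abs_mollify_le {L : ℝ} {k F : ℝ × ℝ → ℝ} (hk : Continuous k)
    (hc : HasCompactSupport k) (hk0 : ∀ x, 0 ≤ k x) (hk1 : ∫ x, k x = 1)
    (hF : IntegrableOn F (Om L)) :
    Integrable (mollify L k F) ∧ ∫ x, |mollify L k F x| ≤ ∫ x in Om L, |F x| := by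
  have hki : Integrable k := hk.integrable_of_hasCompactSupport hc
  have hint : ∀ {F : ℝ × ℝ → ℝ}, IntegrableOn F (Om L) → Integrable (mollify L k F) := fun hF =>
    hki.integrable_convolution _ (integrable_indicator_Om hF)
  refine ⟨hint hF, ?_⟩
  have h1 : ∫ x, mollify L k (fun x => |F x|) x = ∫ x in Om L, |F x| := by
    unfold mollify
    rw [integral_convolution _ hki (integrable_indicator_Om hF.abs), hk1,
      integral_indicator (measurableSet_Om L)]
    simp
  rw [← h1]
  refine integral_mono (hint hF).abs (hint hF.abs) fun x => ?_
  simp only [mollify_eq]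
  refine (abs_integral_le_integral_abs).trans_eq ?_
  refine integral_congr_ae (Eventually.of_forall fun t => ?_)
  simp [abs_mul, abs_of_nonneg (hk0 _)]

/-! ### A Sobolev inequality on rectangles -/

/-- The fundamental theorem of calculus gives |h(x)| ≤ |h(t)| + ∫|h'| for every t; average over t.
-/
theorem abs_le_integral_add_integral_deriv {a b : ℝ} (hab : a < b) {h h' : ℝ → ℝ}
    (hd : ∀ x ∈ Icc a b, HasDerivAt h (h' x) x) (hc : ContinuousOn h' (Icc a b))
    {x : ℝ} (hx : x ∈ Icc a b) :
    |h x| ≤ (b - a)⁻¹ * (∫ t in a..b, |h t|) + ∫ t in a..b, |h' t| := by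
  have hba : 0 < b - a := sub_pos.2 hab
  have hhc : ContinuousOn h (Icc a b) := fun t ht => (hd t ht).continuousAt.continuousWithinAt
  have hi : IntervalIntegrable (fun t => |h t|) volume a b :=
    ContinuousOn.intervalIntegrable (by rw [uIcc_of_le hab.le]; exact hhc.abs)
  have hi' : IntervalIntegrable (fun t => |h' t|) volume a b :=
    ContinuousOn.intervalIntegrable (by rw [uIcc_of_le hab.le]; exact hc.abs)
  have key : ∀ t ∈ Icc a b, |h x| - ∫ s in a..b, |h' s| ≤ |h t| := by
    intro t ht
    have hsub : uIcc t x ⊆ Icc a b := by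
      rw [← uIcc_of_le hab.le] at ht hx ⊢
      exact uIcc_subset_uIcc ht hx
    have e : ∫ s in t..x, h' s = h x - h t :=
      intervalIntegral.integral_eq_sub_of_hasDerivAt (fun s hs => hd s (hsub hs))
        (ContinuousOn.intervalIntegrable (hc.mono hsub))
    have h1 : |h x - h t| ≤ ∫ s in a..b, |h' s| := by
      rw [← e]
      have h2 := intervalIntegral.norm_integral_le_abs_integral_norm (f := h') (a := t) (b := x)
        (μ := volume)
      refine h2.trans ?_
      rw [← abs_of_nonneg (intervalIntegral.integral_nonneg hab.le
        fun s _ => abs_nonneg (h' s) : 0 ≤ ∫ s in a..b, |h' s|)]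
      refine intervalIntegral.abs_integral_mono_interval ?_ ?_ hi'
      · rw [uIoc, uIoc]
        refine Ioc_subset_Ioc ?_ ?_
        · rw [min_eq_left hab.le]; exact le_min ht.1 hx.1
        · rw [max_eq_right hab.le]; exact max_le ht.2 hx.2
      · exact Eventually.of_forall fun s => abs_nonneg _
    have h3 := abs_sub_abs_le_abs_sub (h x) (h t)
    linarith
  have h4 := intervalIntegral.integral_mono_on hab.le (by simp) hi key
  rw [intervalIntegral.integral_const, smul_eq_mul] at h4
  rw [← sub_le_iff_le_add, ← div_eq_inv_mul, le_div_iff₀ hba]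
  linarith

/-- The one-dimensional bound applied once in each variable. Only the mixed second derivative
appears, and only L¹ norms, which mollification does not increase. -/
theorem abs_le_integral_rectangle {a b c d : ℝ} (hab : a < b) (hcd : c < d)
    {g g₁ g₂ g₁₂ : ℝ × ℝ → ℝ} (h0 : Continuous g) (h1 : Continuous g₁) (h2 : Continuous g₂)
    (h12 : Continuous g₁₂)
    (d1 : ∀ x ∈ Icc a b, ∀ y ∈ Icc c d, HasDerivAt (fun t => g (t, y)) (g₁ (x, y)) x)
    (d2 : ∀ x ∈ Icc a b, ∀ y ∈ Icc c d, HasDerivAt (fun t => g (x, t)) (g₂ (x, y)) y)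
    (d12 : ∀ x ∈ Icc a b, ∀ y ∈ Icc c d, HasDerivAt (fun t => g₁ (x, t)) (g₁₂ (x, y)) y)
    {x y : ℝ} (hx : x ∈ Icc a b) (hy : y ∈ Icc c d) :
    |g (x, y)| ≤
      (b - a)⁻¹ * ((d - c)⁻¹ * (∫ s in a..b, ∫ t in c..d, |g (s, t)|) +
        ∫ s in a..b, ∫ t in c..d, |g₂ (s, t)|) +
      ((d - c)⁻¹ * (∫ s in a..b, ∫ t in c..d, |g₁ (s, t)|) +
        ∫ s in a..b, ∫ t in c..d, |g₁₂ (s, t)|) := by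
  have hba : 0 ≤ (b - a)⁻¹ := inv_nonneg.2 (sub_pos.2 hab).le
  have cont : ∀ {q : ℝ × ℝ → ℝ}, Continuous q → Continuous fun s => ∫ t in c..d, |q (s, t)| :=
    fun hq => intervalIntegral.continuous_parametric_intervalIntegral_of_continuous'
      (by simpa [Function.uncurry_def] using hq.abs) c d
  have ii : ∀ {q : ℝ × ℝ → ℝ}, Continuous q →
      IntervalIntegrable (fun s => ∫ t in c..d, |q (s, t)|) volume a b :=
    fun hq => (cont hq).intervalIntegrable a b
  have i1 : ∀ {q : ℝ × ℝ → ℝ}, Continuous q →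
      IntervalIntegrable (fun s => |q (s, y)|) volume a b :=
    fun hq => (by fun_prop : Continuous fun s => |_|).intervalIntegrable a b
  have m : ∀ {q q' : ℝ × ℝ → ℝ}, Continuous q → Continuous q' →
      (∀ x ∈ Icc a b, ∀ y ∈ Icc c d, HasDerivAt (fun t => q (x, t)) (q' (x, y)) y) →
      ∫ s in a..b, |q (s, y)| ≤ (d - c)⁻¹ * (∫ s in a..b, ∫ t in c..d, |q (s, t)|) +
        ∫ s in a..b, ∫ t in c..d, |q' (s, t)| := by
    intro q q' hq hq' hd
    rw [← intervalIntegral.integral_const_mul,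
      ← intervalIntegral.integral_add ((ii hq).const_mul _) (ii hq')]
    exact intervalIntegral.integral_mono_on hab.le (i1 hq) (((ii hq).const_mul _).add (ii hq'))
      fun s hs => abs_le_integral_add_integral_deriv hcd (h := fun t => q (s, t))
        (h' := fun t => q' (s, t)) (hd s hs) (by fun_prop) hy
  refine (abs_le_integral_add_integral_deriv hab (h := fun t => g (t, y))
    (h' := fun t => g₁ (t, y)) (fun s hs => d1 s hs y hy) (by fun_prop) hx).trans ?_
  have ma := m h0 h2 d2
  have mb := m h1 h12 d12
  gcongr

/-! ### Lipschitz representatives of Sobolev functions -/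

/-- The nozzle shrunk by `r` on each side. -/
def shrink (L r : ℝ) : Set (ℝ × ℝ) := Icc r (L - r) ×ˢ Icc (-1 + r) (1 - r)

theorem closedBall_subset_Om {L r ρ : ℝ} (hρ : ρ < r) {x : ℝ × ℝ} (hx : x ∈ shrink L r) :
    Metric.closedBall x ρ ⊆ Om L := by
  obtain ⟨x, y⟩ := x
  obtain ⟨⟨h1, h2⟩, h3, h4⟩ := hx
  rw [← closedBall_prod_same, Real.closedBall_eq_Icc, Real.closedBall_eq_Icc]
  simp only at h1 h2 h3 h4
  exact prod_mono (fun t ht => ⟨by linarith [ht.1], by linarith [ht.2]⟩)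
    (fun t ht => ⟨by linarith [ht.1], by linarith [ht.2]⟩)

theorem exists_mem_shrink {L : ℝ} {x : ℝ × ℝ} (hx : x ∈ Om L) :
    ∃ r₀ > 0, ∀ r ≤ r₀, x ∈ shrink L r := by
  obtain ⟨⟨h1, h2⟩, h3, h4⟩ := hx
  refine ⟨min (min x.1 (L - x.1)) (min (x.2 + 1) (1 - x.2)), ?_, fun r hr => ?_⟩
  · simp only [gt_iff_lt, lt_min_iff]
    refine ⟨⟨?_, ?_⟩, ?_, ?_⟩ <;> linarith
  · simp only [le_min_iff] at hr
    obtain ⟨⟨a, b⟩, c, d⟩ := hr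
    exact ⟨⟨a, by linarith⟩, by linarith, by linarith⟩

theorem IsWeakPartial.integral_fst {L : ℝ} {F G : ℝ × ℝ → ℝ} (h : IsWeakPartial L 1 0 F G) :
    ∀ η : ℝ × ℝ → ℝ, ContDiff ℝ ∞ η → HasCompactSupport η → tsupport η ⊆ Om L →
      ∫ x in Om L, F x * tpd 0 η x = - ∫ x in Om L, G x * η x :=
  fun η h1 h2 h3 => by simpa using h η h1 h2 h3

theorem IsWeakPartial.integral_snd {L : ℝ} {F G : ℝ × ℝ → ℝ} (h : IsWeakPartial L 0 1 F G) :
    ∀ η : ℝ × ℝ → ℝ, ContDiff ℝ ∞ η → HasCompactSupport η → tsupport η ⊆ Om L →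
      ∫ x in Om L, F x * tpd 1 η x = - ∫ x in Om L, G x * η x :=
  fun η h1 h2 h3 => by simpa using h η h1 h2 h3

theorem hasDerivAt_tpd_fst {g : ℝ × ℝ → ℝ} (hg : ContDiff ℝ ∞ g) (x y : ℝ) :
    HasDerivAt (fun t => g (t, y)) (tpd 0 g (x, y)) x := by
  have h1 := (hg.differentiable (by simp) (x, y)).hasFDerivAt
  have h2 : HasDerivAt (fun t : ℝ => (t, y)) ((1 : ℝ), (0 : ℝ)) x :=
    (hasDerivAt_id x).prodMk (hasDerivAt_const x y)
  exact h1.comp_hasDerivAt x h2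

theorem hasDerivAt_tpd_snd {g : ℝ × ℝ → ℝ} (hg : ContDiff ℝ ∞ g) (x y : ℝ) :
    HasDerivAt (fun t => g (x, t)) (tpd 1 g (x, y)) y := by
  have h1 := (hg.differentiable (by simp) (x, y)).hasFDerivAt
  have h2 : HasDerivAt (fun t : ℝ => (x, t)) ((0 : ℝ), (1 : ℝ)) y :=
    (hasDerivAt_const y x).prodMk (hasDerivAt_id y)
  exact h1.comp_hasDerivAt y h2

theorem iterated_integral_le {q : ℝ × ℝ → ℝ} (hq : Integrable q) {a b c d : ℝ} (hab : a ≤ b)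
    (hcd : c ≤ d) : ∫ s in a..b, ∫ t in c..d, |q (s, t)| ≤ ∫ z, |q z| := by
  rw [intervalIntegral.integral_of_le hab]
  simp only [intervalIntegral.integral_of_le hcd]
  rw [← setIntegral_prod (fun z : ℝ × ℝ => |q z|) (by
    rw [← Measure.volume_eq_prod]; exact hq.abs.integrableOn), ← Measure.volume_eq_prod]
  exact setIntegral_le_integral hq.abs (Eventually.of_forall fun _ => abs_nonneg _)

/-- The constraints on `r` keep the sides of the shrunken rectangle at least L/2 and 1, whence a
constant independent of both `r` and the kernel; this uniformity is what survives the limit. -/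
theorem abs_mollify_le {L r ρ N : ℝ} (hL : 0 < L) (hr : 0 < r) (hrL : r ≤ L / 4)
    (hr4 : r ≤ 1 / 4) (hρ : ρ < r) {k F F₁ F₂ F₁₂ : ℝ × ℝ → ℝ}
    (hk : ContDiff ℝ ∞ k) (hc : HasCompactSupport k) (hkr : tsupport k ⊆ Metric.closedBall 0 ρ)
    (hk0 : ∀ x, 0 ≤ k x) (hk1 : ∫ x, k x = 1)
    (hF : IntegrableOn F (Om L)) (hF₁ : IntegrableOn F₁ (Om L)) (hF₂ : IntegrableOn F₂ (Om L))
    (hF₁₂ : IntegrableOn F₁₂ (Om L))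
    (w₁ : IsWeakPartial L 1 0 F F₁) (w₂ : IsWeakPartial L 0 1 F F₂)
    (w₁₂ : IsWeakPartial L 0 1 F₁ F₁₂)
    (n : ∫ x in Om L, |F x| ≤ N) (n₁ : ∫ x in Om L, |F₁ x| ≤ N) (n₂ : ∫ x in Om L, |F₂ x| ≤ N)
    (n₁₂ : ∫ x in Om L, |F₁₂ x| ≤ N) {x : ℝ × ℝ} (hx : x ∈ shrink L r) :
    |mollify L k F x| ≤ (4 / L + 2) * N := by
  have sm : ∀ {F : ℝ × ℝ → ℝ}, IntegrableOn F (Om L) → ContDiff ℝ ∞ (mollify L k F) :=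
    fun h => contDiff_mollify hk hc h
  have hab : r < L - r := by linarith
  have hcd : -1 + r < 1 - r := by linarith
  have I : ∀ {F : ℝ × ℝ → ℝ}, IntegrableOn F (Om L) → ∫ x in Om L, |F x| ≤ N →
      ∫ s in r..(L - r), ∫ t in (-1 + r)..(1 - r), |mollify L k F (s, t)| ≤ N := by
    intro F hF hN
    obtain ⟨h1, h2⟩ := integral_abs_mollify_le hk.continuous hc hk0 hk1 hF
    exact ((iterated_integral_le h1 hab.le hcd.le).trans h2).trans hN
  have N0 : 0 ≤ N := (integral_nonneg fun _ => abs_nonneg _).trans n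
  have key := abs_le_integral_rectangle hab hcd (sm hF).continuous (sm hF₁).continuous
    (sm hF₂).continuous (sm hF₁₂).continuous
    (fun s hs t ht => by
      rw [← tpd_mollify hk hc hkr hF w₁.integral_fst (closedBall_subset_Om hρ ⟨hs, ht⟩)]
      exact hasDerivAt_tpd_fst (sm hF) s t)
    (fun s hs t ht => by
      rw [← tpd_mollify hk hc hkr hF w₂.integral_snd (closedBall_subset_Om hρ ⟨hs, ht⟩)]
      exact hasDerivAt_tpd_snd (sm hF) s t)
    (fun s hs t ht => by
      rw [← tpd_mollify hk hc hkr hF₁ w₁₂.integral_snd (closedBall_subset_Om hρ ⟨hs, ht⟩)]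
      exact hasDerivAt_tpd_snd (sm hF₁) s t)
    hx.1 hx.2
  have i1 : (L - r - r)⁻¹ ≤ 2 / L := by
    rw [inv_eq_one_div, div_le_div_iff₀ (by linarith) hL]; linarith
  have i2 : (1 - r - (-1 + r))⁻¹ ≤ 1 := inv_le_one_of_one_le₀ (by linarith)
  have i1' : 0 ≤ (L - r - r)⁻¹ := inv_nonneg.2 (by linarith)
  have i2' : 0 ≤ (1 - r - (-1 + r))⁻¹ := inv_nonneg.2 (by linarith)
  have h2L : 0 ≤ 2 / L := by positivity
  calc |mollify L k F x| ≤ _ := key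
    _ ≤ (L - r - r)⁻¹ * ((1 - r - (-1 + r))⁻¹ * N + N) + ((1 - r - (-1 + r))⁻¹ * N + N) := by
        gcongr
        exacts [I hF n, I hF₂ n₂, I hF₁ n₁, I hF₁₂ n₁₂]
    _ ≤ 2 / L * (1 * N + N) + (1 * N + N) := by gcongr
    _ = _ := by ring

theorem abs_clamp_sub_le (M a b : ℝ) :
    |max (-M) (min M a) - max (-M) (min M b)| ≤ |a - b| := by
  refine (abs_max_sub_max_le_max (-M) (min M a) (-M) (min M b)).trans ?_
  refine max_le (by simp) ((abs_min_sub_min_le_max M a M b).trans ?_)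
  exact max_le (by simp) le_rfl

/-- The sup bound is applied to mollifications of F and of both first derivatives, so the smooth
approximations are uniformly bounded and Lipschitz. Both properties pass to the limit at almost
every point. The weak derivatives listed are exactly those that the three sup bounds consume. -/
theorem exists_lipBdd_of_weak {L N : ℝ} (hL : 0 < L)
    {F F₁ F₂ F₁₁ F₁₂ F₂₂ F₁₁₂ F₁₂₂ : ℝ × ℝ → ℝ}
    (hF : IntegrableOn F (Om L)) (hF₁ : IntegrableOn F₁ (Om L)) (hF₂ : IntegrableOn F₂ (Om L))
    (hF₁₁ : IntegrableOn F₁₁ (Om L)) (hF₁₂ : IntegrableOn F₁₂ (Om L))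
    (hF₂₂ : IntegrableOn F₂₂ (Om L)) (hF₁₁₂ : IntegrableOn F₁₁₂ (Om L))
    (hF₁₂₂ : IntegrableOn F₁₂₂ (Om L))
    (w₁ : IsWeakPartial L 1 0 F F₁) (w₂ : IsWeakPartial L 0 1 F F₂)
    (w₁₁ : IsWeakPartial L 1 0 F₁ F₁₁) (w₁₂ : IsWeakPartial L 0 1 F₁ F₁₂)
    (w₂₁ : IsWeakPartial L 1 0 F₂ F₁₂) (w₂₂ : IsWeakPartial L 0 1 F₂ F₂₂)
    (w₁₁₂ : IsWeakPartial L 0 1 F₁₁ F₁₁₂) (w₁₂₂ : IsWeakPartial L 0 1 F₁₂ F₁₂₂)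
    (n : ∫ x in Om L, |F x| ≤ N) (n₁ : ∫ x in Om L, |F₁ x| ≤ N) (n₂ : ∫ x in Om L, |F₂ x| ≤ N)
    (n₁₁ : ∫ x in Om L, |F₁₁ x| ≤ N) (n₁₂ : ∫ x in Om L, |F₁₂ x| ≤ N)
    (n₂₂ : ∫ x in Om L, |F₂₂ x| ≤ N) (n₁₁₂ : ∫ x in Om L, |F₁₁₂ x| ≤ N)
    (n₁₂₂ : ∫ x in Om L, |F₁₂₂ x| ≤ N) :
    ∃ g, LipBdd L (2 * ((4 / L + 2) * N)) g ∧ F =ᵐ[volume.restrict (Om L)] g := by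
  have N0 : 0 ≤ N := (integral_nonneg fun _ => abs_nonneg _).trans n
  set M : ℝ := (4 / L + 2) * N with hM
  have M0 : 0 ≤ M := by positivity
  -- The outer radius is twice the inner one; a bounded ratio is what a.e. convergence for a merely
  -- integrable function requires.
  let ψ : ℕ → ContDiffBump (0 : ℝ × ℝ) := fun m =>
    ⟨1 / (2 * ((m : ℝ) + 1)), 1 / ((m : ℝ) + 1), by positivity, by
      apply one_div_lt_one_div_of_lt <;> linarith [(Nat.cast_nonneg m : (0 : ℝ) ≤ m)]⟩
  have hrout : Tendsto (fun m => (ψ m).rOut) atTop (𝓝 0) := tendsto_one_div_add_atTop_nhds_zero_nat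
  have hlim : ∀ᵐ x, Tendsto (fun m => mollify L ((ψ m).normed volume) F x) atTop
      (𝓝 ((Om L).indicator F x)) :=
    ContDiffBump.ae_convolution_tendsto_right_of_locallyIntegrable (K := 2) hrout
      (Eventually.of_forall fun m => by
        change 1 / ((m : ℝ) + 1) ≤ 2 * (1 / (2 * ((m : ℝ) + 1)))
        apply le_of_eq; field_simp)
      (integrable_indicator_Om hF).locallyIntegrable
  -- uniform bounds for the mollified functions
  have bounds : ∀ r, 0 < r → r ≤ L / 4 → r ≤ 1 / 4 → ∀ᶠ m in atTop,
      (∀ x ∈ shrink L r, |mollify L ((ψ m).normed volume) F x| ≤ M) ∧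
      ∀ x ∈ shrink L r, ∀ y ∈ shrink L r, |mollify L ((ψ m).normed volume) F x -
        mollify L ((ψ m).normed volume) F y| ≤ 2 * M * dist x y := by
    intro r hr hrL hr4
    filter_upwards [hrout.eventually (gt_mem_nhds hr)] with m hm
    have hk : ContDiff ℝ ∞ ((ψ m).normed volume) := (ψ m).contDiff_normed
    have hc : HasCompactSupport ((ψ m).normed volume) := (ψ m).hasCompactSupport_normed
    have hkr : tsupport ((ψ m).normed volume) ⊆ Metric.closedBall 0 (ψ m).rOut :=
      (ψ m).tsupport_normed_eq.subset
    have hk0 := fun x => (ψ m).nonneg_normed (μ := volume) x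
    have hk1 := (ψ m).integral_normed (μ := volume)
    refine ⟨fun x hx => abs_mollify_le hL hr hrL hr4 hm hk hc hkr hk0 hk1 hF hF₁ hF₂ hF₁₂ w₁ w₂ w₁₂
      n n₁ n₂ n₁₂ hx, fun x hx y hy => ?_⟩
    have hsm := contDiff_mollify hk hc hF
    have hconv : Convex ℝ (shrink L r) := (convex_Icc _ _).prod (convex_Icc _ _)
    -- The plane carries the sup norm, so the operator norm is bounded by the sum of the two partial
    -- derivatives.
    have hfd : ∀ z ∈ shrink L r, ‖fderiv ℝ (mollify L ((ψ m).normed volume) F) z‖ ≤ 2 * M := by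
      intro z hz
      have hball := closedBall_subset_Om hm hz
      have b1 : |tpd 0 (mollify L ((ψ m).normed volume) F) z| ≤ M := by
        rw [tpd_mollify hk hc hkr hF w₁.integral_fst hball]
        exact abs_mollify_le hL hr hrL hr4 hm hk hc hkr hk0 hk1 hF₁ hF₁₁ hF₁₂ hF₁₁₂ w₁₁ w₁₂ w₁₁₂
          n₁ n₁₁ n₁₂ n₁₁₂ hz
      have b2 : |tpd 1 (mollify L ((ψ m).normed volume) F) z| ≤ M := by
        rw [tpd_mollify hk hc hkr hF w₂.integral_snd hball]
        exact abs_mollify_le hL hr hrL hr4 hm hk hc hkr hk0 hk1 hF₂ hF₁₂ hF₂₂ hF₁₂₂ w₂₁ w₂₂ w₁₂₂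
          n₂ n₁₂ n₂₂ n₁₂₂ hz
      refine ContinuousLinearMap.opNorm_le_bound _ (by positivity) fun v => ?_
      have hv : v = v.1 • (e 0 : ℝ × ℝ) + v.2 • (e 1 : ℝ × ℝ) := by
        ext <;> simp [e]
      have e1 : fderiv ℝ (mollify L ((ψ m).normed volume) F) z v =
          v.1 * tpd 0 (mollify L ((ψ m).normed volume) F) z +
            v.2 * tpd 1 (mollify L ((ψ m).normed volume) F) z := by
        conv_lhs => rw [hv]
        rw [map_add, map_smul, map_smul]
        rfl
      rw [e1, Real.norm_eq_abs]
      have v1 : |v.1| ≤ ‖v‖ := norm_fst_le v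
      have v2 : |v.2| ≤ ‖v‖ := norm_snd_le v
      calc _ ≤ |v.1| * |tpd 0 (mollify L ((ψ m).normed volume) F) z| +
            |v.2| * |tpd 1 (mollify L ((ψ m).normed volume) F) z| := by
            rw [← abs_mul, ← abs_mul]; exact abs_add_le _ _
        _ ≤ ‖v‖ * M + ‖v‖ * M := by gcongr
        _ = _ := by ring
    have := hconv.norm_image_sub_le_of_norm_fderiv_le
      (fun z _ => hsm.differentiable (by simp) z) hfd hy hx
    rwa [Real.norm_eq_abs, ← dist_eq_norm] at this
  set S : Set (ℝ × ℝ) := {x | x ∈ Om L ∧ Tendsto (fun m => mollify L ((ψ m).normed volume) F x) atTop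
      (𝓝 (F x))} with hS
  have hSb : ∀ x ∈ S, |F x| ≤ M := by
    rintro x ⟨hx, hxl⟩
    obtain ⟨r₀, hr₀, hr⟩ := exists_mem_shrink hx
    set r := min r₀ (min (L / 4) (1 / 4))
    have hr' : 0 < r := by positivity
    refine le_of_tendsto hxl.abs ?_
    filter_upwards [bounds r hr' ((min_le_right _ _).trans (min_le_left _ _))
      ((min_le_right _ _).trans (min_le_right _ _))] with m hm
    exact hm.1 x (hr r (min_le_left _ _))
  have hSl : ∀ x ∈ S, ∀ y ∈ S, |F x - F y| ≤ 2 * M * dist x y := by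
    rintro x ⟨hx, hxl⟩ y ⟨hy, hyl⟩
    obtain ⟨r₀, hr₀, hr⟩ := exists_mem_shrink hx
    obtain ⟨r₁, hr₁, hr'⟩ := exists_mem_shrink hy
    set r := min (min r₀ r₁) (min (L / 4) (1 / 4))
    have hr'' : 0 < r := by positivity
    refine le_of_tendsto (hxl.sub hyl).abs ?_
    filter_upwards [bounds r hr'' ((min_le_right _ _).trans (min_le_left _ _))
      ((min_le_right _ _).trans (min_le_right _ _))] with m hm
    exact hm.2 x (hr r ((min_le_left _ _).trans (min_le_left _ _))) y
      (hr' r ((min_le_left _ _).trans (min_le_right _ _)))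
  obtain ⟨g, hgl, hgS⟩ := LipschitzOnWith.extend_real (f := F) (s := S) (K := (2 * M).toNNReal)
    (LipschitzOnWith.of_dist_le_mul fun x hx y hy => by
      rw [Real.coe_toNNReal _ (by positivity), Real.dist_eq]; exact hSl x hx y hy)
  -- The Lipschitz extension from `S` need not obey the sup bound; clamping restores it without
  -- enlarging the Lipschitz constant or changing values on `S`.
  refine ⟨fun x => max (-M) (min M (g x)), ⟨fun x _ => ?_, fun x _ y _ => ?_⟩, ?_⟩
  · rw [abs_le]
    constructor
    · linarith [le_max_left (-M) (min M (g x))]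
    · exact (max_le (by linarith) (min_le_left _ _)).trans (by linarith)
  · refine (abs_clamp_sub_le _ _ _).trans ?_
    have := hgl.dist_le_mul x y
    rwa [Real.coe_toNNReal _ (by positivity), Real.dist_eq] at this
  · filter_upwards [ae_restrict_mem (measurableSet_Om L), ae_restrict_of_ae hlim] with x hx hxl
    rw [indicator_of_mem hx] at hxl
    have hxS : x ∈ S := ⟨hx, hxl⟩
    have := abs_le.1 (hSb x hxS)
    rw [← hgS hxS, min_eq_right this.2, max_eq_right this.1]

theorem integral_abs_le_L2norm {L : ℝ} {F : ℝ × ℝ → ℝ} (hF : MemLp F 2 (volume.restrict (Om L))) :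
    ∫ x in Om L, |F x| ≤ L2norm L (fun _ => 1) * L2norm L F := by
  have := integral_abs_mul_le_L2norm (memLp_const (1 : ℝ)) hF
  simpa using this

/-- Derivatives of order at most `k - 3` of functions in `H^k` are Lipschitz continuous. -/
theorem MemH.exists_lipBdd {L : ℝ} (hL : 0 < L) {k : ℕ} {f : ℝ × ℝ → ℝ} (hf : MemH L k f)
    {a b : ℕ} (hab : a + b + 3 ≤ k) :
    ∃ g, LipBdd L (2 * ((4 / L + 2) * (L2norm L (fun _ => 1) * Hnorm L k f))) g ∧
      wpd L a b f =ᵐ[volume.restrict (Om L)] g := by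
  have hi : ∀ i j, i + j ≤ k → IntegrableOn (wpd L i j f) (Om L) := fun i j hij =>
    (hf.memLp_wpd hij).integrable (by norm_num)
  have hn : ∀ i j, i + j ≤ k →
      ∫ x in Om L, |wpd L i j f x| ≤ L2norm L (fun _ => 1) * Hnorm L k f := fun i j hij =>
    (integral_abs_le_L2norm (hf.memLp_wpd hij)).trans
      (mul_le_mul_of_nonneg_left (L2norm_wpd_le_Hnorm f hij) (L2norm_nonneg _ _))
  exact exists_lipBdd_of_weak hL (hi a b (by omega)) (hi (a + 1) b (by omega))
    (hi a (b + 1) (by omega)) (hi (a + 1 + 1) b (by omega)) (hi (a + 1) (b + 1) (by omega))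
    (hi a (b + 1 + 1) (by omega)) (hi (a + 1 + 1) (b + 1) (by omega))
    (hi (a + 1) (b + 1 + 1) (by omega))
    (hf.isWeakPartial_fst (by omega)) (hf.isWeakPartial_snd (by omega))
    (hf.isWeakPartial_fst (by omega)) (hf.isWeakPartial_snd (by omega))
    (hf.isWeakPartial_fst (by omega)) (hf.isWeakPartial_snd (by omega))
    (hf.isWeakPartial_snd (by omega)) (hf.isWeakPartial_snd (by omega))
    (hn a b (by omega)) (hn (a + 1) b (by omega)) (hn a (b + 1) (by omega))
    (hn (a + 1 + 1) b (by omega)) (hn (a + 1) (b + 1) (by omega))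
    (hn a (b + 1 + 1) (by omega)) (hn (a + 1 + 1) (b + 1) (by omega))
    (hn (a + 1) (b + 1 + 1) (by omega))

theorem wpd_zero_ae_eq {L : ℝ} {k : ℕ} {f : ℝ × ℝ → ℝ} (hf : MemH L k f) :
    wpd L 0 0 f =ᵐ[volume.restrict (Om L)] f :=
  wpd_ae_eq hf.1 (isWeakPartial_zero L f)

/-! ### Traces on the wall -/

/-- Test functions may be nonzero at the walls, because integration by parts in x₁ sees only the two
ends. Multiply by cut-offs in x₂, which ∂₁ does not differentiate, and let them tend to one by
dominated convergence. -/
theorem integral_mul_tpd_fst_of_support {L : ℝ} {F G : ℝ × ℝ → ℝ} (hF : IntegrableOn F (Om L))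
    (hG : IntegrableOn G (Om L)) (h : IsWeakPartial L 1 0 F G) {θ : ℝ × ℝ → ℝ}
    (hθ : ContDiff ℝ ∞ θ) (hc : HasCompactSupport θ) (hs : tsupport θ ⊆ Ioo 0 L ×ˢ univ) :
    ∫ x in Om L, F x * tpd 0 θ x = - ∫ x in Om L, G x * θ x := by
  let χ : ℕ → ContDiffBump (0 : ℝ) := fun n =>
    ⟨1 - 2 / ((n : ℝ) + 3), 1 - 1 / ((n : ℝ) + 3), by
      have : (0 : ℝ) < n + 3 := by positivity
      rw [sub_pos, div_lt_one this]; linarith [(Nat.cast_nonneg n : (0 : ℝ) ≤ n)], by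
      have : (0 : ℝ) < n + 3 := by positivity
      have := div_lt_div_of_pos_right (by norm_num : (1 : ℝ) < 2) this
      linarith⟩
  have hlim : ∀ y ∈ Ioo (-1 : ℝ) 1, Tendsto (fun n => χ n y) atTop (𝓝 1) := by
    intro y hy
    refine tendsto_const_nhds.congr' ?_
    have h1 : Tendsto (fun n : ℕ => 1 - 2 / ((n : ℝ) + 3)) atTop (𝓝 (1 - 0)) := by
      refine tendsto_const_nhds.sub (Tendsto.const_div_atTop ?_ _)
      exact tendsto_atTop_add_const_right _ _ tendsto_natCast_atTop_atTop
    have hy' : |y| < 1 - 0 := by rw [sub_zero, abs_lt]; exact hy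
    filter_upwards [h1.eventually (lt_mem_nhds hy')] with n hn
    refine ((χ n).one_of_mem_closedBall ?_).symm
    rw [mem_closedBall_zero_iff]
    exact hn.le
  have hχle : ∀ n y, ‖χ n y‖ ≤ 1 := fun n y => by
    rw [Real.norm_eq_abs, abs_of_nonneg (χ n).nonneg]; exact (χ n).le_one
  have hχsm : ∀ n, ContDiff ℝ ∞ (fun z : ℝ × ℝ => χ n z.2) := fun n =>
    (χ n).contDiff.comp contDiff_snd
  have hbd : ∀ {η : ℝ × ℝ → ℝ} {Q : ℝ × ℝ → ℝ}, ContDiff ℝ ∞ η → HasCompactSupport η →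
      IntegrableOn Q (Om L) → Tendsto (fun n => ∫ x in Om L, Q x * (χ n x.2 * η x)) atTop
        (𝓝 (∫ x in Om L, Q x * η x)) := by
    intro η Q hη hηc hQ
    obtain ⟨C, hC⟩ := hη.continuous.bounded_above_of_compact_support hηc
    refine tendsto_integral_of_dominated_convergence (fun x => ‖Q x‖ * C) (fun n => ?_)
      (hQ.norm.mul_const C) (fun n => ?_) ?_
    · exact hQ.aestronglyMeasurable.mul
        ((hχsm n).continuous.mul hη.continuous).aestronglyMeasurable
    · refine Eventually.of_forall fun x => ?_
      rw [norm_mul, norm_mul]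
      gcongr
      calc ‖χ n x.2‖ * ‖η x‖ ≤ 1 * C := by gcongr; exacts [hχle _ _, hC _]
        _ = C := one_mul C
    · filter_upwards [ae_restrict_mem (measurableSet_Om L)] with x hx
      have := ((hlim x.2 hx.2).mul_const (η x)).const_mul (Q x)
      rwa [one_mul] at this
  have e : ∀ n, ∫ x in Om L, F x * (χ n x.2 * tpd 0 θ x) =
      - ∫ x in Om L, G x * (χ n x.2 * θ x) := by
    intro n
    have hsm : ContDiff ℝ ∞ (fun z : ℝ × ℝ => χ n z.2 * θ z) := (hχsm n).mul hθ
    have hsub : tsupport (fun z : ℝ × ℝ => χ n z.2 * θ z) ⊆ Om L := by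
      intro z hz
      have h1 : z ∈ tsupport θ := tsupport_mul_subset_right hz
      have h2 : z ∈ tsupport (fun z : ℝ × ℝ => χ n z.2) := tsupport_mul_subset_left hz
      refine ⟨(hs h1).1, ?_⟩
      have h3 : tsupport (fun z : ℝ × ℝ => χ n z.2) ⊆
          (fun z : ℝ × ℝ => z.2) ⁻¹' Metric.closedBall 0 (χ n).rOut := by
        refine closure_minimal (fun w hw => ?_) (Metric.isClosed_closedBall.preimage continuous_snd)
        have : w.2 ∈ Function.support (χ n) := hw
        rw [(χ n).support_eq] at this
        exact Metric.ball_subset_closedBall this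
      have h4 := h3 h2
      rw [mem_preimage, mem_closedBall_zero_iff, Real.norm_eq_abs] at h4
      have h5 : (χ n).rOut < 1 := by
        change 1 - 1 / ((n : ℝ) + 3) < 1
        have : (0 : ℝ) < 1 / ((n : ℝ) + 3) := by positivity
        linarith
      exact abs_lt.1 (h4.trans_lt h5)
    have := h.integral_fst _ hsm hc.mul_left hsub
    rw [← this]
    refine integral_congr_ae (Eventually.of_forall fun z => ?_)
    simp only
    congr 1
    have h1 := (hasDerivAt_tpd_fst hθ z.1 z.2).const_mul (χ n z.2)
    exact h1.unique (hasDerivAt_tpd_fst hsm z.1 z.2)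
  have l1 := hbd (contDiff_tpd hθ 0) (hasCompactSupport_tpd hc 0) hF
  have l2 := (hbd hθ hc hG).neg
  simp only [e] at l1
  exact tendsto_nhds_unique l1 l2

/-- Test Green's identity with a(x₁)bₙ(x₂), where bₙ concentrates at the wall x₂ = σ. The term with
`G` tends to zero, while integrating `g` against bₙ' tends to σg(·,σ). Thus g(·,σ) is orthogonal to
every `a`, and continuity turns a.e. vanishing into vanishing. -/
theorem trace_eq_zero_of_green {L M : ℝ} (hL : 0 < L) {F G g : ℝ × ℝ → ℝ}
    (hG : IntegrableOn G (Om L)) (hg : LipBdd L M g)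
    (hFg : F =ᵐ[volume.restrict (Om L)] g)
    (h : ∀ η : ℝ × ℝ → ℝ, ContDiff ℝ ∞ η → HasCompactSupport η →
      tsupport η ⊆ Ioo 0 L ×ˢ univ → ∫ x in Om L, (F x * tpd 1 η x + G x * η x) = 0)
    {x σ : ℝ} (hx : x ∈ Ioo 0 L) (hσ : σ ∈ ({-1, 1} : Set ℝ)) : g (x, σ) = 0 := by
  have hσI : σ ∈ Icc (-1 : ℝ) 1 := by rcases hσ with rfl | rfl <;> norm_num
  have hσ0 : σ ≠ 0 := by rcases hσ with rfl | rfl <;> norm_num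
  have hM : 0 ≤ M := (abs_nonneg _).trans (hg.1 (x, σ) ⟨Ioo_subset_Icc_self hx, hσI⟩)
  let B : ContDiffBump (0 : ℝ) := ⟨1 / 2, 1, by norm_num, by norm_num⟩
  -- Equal to 1 at σ and already 0 at the opposite wall, which is at distance 2; hence the integral
  -- of bₙ' over (-1, 1) is exactly σ.
  let b : ℕ → ℝ → ℝ := fun n y => B (((n : ℝ) + 1) * (y - σ))
  have hbsm : ∀ n, ContDiff ℝ ∞ (b n) := fun n =>
    B.contDiff.comp (contDiff_const.mul (contDiff_id.sub contDiff_const))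
  have hb0 : ∀ (n : ℕ) (y : ℝ), 1 ≤ ((n : ℝ) + 1) * |y - σ| → b n y = 0 := by
    intro n y hy
    refine B.zero_of_le_dist ?_
    rw [dist_zero_right, Real.norm_eq_abs, abs_mul, abs_of_pos (by positivity)]
    exact hy
  have hbσ : ∀ n, b n σ = 1 := fun n => B.one_of_mem_closedBall (by
    simp only [sub_self, mul_zero]
    exact Metric.mem_closedBall_self B.rIn_pos.le)
  have hbneg : ∀ n, b n (-σ) = 0 := fun n => hb0 n (-σ) (by
    have : |-σ - σ| = 2 := by rcases hσ with rfl | rfl <;> norm_num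
    rw [this]; linarith [(Nat.cast_nonneg n : (0 : ℝ) ≤ n)])
  have hble : ∀ n y, ‖b n y‖ ≤ 1 := fun n y => by
    rw [Real.norm_eq_abs, abs_of_nonneg B.nonneg]; exact B.le_one
  have hblim : ∀ y, y ≠ σ → Tendsto (fun n => b n y) atTop (𝓝 0) := by
    intro y hy
    refine tendsto_const_nhds.congr' ?_
    have h1 : Tendsto (fun n : ℕ => ((n : ℝ) + 1) * |y - σ|) atTop atTop :=
      (tendsto_atTop_add_const_right _ _ tendsto_natCast_atTop_atTop).atTop_mul_const
        (abs_pos.2 (sub_ne_zero.2 hy))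
    filter_upwards [h1.eventually_ge_atTop 1] with n hn
    exact (hb0 n y hn).symm
  have hβ : Tendsto (fun n => ∫ y in (-1 : ℝ)..1, |b n y|) atTop (𝓝 0) := by
    have := intervalIntegral.tendsto_integral_filter_of_dominated_convergence (μ := volume)
      (a := -1) (b := 1) (F := fun n y => |b n y|) (f := fun _ => (0 : ℝ)) (l := atTop)
      (fun _ => 1)
      (Eventually.of_forall fun n => (hbsm n).continuous.abs.aestronglyMeasurable)
      (Eventually.of_forall fun n => Eventually.of_forall fun y _ => by
        simpa using hble n y) (by simp) ?_
    · simpa using this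
    · have hb : ∀ᵐ t : ℝ, t ≠ σ := by simp [ae_iff]
      filter_upwards [hb] with y hy _
      simpa using (hblim y hy).abs
  -- the average of `g` against the derivative of the cut-off
  have havg : ∀ n, ∀ s ∈ Icc 0 L,
      |(∫ y in (-1 : ℝ)..1, g (s, y) * deriv (b n) y) - σ * g (s, σ)| ≤
        M * ∫ y in (-1 : ℝ)..1, |b n y| := by
    intro n s hs
    have hd : ∀ y ∈ Icc (-1 : ℝ) 1,
        HasDerivWithinAt (b n) (deriv (b n) y) (Icc (-1) 1) y := fun y _ =>
      ((hbsm n).differentiable (by simp) y).hasDerivAt.hasDerivWithinAt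
    have hdc : ContinuousOn (deriv (b n)) (Icc (-1) 1) :=
      ((hbsm n).continuous_deriv (by simp)).continuousOn
    -- Subtracting the wall value kills the boundary term at σ, and the other one vanishes with
    -- bₙ(-σ); only M∫|bₙ| remains.
    have h1 := abs_integral_lipschitz_mul_deriv_le (p := fun y => g (s, y) - g (s, σ))
      (by norm_num) hM (fun y hy y' hy' => by
        rw [sub_sub_sub_cancel_right]
        refine (hg.2 (s, y) ⟨hs, hy⟩ (s, y') ⟨hs, hy'⟩).trans_eq ?_
        rw [dist_prod_same_left, Real.dist_eq]) hd hdc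
    have hends : |(g (s, 1) - g (s, σ)) * b n 1| + |(g (s, -1) - g (s, σ)) * b n (-1)| = 0 := by
      have := hbneg n
      rcases hσ with rfl | rfl
      · rw [neg_neg] at this; simp [this]
      · simp [this]
    simp only [hends, zero_add] at h1
    convert h1 using 2
    have hgc : ContinuousOn (fun y => g (s, y)) (uIcc (-1) 1) := by
      rw [uIcc_of_le (by norm_num)]; exact continuousOn_line_snd hg.continuousOn hs
    have hdc' : ContinuousOn (deriv (b n)) (uIcc (-1) 1) := by
      rwa [uIcc_of_le (by norm_num)]
    have e1 : ∫ y in (-1 : ℝ)..1, deriv (b n) y = σ := by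
      rw [intervalIntegral.integral_deriv_eq_sub
        (fun y _ => (hbsm n).differentiable (by simp) y) hdc'.intervalIntegrable]
      have h3 := hbneg n
      have h4 := hbσ n
      rcases hσ with rfl | rfl
      · rw [neg_neg] at h3; simp [h3, h4]
      · simp [h3, h4]
    simp only [sub_mul]
    rw [intervalIntegral.integral_sub (hgc.fun_mul hdc').intervalIntegrable
      (hdc'.intervalIntegrable.const_mul _), intervalIntegral.integral_const_mul, e1, mul_comm σ]
  have htrace : ∀ a : ℝ → ℝ, ContDiff ℝ ∞ a → HasCompactSupport a → tsupport a ⊆ Ioo 0 L →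
      ∫ s in (0 : ℝ)..L, a s * g (s, σ) = 0 := by
    intro a ha hac has
    obtain ⟨A, hA⟩ := ha.continuous.bounded_above_of_compact_support hac
    have hA0 : 0 ≤ A := (norm_nonneg _).trans (hA 0)
    have hθsm : ∀ n, ContDiff ℝ ∞ (fun z : ℝ × ℝ => a z.1 * b n z.2) := fun n =>
      (ha.comp contDiff_fst).mul ((hbsm n).comp contDiff_snd)
    have hbs : ∀ n, Function.support (b n) ⊆ Icc (σ - 1) (σ + 1) := by
      intro n y hy
      by_contra hcon
      refine hy (hb0 n y ?_)
      have : 1 ≤ |y - σ| := by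
        by_contra hlt
        rw [not_le, abs_lt] at hlt
        exact hcon ⟨by linarith, by linarith⟩
      nlinarith [(Nat.cast_nonneg n : (0 : ℝ) ≤ n)]
    have hθsub : ∀ n, tsupport (fun z : ℝ × ℝ => a z.1 * b n z.2) ⊆
        tsupport a ×ˢ Icc (σ - 1) (σ + 1) := by
      intro n
      refine closure_minimal (fun z hz => ?_) ((isClosed_tsupport a).prod isClosed_Icc)
      have hz' : a z.1 * b n z.2 ≠ 0 := hz
      exact ⟨subset_tsupport a (left_ne_zero_of_mul hz'), hbs n (right_ne_zero_of_mul hz')⟩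
    have hθc : ∀ n, HasCompactSupport (fun z : ℝ × ℝ => a z.1 * b n z.2) := fun n =>
      (IsCompact.prod hac isCompact_Icc).of_isClosed_subset (isClosed_tsupport _) (hθsub n)
    have hθd : ∀ n z, tpd 1 (fun z : ℝ × ℝ => a z.1 * b n z.2) z = a z.1 * deriv (b n) z.2 := by
      intro n z
      have h1 := ((hbsm n).differentiable (by simp) z.2).hasDerivAt.const_mul (a z.1)
      exact (hasDerivAt_tpd_snd (hθsm n) z.1 z.2).unique h1
    have hgreen := fun n => h _ (hθsm n) (hθc n)
      ((hθsub n).trans (prod_mono has (subset_univ _)))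
    have hgab : ∀ n, ContinuousOn (fun z => g z * (a z.1 * deriv (b n) z.2)) (OmBar L) := fun n =>
      hg.continuousOn.fun_mul (((ha.continuous.comp continuous_fst).mul
        (((hbsm n).continuous_deriv (by simp)).comp continuous_snd)).continuousOn)
    have hlimG : Tendsto (fun n => ∫ z in Om L, G z * (a z.1 * b n z.2)) atTop (𝓝 0) := by
      have := tendsto_integral_of_dominated_convergence (μ := volume.restrict (Om L))
        (F := fun n z => G z * (a z.1 * b n z.2)) (f := fun _ => (0 : ℝ))
        (fun z => ‖G z‖ * A) (fun n => hG.aestronglyMeasurable.mul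
          (hθsm n).continuous.aestronglyMeasurable) (hG.norm.mul_const A) (fun n => ?_) ?_
      · simpa using this
      · refine Eventually.of_forall fun z => ?_
        rw [norm_mul, norm_mul]
        gcongr
        calc ‖a z.1‖ * ‖b n z.2‖ ≤ A * 1 := by gcongr; exacts [hA _, hble _ _]
          _ = A := mul_one A
      · filter_upwards [ae_restrict_mem (measurableSet_Om L)] with z hz
        have hne : z.2 ≠ σ := by
          rintro rfl
          rcases hσ with h1 | h1
          · exact absurd hz.2.1 (by rw [h1]; exact lt_irrefl _)
          · rw [mem_singleton_iff] at h1
            exact absurd hz.2.2 (by rw [h1]; exact lt_irrefl _)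
        simpa using ((hblim z.2 hne).const_mul (a z.1)).const_mul (G z)
    have hJ : ∀ n, ∫ s in (0 : ℝ)..L, ∫ y in (-1 : ℝ)..1, g (s, y) * (a s * deriv (b n) y) =
        - ∫ z in Om L, G z * (a z.1 * b n z.2) := by
      intro n
      have h1 := hgreen n
      simp only [hθd] at h1
      have i1 : IntegrableOn (fun z => F z * (a z.1 * deriv (b n) z.2)) (Om L) :=
        (integrableOn_Om (hgab n)).congr (by
          filter_upwards [hFg] with z hz; rw [hz])
      have i2 : IntegrableOn (fun z => G z * (a z.1 * b n z.2)) (Om L) :=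
        Integrable.mul_bdd (c := A) hG (hθsm n).continuous.aestronglyMeasurable
          (Eventually.of_forall fun z => by
            rw [norm_mul]
            calc ‖a z.1‖ * ‖b n z.2‖ ≤ A * 1 := by gcongr; exacts [hA _, hble _ _]
              _ = A := mul_one A)
      rw [integral_add i1 i2] at h1
      rw [← integral_Om_eq hL (integrableOn_Om (hgab n))]
      have e2 : ∫ z in Om L, F z * (a z.1 * deriv (b n) z.2) =
          ∫ z in Om L, g z * (a z.1 * deriv (b n) z.2) :=
        integral_congr_ae (by filter_upwards [hFg] with z hz; rw [hz])
      rw [← e2]; linarith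
    have hac' : ContinuousOn (fun s => a s * g (s, σ)) (Icc 0 L) :=
      ha.continuous.continuousOn.fun_mul (continuousOn_line_fst hg.continuousOn hσI)
    have hbound : ∀ n, |(∫ s in (0 : ℝ)..L, ∫ y in (-1 : ℝ)..1, g (s, y) * (a s * deriv (b n) y)) -
        σ * ∫ s in (0 : ℝ)..L, a s * g (s, σ)| ≤ A * (M * ∫ y in (-1 : ℝ)..1, |b n y|) * L := by
      intro n
      have i1 := intervalIntegrable_integral_snd hL (integrableOn_Om (hgab n))
      have i2 : IntervalIntegrable (fun s => a s * g (s, σ)) volume 0 L :=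
        ContinuousOn.intervalIntegrable (by rwa [uIcc_of_le hL.le])
      rw [← intervalIntegral.integral_const_mul, ← intervalIntegral.integral_sub i1
        (i2.const_mul σ), ← Real.norm_eq_abs]
      have := intervalIntegral.norm_integral_le_of_norm_le_const (a := 0) (b := L)
        (f := fun s => (∫ y in (-1 : ℝ)..1, g (s, y) * (a s * deriv (b n) y)) -
          σ * (a s * g (s, σ))) (C := A * (M * ∫ y in (-1 : ℝ)..1, |b n y|)) ?_
      · simpa [abs_of_pos hL] using this
      · intro s hs
        rw [uIoc_of_le hL.le] at hs
        have e3 : ∫ y in (-1 : ℝ)..1, g (s, y) * (a s * deriv (b n) y) =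
            a s * ∫ y in (-1 : ℝ)..1, g (s, y) * deriv (b n) y := by
          rw [← intervalIntegral.integral_const_mul]
          congr 1; ext y; ring
        have e4 : (∫ y in (-1 : ℝ)..1, g (s, y) * (a s * deriv (b n) y)) - σ * (a s * g (s, σ)) =
            a s * ((∫ y in (-1 : ℝ)..1, g (s, y) * deriv (b n) y) - σ * g (s, σ)) := by
          rw [e3]; ring
        rw [e4, norm_mul]
        gcongr
        exacts [hA s, havg n s (Ioc_subset_Icc_self hs)]
    have t1 : Tendsto (fun n => A * (M * ∫ y in (-1 : ℝ)..1, |b n y|) * L) atTop (𝓝 0) := by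
      simpa using ((hβ.const_mul M).const_mul A).mul_const L
    have t2 : Tendsto (fun n => (∫ s in (0 : ℝ)..L, ∫ y in (-1 : ℝ)..1,
        g (s, y) * (a s * deriv (b n) y)) - σ * ∫ s in (0 : ℝ)..L, a s * g (s, σ)) atTop (𝓝 0) :=
      squeeze_zero_norm hbound t1
    have t3 : Tendsto (fun n => (∫ s in (0 : ℝ)..L, ∫ y in (-1 : ℝ)..1,
        g (s, y) * (a s * deriv (b n) y)) - σ * ∫ s in (0 : ℝ)..L, a s * g (s, σ)) atTop
        (𝓝 (-0 - σ * ∫ s in (0 : ℝ)..L, a s * g (s, σ))) := by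
      simp only [hJ]
      exact hlimG.neg.sub_const _
    have := tendsto_nhds_unique t3 t2
    have h5 : σ * ∫ s in (0 : ℝ)..L, a s * g (s, σ) = 0 := by linarith
    exact (mul_eq_zero.1 h5).resolve_left hσ0
  have hcont : ContinuousOn (fun s => g (s, σ)) (Ioo 0 L) :=
    (continuousOn_line_fst hg.continuousOn hσI).mono Ioo_subset_Icc_self
  have hae := isOpen_Ioo.ae_eq_zero_of_integral_contDiff_smul_eq_zero (μ := volume)
    (f := fun s => g (s, σ)) (hcont.locallyIntegrableOn measurableSet_Ioo)
    (fun a ha hac has => by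
      rw [← setIntegral_eq_integral_of_forall_compl_eq_zero (s := Ioo 0 L)]
      · have := htrace a ha hac has
        rw [intervalIntegral.integral_of_le hL.le, integral_Ioc_eq_integral_Ioo] at this
        simpa using this
      · intro s hs
        have : a s = 0 := by
          by_contra hne
          exact hs (has (subset_tsupport a hne))
        simp [this])
  have := Measure.eqOn_open_of_ae_eq (μ := volume) (U := Ioo 0 L) (f := fun s => g (s, σ))
    (g := fun _ => (0 : ℝ)) ((ae_restrict_iff' measurableSet_Ioo).2 hae) isOpen_Ioo hcont
    continuousOn_const
  exact this hx

theorem trace_snd_eq_zero {L M : ℝ} (hL : 0 < L) {ψ g : ℝ × ℝ → ℝ} (hψ : MemH L 4 ψ)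
    (hz : ZeroOnWall L 1 ψ) (hg : LipBdd L M g)
    (hgψ : wpd L 0 1 ψ =ᵐ[volume.restrict (Om L)] g) :
    ∀ x ∈ Ioo 0 L, ∀ y ∈ ({-1, 1} : Set ℝ), g (x, y) = 0 := fun _ hx _ hy =>
  trace_eq_zero_of_green hL ((hψ.memLp_wpd (by norm_num)).integrable (by norm_num)) hg hgψ hz hx hy

/-- A function vanishing on the wall has vanishing tangential derivative there. Weakly: apply the
wall condition for φ to ∂₁η and move ∂₁ onto φ. -/
theorem trace_fst_eq_zero {L M : ℝ} (hL : 0 < L) {φ g : ℝ × ℝ → ℝ} (hφ : MemH L 5 φ)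
    (hz : ZeroOnWall L 0 φ) (hg : LipBdd L M g)
    (hgφ : wpd L 1 0 φ =ᵐ[volume.restrict (Om L)] g) :
    ∀ x ∈ Ioo 0 L, ∀ y ∈ ({-1, 1} : Set ℝ), g (x, y) = 0 := by
  intro x hx y hy
  have hi : ∀ i j, i + j ≤ 5 → IntegrableOn (wpd L i j φ) (Om L) := fun i j hij =>
    (hφ.memLp_wpd hij).integrable (by norm_num)
  refine trace_eq_zero_of_green hL (G := wpd L 1 1 φ) (hi 1 1 (by norm_num))
    hg hgφ (fun η hη hc hs => ?_) hx hy
  have hb : ∀ {Q θ : ℝ × ℝ → ℝ}, IntegrableOn Q (Om L) → ContDiff ℝ ∞ θ → HasCompactSupport θ →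
      IntegrableOn (fun z => Q z * θ z) (Om L) := by
    intro Q θ hQ hθ hθc
    obtain ⟨C, hC⟩ := hθ.continuous.bounded_above_of_compact_support hθc
    exact Integrable.mul_bdd (c := C) hQ hθ.continuous.aestronglyMeasurable
      (Eventually.of_forall hC)
  have s0 := contDiff_tpd hη 0
  have s1 := contDiff_tpd hη 1
  have k0 := hasCompactSupport_tpd hc 0
  have k1 := hasCompactSupport_tpd hc 1
  have e1 := integral_mul_tpd_fst_of_support (hi 0 0 (by norm_num)) (hi 1 0 (by norm_num))
    (hφ.isWeakPartial_fst (by norm_num)) s1 k1 ((tsupport_tpd_subset η 1).trans hs)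
  have e2 := integral_mul_tpd_fst_of_support (hi 0 1 (by norm_num)) (hi 1 1 (by norm_num))
    (hφ.isWeakPartial_fst (by norm_num)) hη hc hs
  have e3 := hz (tpd 0 η) s0 k0 ((tsupport_tpd_subset η 0).trans hs)
  rw [integral_add (hb (hi 0 0 (by norm_num)) (contDiff_tpd s0 1) (hasCompactSupport_tpd k0 1))
    (hb (hi 0 1 (by norm_num)) s0 k0), tpd_comm hη 1 0, e1, e2] at e3
  rw [integral_add (hb (hi 1 0 (by norm_num)) s1 k1) (hb (hi 1 1 (by norm_num)) hη hc)]
  linarith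

/-! ### The sonic speed and the function `H` -/

theorem us_pos {γ J S₀ : ℝ} (hγ : 1 < γ) (hJ : 0 < J) (hS₀ : 0 < S₀) : 0 < us γ J S₀ :=
  Real.rpow_pos_of_pos (by have := Real.rpow_pos_of_pos hJ (γ - 1); positivity) _

theorem us_rpow {γ J S₀ : ℝ} (hγ : 1 < γ) (hJ : 0 < J) (hS₀ : 0 < S₀) :
    us γ J S₀ ^ (γ + 1) = γ * S₀ * J ^ (γ - 1) := by
  have := Real.rpow_pos_of_pos hJ (γ - 1)
  rw [us, ← Real.rpow_mul (by positivity), one_div, inv_mul_cancel₀ (by linarith), Real.rpow_one]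

theorem us_lt_uIon {γ ζ₀ J S₀ : ℝ} (hγ : 1 < γ) (hζ₀ : 1 < ζ₀) (hJ : 0 < J) (hS₀ : 0 < S₀) :
    us γ J S₀ < uIon γ ζ₀ J S₀ := by
  have := us_pos hγ hJ hS₀
  rw [uIon]; nlinarith

/-- The integrand in the definition of `H`. -/
noncomputable def Hderiv (γ ζ₀ J S₀ t : ℝ) : ℝ :=
  J / (uIon γ ζ₀ J S₀ * t ^ (γ + 1)) * (t ^ (γ + 1) - us γ J S₀ ^ (γ + 1)) * (uIon γ ζ₀ J S₀ - t)

theorem hasDerivAt_H {γ ζ₀ J S₀ : ℝ} (hγ : 1 < γ) (hζ₀ : 1 < ζ₀) (hJ : 0 < J) (hS₀ : 0 < S₀)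
    {u : ℝ} (hu : 0 < u) : HasDerivAt (H γ ζ₀ J S₀) (Hderiv γ ζ₀ J S₀ u) u := by
  have hs := us_pos hγ hJ hS₀
  have hI := hs.trans (us_lt_uIon hγ hζ₀ hJ hS₀)
  have hc : ContinuousOn (Hderiv γ ζ₀ J S₀) (Ioi 0) := by
    have hp : ContinuousOn (fun t : ℝ => t ^ (γ + 1)) (Ioi 0) :=
      continuousOn_id.rpow_const fun x hx => Or.inl (ne_of_gt hx)
    unfold Hderiv
    refine ((continuousOn_const.div (continuousOn_const.mul hp) fun t ht => ?_).mul
      (hp.sub continuousOn_const)).mul (continuousOn_const.sub continuousOn_id)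
    exact (mul_pos hI (Real.rpow_pos_of_pos ht (γ + 1))).ne'
  refine intervalIntegral.integral_hasDerivAt_right ?_ ?_ ?_
  · refine (hc.mono fun t ht => ?_).intervalIntegrable
    exact (lt_min hs hu).trans_le ht.1
  · exact hc.stronglyMeasurableAtFilter isOpen_Ioi u hu
  · exact hc.continuousAt (Ioi_mem_nhds hu)

theorem H_us (γ ζ₀ J S₀ : ℝ) : H γ ζ₀ J S₀ (us γ J S₀) = 0 := intervalIntegral.integral_same

/-- The sign condition says that `f` does not increase before `s` and does not decrease after it, so
its minimum is the value 0 at `s`; proved by the mean value theorem on each side. -/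
theorem nonneg_of_deriv_mul_nonneg {a b s : ℝ} {f f' : ℝ → ℝ} (hs : s ∈ Icc a b) (hfs : f s = 0)
    (hd : ∀ u ∈ Icc a b, HasDerivAt f (f' u) u) (h : ∀ u ∈ Icc a b, 0 ≤ f' u * (u - s))
    {u : ℝ} (hu : u ∈ Icc a b) : 0 ≤ f u := by
  rcases lt_trichotomy u s with hlt | rfl | hlt
  · obtain ⟨c, hc, he⟩ := exists_hasDerivAt_eq_slope f f' hlt
      (fun t ht => (hd t ⟨hu.1.trans ht.1, ht.2.trans hs.2⟩).continuousAt.continuousWithinAt)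
      (fun t ht => hd t ⟨hu.1.trans ht.1.le, ht.2.le.trans hs.2⟩)
    have h1 := h c ⟨hu.1.trans hc.1.le, hc.2.le.trans hs.2⟩
    have h2 : f' c ≤ 0 := by
      by_contra hcon
      have := mul_neg_of_pos_of_neg (not_le.1 hcon) (sub_neg.2 hc.2)
      linarith
    rw [he, hfs, div_le_iff₀ (by linarith)] at h2
    linarith
  · exact hfs.ge
  · obtain ⟨c, hc, he⟩ := exists_hasDerivAt_eq_slope f f' hlt
      (fun t ht => (hd t ⟨hs.1.trans ht.1, ht.2.trans hu.2⟩).continuousAt.continuousWithinAt)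
      (fun t ht => hd t ⟨hs.1.trans ht.1.le, ht.2.le.trans hu.2⟩)
    have h1 := h c ⟨hs.1.trans hc.1.le, hc.2.le.trans hu.2⟩
    have h2 : 0 ≤ f' c := by
      by_contra hcon
      have := mul_neg_of_neg_of_pos (not_le.1 hcon) (sub_pos.2 hc.1)
      linarith
    rw [he, hfs, le_div_iff₀ (by linarith)] at h2
    linarith

/-- Write u^(γ+1) - s^(γ+1) = s^γ(u - s) + u(u^γ - s^γ); the last term has the sign of u - s. -/
theorem rpow_sub_mul_sub_ge {γ s u : ℝ} (hγ : 1 < γ) (hs : 0 < s) (hu : 0 < u) :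
    s ^ γ * (u - s) ^ 2 ≤ (u ^ (γ + 1) - s ^ (γ + 1)) * (u - s) := by
  have e : ∀ t : ℝ, 0 < t → t ^ (γ + 1) = t ^ γ * t := fun t ht => by
    rw [Real.rpow_add ht, Real.rpow_one]
  rw [e u hu, e s hs]
  have h : 0 ≤ (u ^ γ - s ^ γ) * (u - s) := by
    rcases le_total u s with h | h
    · have := Real.rpow_le_rpow hu.le h (by linarith : 0 ≤ γ)
      exact mul_nonneg_of_nonpos_of_nonpos (by linarith) (by linarith)
    · have := Real.rpow_le_rpow hs.le h (by linarith : 0 ≤ γ)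
      exact mul_nonneg (by linarith) (by linarith)
  nlinarith

theorem abs_rpow_sub_ge {γ s u : ℝ} (hγ : 1 < γ) (hs : 0 < s) (hu : 0 < u) :
    s ^ γ * |u - s| ≤ |u ^ (γ + 1) - s ^ (γ + 1)| := by
  rcases (abs_nonneg (u - s)).eq_or_lt with h | h
  · rw [← h, mul_zero]; exact abs_nonneg _
  · refine le_of_mul_le_mul_right ?_ h
    rw [mul_assoc, ← sq, sq_abs, ← abs_mul]
    exact (rpow_sub_mul_sub_ge hγ hs hu).trans (le_abs_self _)

theorem abs_rpow_sub_le {γ s u b : ℝ} (hγ : 1 < γ) (hs : 0 < s) (hu : 0 < u) (hsb : s ≤ b)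
    (hub : u ≤ b) : |u ^ (γ + 1) - s ^ (γ + 1)| ≤ (γ + 1) * b ^ γ * |u - s| := by
  have hd : ∀ x ∈ Ioc 0 b, HasDerivWithinAt (fun t : ℝ => t ^ (γ + 1)) ((γ + 1) * x ^ γ)
      (Ioc 0 b) x := by
    intro x hx
    have := Real.hasDerivAt_rpow_const (x := x) (p := γ + 1) (Or.inl hx.1.ne')
    rw [add_sub_cancel_right] at this
    exact this.hasDerivWithinAt
  have hb : ∀ x ∈ Ioc 0 b, ‖(γ + 1) * x ^ γ‖ ≤ (γ + 1) * b ^ γ := by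
    intro x hx
    have := Real.rpow_pos_of_pos hx.1 γ
    rw [Real.norm_of_nonneg (by positivity)]
    have := Real.rpow_le_rpow hx.1.le hx.2 (by linarith : 0 ≤ γ)
    gcongr
  exact (convex_Ioc 0 b).norm_image_sub_le_of_norm_hasDerivWithin_le hd hb ⟨hs, hsb⟩ ⟨hu, hub⟩

theorem exists_pos_bounds {a b : ℝ} (hab : a ≤ b) {f : ℝ → ℝ} (hf : ContinuousOn f (Icc a b))
    (hpos : ∀ x ∈ Icc a b, 0 < f x) :
    ∃ m M : ℝ, 0 < m ∧ 0 < M ∧ ∀ x ∈ Icc a b, m ≤ f x ∧ f x ≤ M := by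
  obtain ⟨x, hx, hmin⟩ := isCompact_Icc.exists_isMinOn (nonempty_Icc.2 hab) hf
  obtain ⟨y, hy, hmax⟩ := isCompact_Icc.exists_isMaxOn (nonempty_Icc.2 hab) hf
  exact ⟨f x, f y, hpos x hx, hpos y hy, fun z hz => ⟨hmin hz, hmax hz⟩⟩

/-- Near the sonic speed, `H` is comparable to the square of the distance to the sonic speed. -/
theorem exists_H_bounds {γ ζ₀ J S₀ a b : ℝ} (hγ : 1 < γ) (hζ₀ : 1 < ζ₀) (hJ : 0 < J)
    (hS₀ : 0 < S₀) (ha : 0 < a) (has : a ≤ us γ J S₀) (hsb : us γ J S₀ ≤ b)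
    (hb : b < uIon γ ζ₀ J S₀) :
    ∃ m M : ℝ, 0 < m ∧ 0 < M ∧ ∀ u ∈ Icc a b,
      m * (u - us γ J S₀) ^ 2 ≤ H γ ζ₀ J S₀ u ∧ H γ ζ₀ J S₀ u ≤ M * (u - us γ J S₀) ^ 2 := by
  set s := us γ J S₀ with hs_def
  have hs : 0 < s := us_pos hγ hJ hS₀
  have hI : 0 < uIon γ ζ₀ J S₀ := by linarith
  have hb0 : 0 < b := by linarith
  -- H' is this factor times t^(γ+1) - s^(γ+1). The factor is bounded between positive constants
  -- because the window stays below `uIon`, and the other factor is comparable to t - s.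
  have hq : ContinuousOn (fun t => J / (uIon γ ζ₀ J S₀ * t ^ (γ + 1)) * (uIon γ ζ₀ J S₀ - t))
      (Icc a b) := by
    have hp : ContinuousOn (fun t : ℝ => t ^ (γ + 1)) (Icc a b) :=
      continuousOn_id.rpow_const fun x hx => Or.inl (ha.trans_le hx.1).ne'
    refine (continuousOn_const.div (continuousOn_const.mul hp) fun t ht => ?_).mul
      (continuousOn_const.sub continuousOn_id)
    exact (mul_pos hI (Real.rpow_pos_of_pos (ha.trans_le ht.1) (γ + 1))).ne'
  obtain ⟨m, M, hm, hM, hmM⟩ := exists_pos_bounds (has.trans hsb) hq (fun t ht => by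
    have := Real.rpow_pos_of_pos (ha.trans_le ht.1) (γ + 1)
    have : 0 < uIon γ ζ₀ J S₀ - t := by linarith [ht.2]
    positivity)
  have hsg := Real.rpow_pos_of_pos hs γ
  have hbg := Real.rpow_pos_of_pos hb0 γ
  have hd : ∀ c : ℝ, ∀ u ∈ Icc a b, HasDerivAt (fun u => H γ ζ₀ J S₀ u - c * (u - s) ^ 2)
      (Hderiv γ ζ₀ J S₀ u - c * (2 * (u - s))) u := by
    intro c u hu
    have h1 : HasDerivAt (fun u : ℝ => (u - s) ^ 2) (2 * (u - s)) u := by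
      simpa using ((hasDerivAt_id u).sub_const s).fun_pow 2
    exact (hasDerivAt_H hγ hζ₀ hJ hS₀ (ha.trans_le hu.1)).sub (h1.const_mul c)
  have hHd : ∀ u ∈ Icc a b, m * s ^ γ * (u - s) ^ 2 ≤ Hderiv γ ζ₀ J S₀ u * (u - s) ∧
      Hderiv γ ζ₀ J S₀ u * (u - s) ≤ M * ((γ + 1) * b ^ γ) * (u - s) ^ 2 := by
    intro u hu
    obtain ⟨h1, h2⟩ := hmM u hu
    have hu0 := ha.trans_le hu.1
    have h3 := rpow_sub_mul_sub_ge hγ hs hu0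
    have h4 : (u ^ (γ + 1) - s ^ (γ + 1)) * (u - s) ≤ (γ + 1) * b ^ γ * (u - s) ^ 2 := by
      refine (le_abs_self _).trans ?_
      rw [abs_mul, ← sq_abs (u - s), sq, ← mul_assoc]
      exact mul_le_mul_of_nonneg_right (abs_rpow_sub_le hγ hs hu0 hsb hu.2) (abs_nonneg _)
    have h5 : 0 ≤ (u ^ (γ + 1) - s ^ (γ + 1)) * (u - s) := le_trans (by positivity) h3
    have e : Hderiv γ ζ₀ J S₀ u * (u - s) =
        J / (uIon γ ζ₀ J S₀ * u ^ (γ + 1)) * (uIon γ ζ₀ J S₀ - u) *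
          ((u ^ (γ + 1) - s ^ (γ + 1)) * (u - s)) := by
      rw [Hderiv]; ring
    rw [e]
    constructor
    · rw [mul_assoc m]
      exact mul_le_mul h1 h3 (by positivity) (hm.le.trans h1)
    · rw [mul_assoc M]
      exact mul_le_mul h2 h4 h5 hM.le
  refine ⟨m * s ^ γ / 2, M * ((γ + 1) * b ^ γ) / 2, by positivity, by positivity, fun u hu => ?_⟩
  have hsI : s ∈ Icc a b := ⟨has, hsb⟩
  have hH0 : H γ ζ₀ J S₀ s = 0 := H_us γ ζ₀ J S₀
  constructor
  · have := nonneg_of_deriv_mul_nonneg hsI (by simp [hH0]) (hd (m * s ^ γ / 2)) (fun u hu => by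
      have := (hHd u hu).1
      nlinarith) hu
    linarith
  · have := nonneg_of_deriv_mul_nonneg (f := fun u => -(H γ ζ₀ J S₀ u -
      M * ((γ + 1) * b ^ γ) / 2 * (u - s) ^ 2)) hsI (by simp [hH0])
      (fun u hu => (hd (M * ((γ + 1) * b ^ γ) / 2) u hu).neg) (fun u hu => by
      have := (hHd u hu).2
      nlinarith) hu
    linarith

theorem H_pos {γ ζ₀ J S₀ u : ℝ} (hγ : 1 < γ) (hζ₀ : 1 < ζ₀) (hJ : 0 < J) (hS₀ : 0 < S₀)
    (hu : 0 < u) (huI : u < uIon γ ζ₀ J S₀) (hne : u ≠ us γ J S₀) : 0 < H γ ζ₀ J S₀ u := by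
  have hs := us_pos hγ hJ hS₀
  obtain ⟨m, M, hm, -, h⟩ := exists_H_bounds (a := min u (us γ J S₀)) (b := max u (us γ J S₀))
    hγ hζ₀ hJ hS₀ (lt_min hu hs) (min_le_right _ _) (le_max_right _ _)
    (max_lt huI (us_lt_uIon hγ hζ₀ hJ hS₀))
  have := (h u ⟨min_le_left _ _, le_max_left _ _⟩).1
  have : 0 < (u - us γ J S₀) ^ 2 := by
    have := sub_ne_zero.2 hne
    positivity
  exact (by positivity : 0 < m * (u - us γ J S₀) ^ 2).trans_le (by assumption)

theorem Hderiv_neg {γ ζ₀ J S₀ t : ℝ} (hγ : 1 < γ) (hζ₀ : 1 < ζ₀) (hJ : 0 < J) (hS₀ : 0 < S₀)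
    (ht : 0 < t) (hts : t < us γ J S₀) : Hderiv γ ζ₀ J S₀ t < 0 := by
  have hI := us_lt_uIon hγ hζ₀ hJ hS₀
  have h1 := Real.rpow_lt_rpow ht.le hts (by linarith : 0 < γ + 1)
  have h2 := Real.rpow_pos_of_pos ht (γ + 1)
  have h3 : 0 < uIon γ ζ₀ J S₀ := by linarith
  exact mul_neg_of_neg_of_pos (mul_neg_of_pos_of_neg (by positivity) (by linarith)) (by linarith)

theorem Hderiv_pos {γ ζ₀ J S₀ t : ℝ} (hγ : 1 < γ) (hJ : 0 < J) (hS₀ : 0 < S₀)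
    (hts : us γ J S₀ < t) (htI : t < uIon γ ζ₀ J S₀) : 0 < Hderiv γ ζ₀ J S₀ t := by
  have hs := us_pos hγ hJ hS₀
  have ht : 0 < t := by linarith
  have h1 := Real.rpow_lt_rpow hs.le hts (by linarith : 0 < γ + 1)
  have h2 := Real.rpow_pos_of_pos ht (γ + 1)
  have h3 : 0 < uIon γ ζ₀ J S₀ := by linarith
  exact mul_pos (mul_pos (by positivity) (by linarith)) (by linarith)

theorem strictAntiOn_H {γ ζ₀ J S₀ : ℝ} (hγ : 1 < γ) (hζ₀ : 1 < ζ₀) (hJ : 0 < J) (hS₀ : 0 < S₀) :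
    StrictAntiOn (H γ ζ₀ J S₀) (Ioc 0 (us γ J S₀)) := by
  refine strictAntiOn_of_deriv_neg (convex_Ioc _ _)
    (fun t ht => (hasDerivAt_H hγ hζ₀ hJ hS₀ ht.1).continuousAt.continuousWithinAt) fun t ht => ?_
  rw [interior_Ioc] at ht
  rw [(hasDerivAt_H hγ hζ₀ hJ hS₀ ht.1).deriv]
  exact Hderiv_neg hγ hζ₀ hJ hS₀ ht.1 ht.2

theorem strictMonoOn_H {γ ζ₀ J S₀ : ℝ} (hγ : 1 < γ) (hζ₀ : 1 < ζ₀) (hJ : 0 < J) (hS₀ : 0 < S₀) :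
    StrictMonoOn (H γ ζ₀ J S₀) (Icc (us γ J S₀) (uIon γ ζ₀ J S₀)) := by
  have hs := us_pos hγ hJ hS₀
  refine strictMonoOn_of_deriv_pos (convex_Icc _ _)
    (fun t ht => (hasDerivAt_H hγ hζ₀ hJ hS₀
      (hs.trans_le ht.1)).continuousAt.continuousWithinAt) fun t ht => ?_
  rw [interior_Icc] at ht
  rw [(hasDerivAt_H hγ hζ₀ hJ hS₀ (hs.trans ht.1)).deriv]
  exact Hderiv_pos hγ hJ hS₀ ht.1 ht.2

/-! ### The background flow -/

section Background

variable {γ ζ₀ J S₀ E₀ ℓ : ℝ} {u E : ℝ → ℝ}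

theorem IsBackground.hasDerivWithinAt_u (h : IsBackground γ ζ₀ J S₀ E₀ ℓ u E) {x : ℝ}
    (hx : x ∈ Ico 0 ℓ) : HasDerivWithinAt u (derivWithin u (Ico 0 ℓ) x) (Ico 0 ℓ) x :=
  (h.smooth_u.differentiableOn (by simp) x hx).hasDerivWithinAt

theorem IsBackground.hasDerivWithinAt_E (h : IsBackground γ ζ₀ J S₀ E₀ ℓ u E) {x : ℝ}
    (hx : x ∈ Ico 0 ℓ) : HasDerivWithinAt E (J / u x - rhoIon γ ζ₀ J S₀) (Ico 0 ℓ) x := by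
  rw [← h.ode_E x hx]
  exact (h.smooth_E.differentiableOn (by simp) x hx).hasDerivWithinAt

theorem IsBackground.hasDerivAt_u (h : IsBackground γ ζ₀ J S₀ E₀ ℓ u E) {x : ℝ}
    (hx : x ∈ Ioo 0 ℓ) : HasDerivAt u (derivWithin u (Ico 0 ℓ) x) x :=
  (h.hasDerivWithinAt_u (Ioo_subset_Ico_self hx)).hasDerivAt (Ico_mem_nhds hx.1 hx.2)

theorem IsBackground.hasDerivAt_E (h : IsBackground γ ζ₀ J S₀ E₀ ℓ u E) {x : ℝ}
    (hx : x ∈ Ioo 0 ℓ) : HasDerivAt E (J / u x - rhoIon γ ζ₀ J S₀) x :=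
  (h.hasDerivWithinAt_E (Ioo_subset_Ico_self hx)).hasDerivAt (Ico_mem_nhds hx.1 hx.2)

theorem IsBackground.continuousOn_derivWithin (h : IsBackground γ ζ₀ J S₀ E₀ ℓ u E) :
    ContinuousOn (derivWithin u (Ico 0 ℓ)) (Ico 0 ℓ) :=
  h.smooth_u.continuousOn_derivWithin (uniqueDiffOn_Ico 0 ℓ) (by simp)

theorem IsBackground.strictMonoOn_u (h : IsBackground γ ζ₀ J S₀ E₀ ℓ u E) :
    StrictMonoOn u (Ico 0 ℓ) := by
  refine strictMonoOn_of_deriv_pos (convex_Ico _ _) h.smooth_u.continuousOn fun x hx => ?_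
  rw [interior_Ico] at hx
  rw [(h.hasDerivAt_u hx).deriv]
  exact h.accelerating x (Ioo_subset_Ico_self hx)

/-- Since ū' > 0, the differential equation forces E to have the sign of ū^(γ+1) - u_s^(γ+1): the
flow remains on the accelerating branch, not merely on the curve E²/2 = H. -/
theorem IsBackground.sub_mul_nonneg (h : IsBackground γ ζ₀ J S₀ E₀ ℓ u E) (hγ : 1 < γ)
    (hJ : 0 < J) (hS₀ : 0 < S₀) {x : ℝ} (hx : x ∈ Ico 0 ℓ) : 0 ≤ (u x - us γ J S₀) * E x := by
  have h1 := rpow_sub_mul_sub_ge hγ (us_pos hγ hJ hS₀) (h.pos x hx)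
  have h2 := h.ode_u x hx
  have h3 := h.accelerating x hx
  have h4 := Real.rpow_pos_of_pos (h.pos x hx) γ
  have h5 := Real.rpow_pos_of_pos (us_pos hγ hJ hS₀) γ
  refine nonneg_of_mul_nonneg_left (b := u x ^ γ) ?_ h4
  calc 0 ≤ derivWithin u (Ico 0 ℓ) x *
        ((u x ^ (γ + 1) - us γ J S₀ ^ (γ + 1)) * (u x - us γ J S₀)) :=
        mul_nonneg h3.le (le_trans (by positivity) h1)
    _ = (u x - us γ J S₀) * (E x * u x ^ γ) := by rw [← h2]; ring
    _ = _ := by ring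

/-- The background flow stays on the critical trajectory. -/
theorem IsBackground.energy (h : IsBackground γ ζ₀ J S₀ E₀ ℓ u E) (hγ : 1 < γ) (hζ₀ : 1 < ζ₀)
    (hJ : 0 < J) (hS₀ : 0 < S₀) {X : ℝ} (hX : X ∈ Ico 0 ℓ) :
    E X ^ 2 / 2 = H γ ζ₀ J S₀ (u X) := by
  have hI : 0 < uIon γ ζ₀ J S₀ := (us_pos hγ hJ hS₀).trans (us_lt_uIon hγ hζ₀ hJ hS₀)
  have hsub : Icc 0 X ⊆ Ico 0 ℓ := fun x hx => ⟨hx.1, hx.2.trans_lt hX.2⟩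
  have hd : ∀ x ∈ Ico 0 ℓ, HasDerivWithinAt (fun x => E x ^ 2 / 2 - H γ ζ₀ J S₀ (u x)) 0
      (Ico 0 ℓ) x := by
    intro x hx
    have hux := h.pos x hx
    have h1 := ((h.hasDerivWithinAt_E hx).fun_pow 2).div_const 2
    have h2 := (hasDerivAt_H hγ hζ₀ hJ hS₀ hux).comp_hasDerivWithinAt x (h.hasDerivWithinAt_u hx)
    refine (h1.fun_sub h2).congr_deriv ?_
    have h3 := h.ode_u x hx
    have h4 : u x ^ (γ + 1) = u x ^ γ * u x := by rw [Real.rpow_add hux, Real.rpow_one]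
    have h5 := Real.rpow_pos_of_pos hux γ
    -- The factor of H' that degenerates at the sonic point is precisely the one multiplying ū' in
    -- the equation, so nothing is divided by zero.
    have h6 : Hderiv γ ζ₀ J S₀ (u x) * derivWithin u (Ico 0 ℓ) x =
        J / (uIon γ ζ₀ J S₀ * u x ^ (γ + 1)) * (E x * u x ^ γ) * (uIon γ ζ₀ J S₀ - u x) := by
      rw [← h3, Hderiv]; ring
    rw [h6, h4, rhoIon]
    field_simp
    simp
  have hc := constant_of_derivWithin_zero (f := fun x => E x ^ 2 / 2 - H γ ζ₀ J S₀ (u x))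
    (a := 0) (b := X) (fun x hx => ((hd x (hsub hx)).mono hsub).differentiableWithinAt)
    (fun x hx => ((hd x (hsub (Ico_subset_Icc_self hx))).mono hsub).derivWithin
      (uniqueDiffOn_Icc (hx.1.trans_lt hx.2) x (Ico_subset_Icc_self hx))) X ⟨hX.1, le_rfl⟩
  have h0 : E 0 ^ 2 / 2 - H γ ζ₀ J S₀ (u 0) = 0 := h.init_mem.2.1
  simp only [h0] at hc
  linarith

/-- Bernoulli's law: by the equation for ū the right side has derivative E, and the constants in Φ̄
are its value at the entrance. Consequently (γ-1)(Φ̄ - ū²/2) is the squared sound speed. -/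
theorem IsBackground.PhiBar_eq (h : IsBackground γ ζ₀ J S₀ E₀ ℓ u E) (hγ : 1 < γ)
    (hJ : 0 < J) (hS₀ : 0 < S₀) {X : ℝ} (hX : X ∈ Ico 0 ℓ) :
    PhiBar γ J S₀ u E X = u X ^ 2 / 2 + γ * S₀ / (γ - 1) * (J / u X) ^ (γ - 1) := by
  have hsub : Icc 0 X ⊆ Ico 0 ℓ := fun x hx => ⟨hx.1, hx.2.trans_lt hX.2⟩
  have hd : ∀ x ∈ Ico 0 ℓ, HasDerivWithinAt
      (fun x => u x ^ 2 / 2 + γ * S₀ / (γ - 1) * (J / u x) ^ (γ - 1)) (E x) (Ico 0 ℓ) x := by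
    intro x hx
    have hux := h.pos x hx
    have h1 := ((h.hasDerivWithinAt_u hx).fun_pow 2).div_const 2
    have h2 : HasDerivWithinAt (fun x => J / u x) (-J * derivWithin u (Ico 0 ℓ) x / u x ^ 2)
        (Ico 0 ℓ) x := by
      refine ((hasDerivWithinAt_const x _ J).fun_div (h.hasDerivWithinAt_u hx) hux.ne').congr_deriv ?_
      ring
    have h3 := (h2.rpow_const (p := γ - 1) (Or.inl (by positivity))).const_mul
      (γ * S₀ / (γ - 1))
    refine (h1.fun_add h3).congr_deriv ?_
    have h4 := h.ode_u x hx
    rw [us_rpow hγ hJ hS₀] at h4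
    have h5 : u x ^ (γ + 1) = u x ^ γ * u x := by rw [Real.rpow_add hux, Real.rpow_one]
    have h6 := Real.rpow_pos_of_pos hux γ
    have h7 : (J / u x) ^ (γ - 1 - 1) = J ^ (γ - 1) / J * (u x ^ 2 / u x ^ γ) := by
      rw [Real.div_rpow hJ.le hux.le, Real.rpow_sub hJ (γ - 1) 1, Real.rpow_one,
        Real.rpow_sub hux (γ - 1) 1, Real.rpow_sub hux γ 1, Real.rpow_one]
      field_simp
    rw [h7]
    have hγ1 : γ - 1 ≠ 0 := by linarith
    rw [h5] at h4
    have h8 : E x = derivWithin u (Ico 0 ℓ) x * (u x ^ γ * u x - γ * S₀ * J ^ (γ - 1)) /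
        u x ^ γ := by
      rw [h4]; field_simp
    rw [h8]
    field_simp
    ring
  have hint := intervalIntegral.integral_eq_sub_of_hasDerivAt_of_le hX.1
    (f := fun x => u x ^ 2 / 2 + γ * S₀ / (γ - 1) * (J / u x) ^ (γ - 1)) (f' := E)
    (fun x hx => (hd x (hsub hx)).continuousWithinAt.mono hsub)
    (fun x hx => (hd x (hsub (Ioo_subset_Icc_self hx))).hasDerivAt
      (Ico_mem_nhds hx.1 (hx.2.trans hX.2)))
    (ContinuousOn.intervalIntegrable (by
      rw [uIcc_of_le hX.1]; exact h.smooth_E.continuousOn.mono hsub))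
  rw [PhiBar, hint]
  ring

/-- On the accelerating branch below `uIon`, E is a strictly increasing function of u: it is -√(2H)
up to the sonic speed, where H decreases, and √(2H) beyond, where H increases. -/
theorem lt_of_mem_trajectory (hγ : 1 < γ) (hζ₀ : 1 < ζ₀) (hJ : 0 < J) (hS₀ : 0 < S₀)
    {u₁ u₂ E₁ E₂ : ℝ} (h₁ : 0 < u₁) (h₁₂ : u₁ < u₂) (h₂ : u₂ < uIon γ ζ₀ J S₀)
    (e₁ : E₁ ^ 2 / 2 = H γ ζ₀ J S₀ u₁) (e₂ : E₂ ^ 2 / 2 = H γ ζ₀ J S₀ u₂)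
    (s₁ : 0 ≤ (u₁ - us γ J S₀) * E₁) (s₂ : 0 ≤ (u₂ - us γ J S₀) * E₂) : E₁ < E₂ := by
  have hneg : ∀ {v F : ℝ}, v < us γ J S₀ → 0 ≤ (v - us γ J S₀) * F → F ≤ 0 := fun hv hF => by
    by_contra hcon
    have := mul_neg_of_neg_of_pos (sub_neg.2 hv) (not_le.1 hcon)
    linarith
  have hpos : ∀ {v F : ℝ}, us γ J S₀ < v → 0 ≤ (v - us γ J S₀) * F → 0 ≤ F := fun hv hF => by
    by_contra hcon
    have := mul_neg_of_pos_of_neg (sub_pos.2 hv) (not_le.1 hcon)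
    linarith
  have hzero : ∀ {v F : ℝ}, v = us γ J S₀ → F ^ 2 / 2 = H γ ζ₀ J S₀ v → F = 0 := by
    intro v F hv hF
    rw [hv, H_us] at hF
    have : F ^ 2 = 0 := by linarith
    exact pow_eq_zero_iff (two_ne_zero) |>.1 this
  rcases le_or_gt u₂ (us γ J S₀) with h | h
  · have hH := strictAntiOn_H hγ hζ₀ hJ hS₀ ⟨h₁, h₁₂.le.trans h⟩ ⟨h₁.trans h₁₂, h⟩ h₁₂
    have a₁ := hneg (h₁₂.trans_le h) s₁
    have a₂ : E₂ ≤ 0 := by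
      rcases h.eq_or_lt with h | h
      · exact (hzero h e₂).le
      · exact hneg h s₂
    nlinarith
  · have a₂ := hpos h s₂
    rcases le_or_gt (us γ J S₀) u₁ with h' | h'
    · have hH := strictMonoOn_H hγ hζ₀ hJ hS₀ ⟨h', (h₁₂.trans h₂).le⟩ ⟨h.le, h₂.le⟩ h₁₂
      have a₁ : 0 ≤ E₁ := by
        rcases h'.eq_or_lt with h' | h'
        · exact (hzero h'.symm e₁).ge
        · exact hpos h' s₁
      nlinarith
    · have a₁ := hneg h' s₁
      have := H_pos hγ hζ₀ hJ hS₀ h₁ (h₁₂.trans h₂) h'.ne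
      have : E₁ ≠ 0 := by rintro rfl; norm_num at e₁; linarith
      exact (lt_of_le_of_ne a₁ this).trans_le a₂

/-- The background flow is determined by its initial electric field. -/
theorem IsBackground.unique (h : IsBackground γ ζ₀ J S₀ E₀ ℓ u E) {ℓ' : ℝ} {u' E' : ℝ → ℝ}
    (h' : IsBackground γ ζ₀ J S₀ E₀ ℓ' u' E') (hγ : 1 < γ) (hζ₀ : 1 < ζ₀) (hJ : 0 < J)
    (hS₀ : 0 < S₀) {L : ℝ} (hL : L < ℓ) (hL' : L < ℓ') (hu : u L < uIon γ ζ₀ J S₀)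
    (hu' : u' L < uIon γ ζ₀ J S₀) : ∀ x ∈ Icc 0 L, u x = u' x ∧ E x = E' x := by
  have hsub : ∀ x ∈ Icc 0 L, x ∈ Ico 0 ℓ := fun x hx => ⟨hx.1, hx.2.trans_lt hL⟩
  have hsub' : ∀ x ∈ Icc 0 L, x ∈ Ico 0 ℓ' := fun x hx => ⟨hx.1, hx.2.trans_lt hL'⟩
  have hle : ∀ x ∈ Icc 0 L, u x < uIon γ ζ₀ J S₀ := fun x hx =>
    (h.strictMonoOn_u.monotoneOn (hsub x hx) (hsub L ⟨hx.1.trans hx.2, le_rfl⟩) hx.2).trans_lt hu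
  have hle' : ∀ x ∈ Icc 0 L, u' x < uIon γ ζ₀ J S₀ := fun x hx =>
    (h'.strictMonoOn_u.monotoneOn (hsub' x hx) (hsub' L ⟨hx.1.trans hx.2, le_rfl⟩) hx.2).trans_lt
      hu'
  have lt1 : ∀ x ∈ Icc 0 L, u x < u' x → E x < E' x := fun x hx hlt =>
    lt_of_mem_trajectory hγ hζ₀ hJ hS₀ (h.pos x (hsub x hx)) hlt (hle' x hx)
      (h.energy hγ hζ₀ hJ hS₀ (hsub x hx)) (h'.energy hγ hζ₀ hJ hS₀ (hsub' x hx))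
      (h.sub_mul_nonneg hγ hJ hS₀ (hsub x hx)) (h'.sub_mul_nonneg hγ hJ hS₀ (hsub' x hx))
  have lt2 : ∀ x ∈ Icc 0 L, u' x < u x → E' x < E x := fun x hx hlt =>
    lt_of_mem_trajectory hγ hζ₀ hJ hS₀ (h'.pos x (hsub' x hx)) hlt (hle x hx)
      (h'.energy hγ hζ₀ hJ hS₀ (hsub' x hx)) (h.energy hγ hζ₀ hJ hS₀ (hsub x hx))
      (h'.sub_mul_nonneg hγ hJ hS₀ (hsub' x hx)) (h.sub_mul_nonneg hγ hJ hS₀ (hsub x hx))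
  -- Comparing the fields rather than the velocities avoids the degenerate equation. The derivative
  -- is 2(E - E')(J/u - J/u'), which is nonpositive because the larger field goes with the larger
  -- velocity; the difference vanishes at the entrance.
  have hanti : AntitoneOn (fun x => (E x - E' x) ^ 2) (Icc 0 L) := by
    have hcont : ContinuousOn (fun x => (E x - E' x) ^ 2) (Icc 0 L) :=
      ((h.smooth_E.continuousOn.mono hsub).sub (h'.smooth_E.continuousOn.mono hsub')).pow 2
    have hd : ∀ x ∈ Ioo 0 L, HasDerivAt (fun x => (E x - E' x) ^ 2)
        (2 * (E x - E' x) * (J / u x - J / u' x)) x := by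
      intro x hx
      have h1 := h.hasDerivAt_E ⟨hx.1, hx.2.trans hL⟩
      have h2 := h'.hasDerivAt_E ⟨hx.1, hx.2.trans hL'⟩
      refine ((h1.fun_sub h2).fun_pow 2).congr_deriv ?_
      simp
    refine antitoneOn_of_deriv_nonpos (convex_Icc 0 L) hcont (fun x hx => ?_) fun x hx => ?_
    · rw [interior_Icc] at hx
      exact (hd x hx).differentiableAt.differentiableWithinAt
    · rw [interior_Icc] at hx
      rw [(hd x hx).deriv]
      have hx' := Ioo_subset_Icc_self hx
      have p1 := h.pos x (hsub x hx')
      have p2 := h'.pos x (hsub' x hx')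
      rcases lt_trichotomy (u x) (u' x) with hlt | heq | hlt
      · have := lt1 x hx' hlt
        have := div_le_div_of_nonneg_left hJ.le p1 hlt.le
        exact mul_nonpos_of_nonpos_of_nonneg (by linarith) (by linarith)
      · rw [heq]; simp
      · have := lt2 x hx' hlt
        have := div_le_div_of_nonneg_left hJ.le p2 hlt.le
        exact mul_nonpos_of_nonneg_of_nonpos (by linarith) (by linarith)
  intro x hx
  have h0 : (E x - E' x) ^ 2 ≤ (E 0 - E' 0) ^ 2 := hanti ⟨le_rfl, hx.1.trans hx.2⟩ hx hx.1
  rw [h.init, h'.init, sub_self] at h0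
  have hEE : E x = E' x := by
    have : (E x - E' x) ^ 2 = 0 := le_antisymm (by simpa using h0) (sq_nonneg _)
    have := pow_eq_zero_iff (two_ne_zero) |>.1 this
    linarith
  refine ⟨?_, hEE⟩
  rcases lt_trichotomy (u x) (u' x) with hlt | heq | hlt
  · exact absurd hEE (lt1 x hx hlt).ne
  · exact heq
  · exact absurd hEE (lt2 x hx hlt).ne'

end Background

/-- Uniform two-sided bounds for the acceleration near the sonic point. -/
theorem exists_acceleration_bounds {γ ζ₀ J S₀ a b : ℝ} (hγ : 1 < γ) (hζ₀ : 1 < ζ₀) (hJ : 0 < J)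
    (hS₀ : 0 < S₀) (ha : 0 < a) (has : a < us γ J S₀) (hsb : us γ J S₀ < b)
    (hb : b < uIon γ ζ₀ J S₀) :
    ∃ κ Λ : ℝ, 0 < κ ∧ 0 < Λ ∧ ∀ (E₀ ℓ : ℝ) (u E : ℝ → ℝ), IsBackground γ ζ₀ J S₀ E₀ ℓ u E →
      ∀ x ∈ Ico 0 ℓ, u x ∈ Icc a b →
        κ ≤ derivWithin u (Ico 0 ℓ) x ∧ derivWithin u (Ico 0 ℓ) x ≤ Λ := by
  obtain ⟨m, M, hm, hM, hmM⟩ := exists_H_bounds hγ hζ₀ hJ hS₀ ha has.le hsb.le hb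
  set s := us γ J S₀ with hs_def
  have hs : 0 < s := us_pos hγ hJ hS₀
  have hb0 : 0 < b := by linarith
  have hγ0 : 0 ≤ γ := by linarith
  have hsg := Real.rpow_pos_of_pos hs γ
  have hag := Real.rpow_pos_of_pos ha γ
  have hbg := Real.rpow_pos_of_pos hb0 γ
  -- In ū' = |E|ū^γ / |ū^(γ+1) - s^(γ+1)|, the bounds on H give √(2m)|ū - s| ≤ |E| ≤ √(2M)|ū - s|,
  -- and the distance to the sonic speed cancels.
  refine ⟨√(2 * m) * a ^ γ / ((γ + 1) * b ^ γ), √(2 * M) * b ^ γ / s ^ γ, by positivity,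
    by positivity, fun E₀ ℓ u E h => ?_⟩
  have key : ∀ x ∈ Ico 0 ℓ, u x ∈ Icc a b → u x ≠ s →
      √(2 * m) * a ^ γ / ((γ + 1) * b ^ γ) ≤ derivWithin u (Ico 0 ℓ) x ∧
        derivWithin u (Ico 0 ℓ) x ≤ √(2 * M) * b ^ γ / s ^ γ := by
    intro x hx hux hne
    have hu0 := h.pos x hx
    have hacc := h.accelerating x hx
    have hpos : 0 < |u x - s| := abs_pos.2 (sub_ne_zero.2 hne)
    have hE := h.energy hγ hζ₀ hJ hS₀ hx
    obtain ⟨l1, l2⟩ := hmM (u x) hux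
    have habs : derivWithin u (Ico 0 ℓ) x * |u x ^ (γ + 1) - s ^ (γ + 1)| = |E x| * u x ^ γ := by
      have := congrArg abs (h.ode_u x hx)
      rwa [abs_mul, abs_mul, abs_of_pos hacc, abs_of_pos (Real.rpow_pos_of_pos hu0 γ)] at this
    have E1 : √(2 * m) * |u x - s| ≤ |E x| := by
      rw [← Real.sqrt_sq_eq_abs, ← Real.sqrt_sq_eq_abs, ← Real.sqrt_mul (by positivity)]
      exact Real.sqrt_le_sqrt (by linarith)
    have E2 : |E x| ≤ √(2 * M) * |u x - s| := by
      rw [← Real.sqrt_sq_eq_abs, ← Real.sqrt_sq_eq_abs, ← Real.sqrt_mul (by positivity)]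
      exact Real.sqrt_le_sqrt (by linarith)
    have g1 := abs_rpow_sub_ge hγ hs hu0
    have g2 := abs_rpow_sub_le hγ hs hu0 hsb.le hux.2
    have p1 := Real.rpow_le_rpow ha.le hux.1 hγ0
    have p2 := Real.rpow_le_rpow hu0.le hux.2 hγ0
    constructor
    · rw [div_le_iff₀ (by positivity)]
      refine le_of_mul_le_mul_right ?_ hpos
      calc √(2 * m) * a ^ γ * |u x - s| = √(2 * m) * |u x - s| * a ^ γ := by ring
        _ ≤ |E x| * u x ^ γ := by gcongr
        _ = derivWithin u (Ico 0 ℓ) x * |u x ^ (γ + 1) - s ^ (γ + 1)| := habs.symm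
        _ ≤ derivWithin u (Ico 0 ℓ) x * ((γ + 1) * b ^ γ * |u x - s|) := by gcongr
        _ = _ := by ring
    · rw [le_div_iff₀ hsg]
      refine le_of_mul_le_mul_right ?_ hpos
      calc derivWithin u (Ico 0 ℓ) x * s ^ γ * |u x - s| =
            derivWithin u (Ico 0 ℓ) x * (s ^ γ * |u x - s|) := by ring
        _ ≤ derivWithin u (Ico 0 ℓ) x * |u x ^ (γ + 1) - s ^ (γ + 1)| := by gcongr
        _ = |E x| * u x ^ γ := habs
        _ ≤ √(2 * M) * |u x - s| * b ^ γ := by gcongr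
        _ = _ := by ring
  intro x hx hux
  by_cases hne : u x = s
  swap
  · exact key x hx hux hne
  -- At the sonic point the quotient is 0/0. Strict monotonicity makes all nearby points to the
  -- right non-sonic, and continuity of ū' carries the bounds back.
  have hmem : Ioo x ℓ ∈ 𝓝[>] x := Ioo_mem_nhdsGT hx.2
  have hsub : Ioo x ℓ ⊆ Ico 0 ℓ := fun t ht => ⟨hx.1.trans ht.1.le, ht.2⟩
  have hle : 𝓝[>] x ≤ 𝓝[Ico 0 ℓ] x := by
    refine le_inf nhdsWithin_le_nhds ?_
    exact le_principal_iff.2 (mem_of_superset hmem hsub)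
  have hucont : Tendsto u (𝓝[>] x) (𝓝 (u x)) := (h.smooth_u.continuousOn x hx).mono_left hle
  have hdcont : Tendsto (derivWithin u (Ico 0 ℓ)) (𝓝[>] x) (𝓝 (derivWithin u (Ico 0 ℓ) x)) :=
    (h.continuousOn_derivWithin x hx).mono_left hle
  have hev : ∀ᶠ t in 𝓝[>] x, √(2 * m) * a ^ γ / ((γ + 1) * b ^ γ) ≤ derivWithin u (Ico 0 ℓ) t ∧
        derivWithin u (Ico 0 ℓ) t ≤ √(2 * M) * b ^ γ / s ^ γ := by
    filter_upwards [hmem, hucont.eventually (gt_mem_nhds (by rw [hne]; exact hsb))] with t ht htb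
    have hlt : u x < u t := h.strictMonoOn_u hx (hsub ht) ht.1
    exact key t (hsub ht) ⟨hux.1.trans hlt.le, htb.le⟩ (by rw [← hne]; exact hlt.ne')
  exact ⟨ge_of_tendsto hdcont (hev.mono fun _ h => h.1),
    le_of_tendsto hdcont (hev.mono fun _ h => h.2)⟩

/-! ### Bounded Lipschitz functions on the rectangle -/

section LipBdd

variable {L M N : ℝ} {p q : ℝ × ℝ → ℝ}

theorem LipBdd.mono (hp : LipBdd L M p) (h : M ≤ N) : LipBdd L N p :=
  ⟨fun x hx => (hp.1 x hx).trans h, fun x hx y hy => (hp.2 x hx y hy).trans (by gcongr)⟩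

theorem LipBdd.add (hp : LipBdd L M p) (hq : LipBdd L N q) :
    LipBdd L (M + N) (fun x => p x + q x) := by
  refine ⟨fun x hx => (abs_add_le _ _).trans (add_le_add (hp.1 x hx) (hq.1 x hx)),
    fun x hx y hy => ?_⟩
  calc |p x + q x - (p y + q y)| = |(p x - p y) + (q x - q y)| := by ring_nf
    _ ≤ M * dist x y + N * dist x y :=
      (abs_add_le _ _).trans (add_le_add (hp.2 x hx y hy) (hq.2 x hx y hy))
    _ = _ := by ring

theorem LipBdd.const_mul (c : ℝ) (hp : LipBdd L M p) : LipBdd L (|c| * M) (fun x => c * p x) := by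
  refine ⟨fun x hx => ?_, fun x hx y hy => ?_⟩
  · rw [abs_mul]
    exact mul_le_mul_of_nonneg_left (hp.1 x hx) (abs_nonneg c)
  · rw [← mul_sub, abs_mul, mul_assoc]
    exact mul_le_mul_of_nonneg_left (hp.2 x hx y hy) (abs_nonneg c)

theorem LipBdd.sub (hp : LipBdd L M p) (hq : LipBdd L N q) :
    LipBdd L (M + N) (fun x => p x - q x) := by
  simpa [sub_eq_add_neg] using hp.add (hq.const_mul (-1))

/-- The factor 2 comes from the product rule for the Lipschitz constant; the sup bound would not
need it. -/
theorem LipBdd.mul (hM : 0 ≤ M) (hN : 0 ≤ N) (hp : LipBdd L M p) (hq : LipBdd L N q) :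
    LipBdd L (2 * M * N) (fun x => p x * q x) := by
  refine ⟨fun x hx => ?_, fun x hx y hy => ?_⟩
  · rw [abs_mul]
    have := mul_le_mul (hp.1 x hx) (hq.1 x hx) (abs_nonneg _) hM
    nlinarith [mul_nonneg hM hN]
  · have h1 : |p x * (q x - q y)| ≤ M * (N * dist x y) := by
      rw [abs_mul]
      exact mul_le_mul (hp.1 x hx) (hq.2 x hx y hy) (abs_nonneg _) hM
    have h2 : |(p x - p y) * q y| ≤ M * dist x y * N := by
      rw [abs_mul]
      exact mul_le_mul (hp.2 x hx y hy) (hq.1 y hy) (abs_nonneg _) (by positivity)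
    calc |p x * q x - p y * q y| = |p x * (q x - q y) + (p x - p y) * q y| := by ring_nf
      _ ≤ M * (N * dist x y) + M * dist x y * N := (abs_add_le _ _).trans (add_le_add h1 h2)
      _ = _ := by ring

theorem exists_lipBdd_fst {Q Q' : ℝ → ℝ}
    (hQ : ∀ x ∈ Icc 0 L, HasDerivWithinAt Q (Q' x) (Icc 0 L) x)
    (hQ' : ContinuousOn Q' (Icc 0 L)) : ∃ M, 0 ≤ M ∧ LipBdd L M (fun z => Q z.1) := by
  obtain ⟨C₁, h₁⟩ := isCompact_Icc.exists_bound_of_continuousOn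
    (fun x hx => (hQ x hx).continuousWithinAt : ContinuousOn Q (Icc 0 L))
  obtain ⟨C₂, h₂⟩ := isCompact_Icc.exists_bound_of_continuousOn hQ'
  refine ⟨max 0 (max C₁ C₂), le_max_left _ _, fun x hx => ?_, fun x hx y hy => ?_⟩
  · exact (h₁ x.1 hx.1).trans ((le_max_left _ _).trans (le_max_right _ _))
  · have h3 := (convex_Icc 0 L).norm_image_sub_le_of_norm_hasDerivWithin_le hQ h₂ hy.1 hx.1
    have h4 : ‖x.1 - y.1‖ ≤ dist x y := by
      rw [← dist_eq_norm, Prod.dist_eq]; exact le_max_left _ _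
    refine h3.trans (mul_le_mul ((le_max_right _ _).trans (le_max_right _ _)) h4
      (norm_nonneg _) (le_max_left _ _))

/-- The deviations of the coefficients from those of the background flow are small together with
the perturbation `(s₁, s₂)` of the velocity and the perturbation `z` of the potential. -/
theorem exists_small_perturbation {γ ε U B : ℝ} {u T : ℝ × ℝ → ℝ} (hε : 0 < ε) (hU : 0 ≤ U)
    (hB : 0 ≤ B) (hγ : 1 < γ) (hu : LipBdd L U u) (hT : LipBdd L B T) :
    ∃ t, 0 < t ∧ ∀ s₁ s₂ z : ℝ × ℝ → ℝ, LipBdd L t s₁ → LipBdd L t s₂ → LipBdd L t z →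
      LipBdd L ε (fun x => T x * ((γ - 1) * (z x - (2 * u x * s₁ x + s₁ x ^ 2 + s₂ x ^ 2) / 2) -
        2 * u x * s₁ x - s₁ x ^ 2)) ∧
      LipBdd L ε (fun x => T x * (-(u x + s₁ x) * s₂ x)) ∧
      LipBdd L ε (fun x => T x * ((γ - 1) * (z x - (2 * u x * s₁ x + s₁ x ^ 2 + s₂ x ^ 2) / 2) -
        s₂ x ^ 2)) := by
  set K := (γ - 1) * (2 * U + 3) + 4 * U + 4 with hK
  have hK0 : 0 < K := by
    have : 0 < γ - 1 := by linarith
    positivity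
  -- With t ≤ 1 the quadratic terms are bounded linearly in t, so each bracket has constant at most
  -- K·t; multiplying by `T` gives 2B·K·t ≤ ε.
  set t := min 1 (ε / (2 * B * K + 1)) with ht
  have ht0 : 0 < t := by positivity
  have ht1 : t ≤ 1 := min_le_left _ _
  have htε : 2 * B * (K * t) ≤ ε := by
    have h1 : t * (2 * B * K + 1) ≤ ε := by
      rw [← le_div_iff₀ (by positivity)]; exact min_le_right _ _
    nlinarith
  refine ⟨t, ht0, fun s₁ s₂ z h₁ h₂ hz => ?_⟩
  have a₁ := hu.mul hU ht0.le h₁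
  have a₂ := (h₁.mono ht1).mul zero_le_one ht0.le h₁
  have a₃ := (h₂.mono ht1).mul zero_le_one ht0.le h₂
  have a₄ := (hz.sub ((((a₁.const_mul 2).add a₂).add a₃).const_mul (1 / 2))).const_mul (γ - 1)
  have a₅ := hu.mul hU ht0.le h₂
  have a₆ := (h₁.mono ht1).mul zero_le_one ht0.le h₂
  have hγ' : |γ - 1| = γ - 1 := abs_of_pos (by linarith)
  have fin : ∀ {m : ℝ} {q : ℝ × ℝ → ℝ}, LipBdd L m q → m ≤ K * t →
      LipBdd L ε (fun x => T x * q x) := fun hq hm =>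
    (hT.mul hB (by positivity) (hq.mono hm)).mono htε
  have hg : 0 ≤ (γ - 1) * t := mul_nonneg (by linarith) ht0.le
  have hUt : 0 ≤ U * t := by positivity
  have hUg : 0 ≤ U * ((γ - 1) * t) := by positivity
  refine ⟨?_, ?_, ?_⟩
  · convert fin ((a₄.sub (a₁.const_mul 2)).sub a₂) ?_ using 3
    · ring
    · rw [hγ', abs_of_pos (by norm_num : (0 : ℝ) < 2), abs_of_pos (by norm_num : (0 : ℝ) < 1 / 2),
        hK]
      nlinarith
  · convert fin ((a₅.add a₆).const_mul (-1)) ?_ using 3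
    · ring
    · rw [abs_neg, abs_one, hK]
      nlinarith
  · convert fin (a₄.sub a₃) ?_ using 3
    · ring
    · rw [hγ', abs_of_pos (by norm_num : (0 : ℝ) < 2), abs_of_pos (by norm_num : (0 : ℝ) < 1 / 2),
        hK]
      nlinarith

/-- Lipschitz representatives of the perturbations of velocity and potential. -/
theorem exists_lipBdd_representatives (hL : 0 < L) {t : ℝ} (ht : 0 < t) :
    ∃ δ, 0 < δ ∧ ∀ r₂ r₃ : ℝ, max r₂ r₃ ≤ 2 * δ → ∀ φ ψ Ψ : ℝ × ℝ → ℝ, φ ∈ IterV L r₂ →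
      (ψ, Ψ) ∈ IterP L r₃ → ∃ s₁ s₂ z : ℝ × ℝ → ℝ, LipBdd L t s₁ ∧ LipBdd L t s₂ ∧ LipBdd L t z ∧
        (∀ x ∈ Ioo 0 L, ∀ y ∈ ({-1, 1} : Set ℝ), s₂ (x, y) = 0) ∧
        ∀ᵐ x ∂(volume.restrict (Om L)), wpd L 1 0 ψ x + wpd L 0 1 φ x = s₁ x ∧
          wpd L 0 1 ψ x - wpd L 1 0 φ x = s₂ x ∧ Ψ x = z x := by
  set K := 2 * ((4 / L + 2) * L2norm L (fun _ => 1)) with hK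
  have hK0 : 0 ≤ K := by have := L2norm_nonneg L (fun _ => 1); positivity
  -- Makes each individual derivative bounded and Lipschitz with constant t/2, since a velocity
  -- component is a sum or difference of two of them.
  refine ⟨t / (4 * K + 1), by positivity, fun r₂ r₃ hr φ ψ Ψ hφ hP => ?_⟩
  obtain ⟨hφm, hφr, hφ0, -, -⟩ := hφ
  obtain ⟨hψm, hΨm, hr₃, hψ1, -, -, -⟩ := hP
  simp only at hψm hΨm hr₃ hψ1
  have n1 := Hnorm_nonneg L 4 ψ
  have n2 := Hnorm_nonneg L 4 Ψ
  have small : ∀ m : ℝ, m ≤ max r₂ r₃ →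
      2 * ((4 / L + 2) * (L2norm L (fun _ => 1) * m)) ≤ t / 2 := by
    intro m hm
    have h1 : K * m ≤ K * (2 * (t / (4 * K + 1))) := by gcongr; exact hm.trans hr
    have h2 : K * (2 * (t / (4 * K + 1))) ≤ t / 2 := by
      rw [mul_div_assoc', mul_div_assoc', div_le_div_iff₀ (by positivity) (by norm_num)]
      nlinarith
    calc 2 * ((4 / L + 2) * (L2norm L (fun _ => 1) * m)) = K * m := by rw [hK]; ring
      _ ≤ t / 2 := h1.trans h2
  have s2 := small _ (hφr.trans (le_max_left _ _))
  have s3 := small (Hnorm L 4 ψ) (le_trans (by linarith) (le_max_right r₂ r₃))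
  have s4 := small (Hnorm L 4 Ψ) (le_trans (by linarith) (le_max_right r₂ r₃))
  obtain ⟨ψ₁, l1, e1⟩ := hψm.exists_lipBdd hL (a := 1) (b := 0) (by norm_num)
  obtain ⟨ψ₂, l2, e2⟩ := hψm.exists_lipBdd hL (a := 0) (b := 1) (by norm_num)
  obtain ⟨φ₁, l3, e3⟩ := hφm.exists_lipBdd hL (a := 1) (b := 0) (by norm_num)
  obtain ⟨φ₂, l4, e4⟩ := hφm.exists_lipBdd hL (a := 0) (b := 1) (by norm_num)
  obtain ⟨z, l5, e5⟩ := hΨm.exists_lipBdd hL (a := 0) (b := 0) (by norm_num)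
  refine ⟨fun x => ψ₁ x + φ₂ x, fun x => ψ₂ x - φ₁ x, z, (l1.add l4).mono (by linarith),
    (l2.sub l3).mono (by linarith), l5.mono (by linarith), fun x hx y hy => ?_, ?_⟩
  · simp only [trace_snd_eq_zero hL hψm hψ1 l2 e2 x hx y hy,
      trace_fst_eq_zero hL hφm hφ0 l3 e3 x hx y hy, sub_zero]
  · filter_upwards [e1, e2, e3, e4, e5, wpd_zero_ae_eq hΨm] with x h1 h2 h3 h4 h5 h6
    exact ⟨by rw [h1, h4], by rw [h2, h3], by rw [← h5, h6]⟩

end LipBdd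

/-! ### The energy multiplier -/

/-- A multiplier `T` for the mixed-type operator along a background flow, with `ud` the derivative
of `u`. With `c² = γ S₀ ρ̄^{γ-1}` the squared sound speed, `P = T (c² - u²)` and `G = T c²` are the
leading coefficients after multiplication by `T`. -/
structure IsMultiplier (γ J S₀ L β μ k B₀ B₁ : ℝ) (u E ud P P' G T T' : ℝ → ℝ) : Prop where
  hasDeriv_P : ∀ x ∈ Icc 0 L, HasDerivWithinAt P (P' x) (Icc 0 L) x
  continuousOn_P' : ContinuousOn P' (Icc 0 L)
  hasDeriv_G : ∀ x ∈ Icc 0 L, HasDerivWithinAt G (-μ) (Icc 0 L) x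
  hasDeriv_T : ∀ x ∈ Icc 0 L, HasDerivWithinAt T (T' x) (Icc 0 L) x
  continuousOn_T' : ContinuousOn T' (Icc 0 L)
  one_le_G : ∀ x ∈ Icc 0 L, 1 ≤ G x
  G_le_two : ∀ x ∈ Icc 0 L, G x ≤ 2
  P_eq : ∀ x ∈ Icc 0 L, P x = T x * (γ * S₀ * (J / u x) ^ (γ - 1) - u x ^ 2)
  G_eq : ∀ x ∈ Icc 0 L, G x = T x * (γ * S₀ * (J / u x) ^ (γ - 1))
  le_P : β ≤ P 0
  P_le : P L ≤ -β
  le_G : β ≤ G L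
  coercive : ∀ x ∈ Icc 0 L, k ≤ P' x / 2 - T x * (E x - (γ + 1) * ud x * u x)
  bound_b₀ : ∀ x ∈ Icc 0 L, |T x * ((γ - 1) * ud x)| ≤ B₀
  bound_b₁ : ∀ x ∈ Icc 0 L, |T x * u x| ≤ B₁

/-- Since c² = S/u^(γ-1) with S = u_s^(γ+1), prescribing G = 1 + μ(L - x) dictates T = G·u^(γ-1)/S
and P = G(1 - u^(γ+1)/S). The constants other than β depend only on the velocity window and the
acceleration bounds, not on L or the particular flow, so L can later be taken small against them. -/
theorem IsBackground.exists_multiplier {γ ζ₀ J S₀ E₀ ℓ L κ Λ b : ℝ} {u E : ℝ → ℝ}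
    (h : IsBackground γ ζ₀ J S₀ E₀ ℓ u E) (hγ : 1 < γ) (hJ : 0 < J) (hS₀ : 0 < S₀)
    (hL : 0 < L) (hLℓ : L < ℓ) (hu0 : u 0 < us γ J S₀) (huL : us γ J S₀ < u L) (hub : u L ≤ b)
    (hκ : 0 < κ) (hκΛ : ∀ x ∈ Icc 0 L,
      κ ≤ derivWithin u (Ico 0 ℓ) x ∧ derivWithin u (Ico 0 ℓ) x ≤ Λ)
    (hLb : L ≤ b / κ) :
    ∃ β : ℝ, 0 < β ∧ ∃ P P' G T T' : ℝ → ℝ, IsMultiplier γ J S₀ L β (κ / b) (κ / (2 * b))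
      (2 * ((γ - 1) * Λ * b ^ (γ - 1) / us γ J S₀ ^ (γ + 1)))
      (2 * (b ^ γ / us γ J S₀ ^ (γ + 1))) u E (derivWithin u (Ico 0 ℓ)) P P' G T T' := by
  have hs : 0 < us γ J S₀ := us_pos hγ hJ hS₀
  set s := us γ J S₀ with hs_def
  set S := s ^ (γ + 1) with hS
  have hSpos : 0 < S := Real.rpow_pos_of_pos hs _
  set ud := derivWithin u (Ico 0 ℓ) with hud
  have hb : 0 < b := by linarith
  -- Small enough that the loss -μ/2 in the coercivity is half of the gain u'/u ≥ κ/b. Together with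
  -- L ≤ b/κ it also keeps `G` at most 2.
  set μ := κ / b with hμ
  have hμ0 : 0 < μ := by positivity
  have hsub : Icc 0 L ⊆ Ico 0 ℓ := fun x hx => ⟨hx.1, hx.2.trans_lt hLℓ⟩
  have hpos : ∀ x ∈ Icc 0 L, 0 < u x := fun x hx => h.pos x (hsub hx)
  have hle : ∀ x ∈ Icc 0 L, u x ≤ b := fun x hx =>
    (h.strictMonoOn_u.monotoneOn (hsub hx) (hsub ⟨hL.le, le_rfl⟩) hx.2).trans hub
  have hdu : ∀ x ∈ Icc 0 L, HasDerivWithinAt u (ud x) (Icc 0 L) x := fun x hx =>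
    (h.hasDerivWithinAt_u (hsub hx)).mono hsub
  have hudc : ContinuousOn ud (Icc 0 L) := h.continuousOn_derivWithin.mono hsub
  have huc : ContinuousOn u (Icc 0 L) := fun x hx => (hdu x hx).continuousWithinAt
  have hrc : ∀ p : ℝ, ContinuousOn (fun x => u x ^ p) (Icc 0 L) := fun p =>
    huc.rpow_const fun x hx => Or.inl (hpos x hx).ne'
  have hdr : ∀ p : ℝ, ∀ x ∈ Icc 0 L,
      HasDerivWithinAt (fun x => u x ^ p) (ud x * p * u x ^ (p - 1)) (Icc 0 L) x := fun p x hx =>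
    (hdu x hx).rpow_const (Or.inl (hpos x hx).ne')
  set G : ℝ → ℝ := fun x => 1 + μ * (L - x) with hG
  have hGd : ∀ x ∈ Icc 0 L, HasDerivWithinAt G (-μ) (Icc 0 L) x := fun x _ => by
    exact ((((hasDerivAt_id x).const_sub L).const_mul μ).const_add 1).hasDerivWithinAt.congr_deriv
      (by simp)
  have hGc : ContinuousOn G (Icc 0 L) := fun x hx => (hGd x hx).continuousWithinAt
  have hG1 : ∀ x ∈ Icc 0 L, 1 ≤ G x := fun x hx => by
    have : 0 ≤ μ * (L - x) := mul_nonneg hμ0.le (by linarith [hx.2])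
    simp only [hG]; linarith
  have hG2 : ∀ x ∈ Icc 0 L, G x ≤ 2 := fun x hx => by
    have h1 : μ * (L - x) ≤ μ * (b / κ) := by gcongr; linarith [hx.1]
    have h2 : μ * (b / κ) = 1 := by rw [hμ]; field_simp
    simp only [hG]; linarith
  have hSeq : S = γ * S₀ * J ^ (γ - 1) := us_rpow hγ hJ hS₀
  have e1 : ∀ x ∈ Icc 0 L, u x ^ (γ + 1) = u x ^ γ * u x := fun x hx => by
    rw [Real.rpow_add (hpos x hx), Real.rpow_one]
  have e2 : ∀ x ∈ Icc 0 L, u x ^ (γ - 1) = u x ^ γ / u x := fun x hx => by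
    rw [Real.rpow_sub (hpos x hx), Real.rpow_one]
  have e3 : ∀ x ∈ Icc 0 L, γ * S₀ * (J / u x) ^ (γ - 1) = S / u x ^ (γ - 1) := fun x hx => by
    rw [Real.div_rpow hJ.le (hpos x hx).le, hSeq]; ring
  have epos : ∀ x ∈ Icc 0 L, ∀ p : ℝ, 0 < u x ^ p := fun x hx p =>
    Real.rpow_pos_of_pos (hpos x hx) p
  have h0 : (0 : ℝ) ∈ Icc 0 L := ⟨le_rfl, hL.le⟩
  have h1 : L ∈ Icc 0 L := ⟨hL.le, le_rfl⟩
  set P : ℝ → ℝ := fun x => G x * (1 - u x ^ (γ + 1) / S) with hP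
  have hP0 : 0 < P 0 := by
    refine mul_pos (by linarith [hG1 0 h0]) (sub_pos.2 ?_)
    rw [div_lt_one hSpos]
    exact Real.rpow_lt_rpow (hpos 0 h0).le hu0 (by linarith)
  have hPL : 0 < -P L := by
    rw [neg_pos]
    refine mul_neg_of_pos_of_neg (by linarith [hG1 L h1]) (sub_neg.2 ?_)
    rw [one_lt_div hSpos]
    exact Real.rpow_lt_rpow hs.le huL (by linarith)
  refine ⟨min (P 0) (min (-P L) 1), by positivity, P,
    fun x => -μ * (1 - u x ^ (γ + 1) / S) + G x * (-(ud x * (γ + 1) * u x ^ (γ + 1 - 1) / S)), G,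
    fun x => G x * u x ^ (γ - 1) / S,
    fun x => (-μ * u x ^ (γ - 1) + G x * (ud x * (γ - 1) * u x ^ (γ - 1 - 1))) / S, ?_⟩
  refine ⟨fun x hx => ?_, ?_, hGd, fun x hx => ?_, ?_, hG1, hG2, fun x hx => ?_,
    fun x hx => ?_, min_le_left _ _, ?_, ?_, fun x hx => ?_, fun x hx => ?_, fun x hx => ?_⟩
  · exact (hGd x hx).fun_mul (((hdr (γ + 1) x hx).div_const S).const_sub 1)
  · exact (continuousOn_const.mul (continuousOn_const.sub ((hrc _).div_const S))).add
      (hGc.mul (((hudc.mul continuousOn_const).mul (hrc _)).div_const S).neg)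
  · exact ((hGd x hx).fun_mul (hdr (γ - 1) x hx)).div_const S
  · exact ((continuousOn_const.mul (hrc _)).add
      (hGc.mul ((hudc.mul continuousOn_const).mul (hrc _)))).div_const S
  · have := hpos x hx
    have := epos x hx γ
    rw [e3 x hx]
    simp only [hP]
    rw [e1 x hx, e2 x hx]
    field_simp
  · have := epos x hx (γ - 1)
    rw [e3 x hx]
    field_simp
  · have := (min_le_right (P 0) (min (-P L) 1)).trans (min_le_left _ _)
    linarith
  · have := (min_le_right (P 0) (min (-P L) 1)).trans (min_le_right _ _)
    linarith [hG1 L h1]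
  · have hux := hpos x hx
    have hug := epos x hx γ
    have hode := h.ode_u x (hsub hx)
    have hE : E x = ud x * (u x ^ γ * u x - S) / u x ^ γ := by
      rw [eq_div_iff hug.ne', ← hode, e1 x hx]
    -- After E is eliminated by the differential equation, every term except -μ/2 is nonnegative.
    have hK : (-μ * (1 - u x ^ (γ + 1) / S) +
        G x * (-(ud x * (γ + 1) * u x ^ (γ + 1 - 1) / S))) / 2 -
        G x * u x ^ (γ - 1) / S * (E x - (γ + 1) * ud x * u x) =
        -μ / 2 + μ / 2 * (u x ^ γ * u x / S) +
          G x * ud x * ((γ - 1) / 2 * u x ^ γ / S) + G x * (ud x / u x) := by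
      rw [hE, e1 x hx, e2 x hx, add_sub_cancel_right]
      field_simp
      ring
    rw [hK]
    have i1 : κ / b ≤ ud x / u x := by
      have h2 := (hκΛ x hx).1
      have : 0 ≤ ud x := hκ.le.trans h2
      have := hle x hx
      gcongr
    have i2 : κ / b ≤ G x * (ud x / u x) := by
      have := hG1 x hx
      have : 0 ≤ ud x / u x := le_trans (by positivity) i1
      nlinarith
    have i3 : 0 ≤ μ / 2 * (u x ^ γ * u x / S) := by positivity
    have i4 : 0 ≤ G x * ud x * ((γ - 1) / 2 * u x ^ γ / S) := by
      have := hG1 x hx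
      have : 0 ≤ ud x := hκ.le.trans (hκΛ x hx).1
      have : 0 < γ - 1 := by linarith
      positivity
    have i5 : κ / (2 * b) = κ / b / 2 := by rw [mul_comm, div_div]
    rw [i5]
    have : μ = κ / b := hμ
    linarith
  · have g1 := hG1 x hx
    have hud0 : 0 < ud x := hκ.trans_le (hκΛ x hx).1
    have g2 : 0 < γ - 1 := by linarith
    have g3 := epos x hx (γ - 1)
    have g4 := (hκΛ x hx).2
    have g5 := Real.rpow_le_rpow (hpos x hx).le (hle x hx) g2.le
    have g6 : 0 ≤ Λ := hud0.le.trans g4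
    rw [abs_of_pos (by positivity)]
    calc G x * u x ^ (γ - 1) / S * ((γ - 1) * ud x) ≤ 2 * b ^ (γ - 1) / S * ((γ - 1) * Λ) := by
          gcongr; exact hG2 x hx
      _ = _ := by ring
  · have g1 := hG1 x hx
    have g3 := epos x hx γ
    have hux := hpos x hx
    have g5 := Real.rpow_le_rpow hux.le (hle x hx) (by linarith : 0 ≤ γ)
    have : G x * u x ^ (γ - 1) / S * u x = G x * u x ^ γ / S := by rw [e2 x hx]; field_simp
    rw [this, abs_of_pos (by positivity)]
    calc G x * u x ^ γ / S ≤ 2 * b ^ γ / S := by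
          gcongr; exact hG2 x hx
      _ = _ := by ring

/-! ### The a priori estimate -/

theorem memLp_mul_of_bounded {L M : ℝ} {q f : ℝ × ℝ → ℝ} (hq : ContinuousOn q (OmBar L))
    (hM : ∀ x ∈ OmBar L, |q x| ≤ M) (hf : MemLp f 2 (volume.restrict (Om L))) :
    MemLp (fun x => q x * f x) 2 (volume.restrict (Om L)) := by
  refine MemLp.of_le_mul (c := M) hf (((hq.mono (Om_subset_OmBar L)).aestronglyMeasurable
    (measurableSet_Om L)).mul hf.1) ?_
  filter_upwards [ae_restrict_mem (measurableSet_Om L)] with x hx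
  rw [norm_mul]
  exact mul_le_mul_of_nonneg_right (hM x (Om_subset_OmBar L hx)) (norm_nonneg _)

theorem L2norm_mul_le_of_bounded {L M : ℝ} {q f : ℝ × ℝ → ℝ} (hq : ContinuousOn q (OmBar L))
    (hM0 : 0 ≤ M) (hM : ∀ x ∈ OmBar L, |q x| ≤ M) (hf : MemLp f 2 (volume.restrict (Om L))) :
    L2norm L (fun x => q x * f x) ≤ M * L2norm L f := by
  unfold L2norm
  rw [← Real.sqrt_sq hM0, ← Real.sqrt_mul (sq_nonneg M), ← integral_const_mul]
  refine Real.sqrt_le_sqrt (setIntegral_mono_on (memLp_mul_of_bounded hq hM hf).integrable_sq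
    (hf.integrable_sq.const_mul _) (measurableSet_Om L) fun x hx => ?_)
  have := hM x (Om_subset_OmBar L hx)
  rw [mul_pow, ← sq_abs (q x)]
  gcongr

/-- The coefficients see the flow only through its values on [0, L]: Φ̄ integrates E from the
entrance, and the derivative of u is evaluated at interior points. -/
theorem IsSolution.congr_background {γ J S₀ L : ℝ} {u E u' E' : ℝ → ℝ}
    {φ ψ Ψ f₁ f₂ v w : ℝ × ℝ → ℝ} (h : IsSolution γ J S₀ L u E φ ψ Ψ f₁ f₂ v w) (hL : 0 < L)
    (hu : ∀ x ∈ Icc 0 L, u x = u' x ∧ E x = E' x) :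
    IsSolution γ J S₀ L u' E' φ ψ Ψ f₁ f₂ v w := by
  have hΦ : ∀ x ∈ Ioo 0 L, PhiBar γ J S₀ u E x = PhiBar γ J S₀ u' E' x := by
    intro x hx
    have : ∫ t in (0 : ℝ)..x, E t = ∫ t in (0 : ℝ)..x, E' t := by
      refine intervalIntegral.integral_congr fun t ht => ?_
      rw [uIcc_of_le hx.1.le] at ht
      exact (hu t ⟨ht.1, ht.2.trans hx.2.le⟩).2
    rw [PhiBar, PhiBar, this, (hu 0 ⟨le_rfl, hL.le⟩).1]
  have hd : ∀ x ∈ Ioo 0 L, deriv u x = deriv u' x := fun x hx => by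
    refine Filter.EventuallyEq.deriv_eq ?_
    filter_upwards [Icc_mem_nhds hx.1 hx.2] with t ht using (hu t ht).1
  refine ⟨h.reg_v, h.reg_w, ?_, ?_, h.entrance, h.wall, h.exit⟩
  · filter_upwards [h.eq₁, ae_restrict_mem (measurableSet_Om L)] with x hx hxm
    have h1 := hu x.1 (Ioo_subset_Icc_self hxm.1)
    rw [← hx]
    simp only [opL1, AP, A, hΦ x.1 hxm.1, hd x.1 hxm.1, h1.1, h1.2]
  · filter_upwards [h.eq₂, ae_restrict_mem (measurableSet_Om L)] with x hx hxm
    have h1 := hu x.1 (Ioo_subset_Icc_self hxm.1)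
    rw [← hx]
    simp only [opL2, c0, c1, h1.1]

/-- The equation multiplied by `T`, with the coefficients split into the background part and
the perturbation. -/
theorem multiplied_equation {γ J S₀ L : ℝ} {u E : ℝ → ℝ} {φ ψ Ψ v w : ℝ × ℝ → ℝ} {x : ℝ × ℝ}
    {s₁ s₂ z T g f ud : ℝ} (hγ : 1 < γ)
    (hΦ : PhiBar γ J S₀ u E x.1 = u x.1 ^ 2 / 2 + γ * S₀ / (γ - 1) * (J / u x.1) ^ (γ - 1))
    (hs₁ : wpd L 1 0 ψ x + wpd L 0 1 φ x = s₁) (hs₂ : wpd L 0 1 ψ x - wpd L 1 0 φ x = s₂)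
    (hz : Ψ x = z) (hud : deriv u x.1 = ud)
    (hcomm : pd L 0 (pd L 1 v) x = pd L 1 (pd L 0 v) x)
    (hg : g = T * (γ * S₀ * (J / u x.1) ^ (γ - 1)) +
      T * ((γ - 1) * (z - (2 * u x.1 * s₁ + s₁ ^ 2 + s₂ ^ 2) / 2) - s₂ ^ 2))
    (hg0 : g ≠ 0) (hf : opL1 γ J S₀ L u E φ ψ Ψ v w x = f) :
    (T * (γ * S₀ * (J / u x.1) ^ (γ - 1) - u x.1 ^ 2) +
        T * ((γ - 1) * (z - (2 * u x.1 * s₁ + s₁ ^ 2 + s₂ ^ 2) / 2) - 2 * u x.1 * s₁ - s₁ ^ 2)) *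
          pd L 0 (pd L 0 v) x +
      2 * (T * (-(u x.1 + s₁) * s₂)) * pd L 1 (pd L 0 v) x + g * pd L 1 (pd L 1 v) x +
      T * (E x.1 - (γ + 1) * ud * u x.1) * pd L 0 v x + T * u x.1 * pd L 0 w x +
      T * ((γ - 1) * ud) * w x = g * f := by
  have hγ1 : γ - 1 ≠ 0 := by linarith
  set c := γ * S₀ * (J / u x.1) ^ (γ - 1) with hc
  have hΦ' : (γ - 1) * PhiBar γ J S₀ u E x.1 = (γ - 1) * (u x.1 ^ 2 / 2) + c := by
    rw [hΦ, hc]; field_simp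
  have hq : wpd L 0 1 ψ x + -wpd L 1 0 φ x = s₂ := by rw [← hs₂]; ring
  have hV : u x.1 + wpd L 1 0 ψ x + wpd L 0 1 φ x = u x.1 + s₁ := by rw [← hs₁]; ring
  have A00 : AP γ J S₀ L u E φ ψ Ψ 0 0 x = c - u x.1 ^ 2 +
      ((γ - 1) * (z - (2 * u x.1 * s₁ + s₁ ^ 2 + s₂ ^ 2) / 2) - 2 * u x.1 * s₁ - s₁ ^ 2) := by
    simp only [AP, A, Fin.sum_univ_two, Pi.add_apply, Matrix.cons_val_zero, Matrix.cons_val_one,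
      zero_add, if_true, hV, hq, hz]
    linear_combination hΦ'
  have A11 : AP γ J S₀ L u E φ ψ Ψ 1 1 x = c +
      ((γ - 1) * (z - (2 * u x.1 * s₁ + s₁ ^ 2 + s₂ ^ 2) / 2) - s₂ ^ 2) := by
    simp only [AP, A, Fin.sum_univ_two, Pi.add_apply, Matrix.cons_val_zero, Matrix.cons_val_one,
      zero_add, if_true, hV, hq, hz]
    linear_combination hΦ'
  have A01 : AP γ J S₀ L u E φ ψ Ψ 0 1 x = -(u x.1 + s₁) * s₂ := by
    simp only [AP, A, Fin.sum_univ_two, Pi.add_apply, Matrix.cons_val_zero, Matrix.cons_val_one,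
      zero_add, hV, hq, hz, zero_ne_one, if_false]
    ring
  have A10 : AP γ J S₀ L u E φ ψ Ψ 1 0 x = -(u x.1 + s₁) * s₂ := by
    simp only [AP, A, Fin.sum_univ_two, Pi.add_apply, Matrix.cons_val_zero, Matrix.cons_val_one,
      zero_add, hV, hq, hz, one_ne_zero, if_false]
    ring
  -- Multiplying by g = T·A₂₂ clears the normalisation by A₂₂ and applies the multiplier at once; g
  -- ≠ 0 supplies A₂₂ ≠ 0.
  have hgA : g = T * AP γ J S₀ L u E φ ψ Ψ 1 1 x := by rw [hg, A11]; ring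
  have hA : AP γ J S₀ L u E φ ψ Ψ 1 1 x ≠ 0 := right_ne_zero_of_mul (hgA ▸ hg0)
  rw [← hf, hgA]
  simp only [opL1, Fin.sum_univ_two, hud, hcomm]
  rw [A00, A01, A10]
  field_simp
  ring

/-- Combines the two energy estimates for a fixed flow. The tolerance δ is chosen from the
multiplier and Lipschitz bounds of the flow, so it is uniform in the perturbation and the data. -/
theorem IsBackground.a_priori_estimate {γ ζ₀ J S₀ E₀ ℓ L β μ k B₀ B₁ B₃ : ℝ}
    {u E P P' G T T' : ℝ → ℝ} (h : IsBackground γ ζ₀ J S₀ E₀ ℓ u E) (hγ : 1 < γ)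
    (hJ : 0 < J) (hS₀ : 0 < S₀) (hL : 0 < L) (hLℓ : L < ℓ)
    (m : IsMultiplier γ J S₀ L β μ k B₀ B₁ u E (derivWithin u (Ico 0 ℓ)) P P' G T T')
    (hβ : 0 < β) (hμ : 0 < μ) (hk : 0 < k) (hB₀ : 0 ≤ B₀) (hB₁ : 0 ≤ B₁) (hB₃ : 0 ≤ B₃)
    (hc₁ : ∀ x ∈ Icc 0 L, u x / (γ * S₀ * (J / u x) ^ (γ - 2)) ≤ B₃)
    (hsmall : (B₁ + B₀ * (2 * L)) * (2 * L) * B₃ ≤ k / 4) :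
    ∃ δ C : ℝ, 0 < δ ∧ 0 < C ∧ ∀ r₂ r₃ : ℝ, max r₂ r₃ ≤ 2 * δ → ∀ φ ψ Ψ : ℝ × ℝ → ℝ,
      φ ∈ IterV L r₂ → (ψ, Ψ) ∈ IterP L r₃ → ∀ f₁ f₂ v w : ℝ × ℝ → ℝ,
      MemLp f₁ 2 (volume.restrict (Om L)) → MemLp f₂ 2 (volume.restrict (Om L)) →
      IsSolution γ J S₀ L u E φ ψ Ψ f₁ f₂ v w →
      L2line 0 (pd L 0 v) + (L2line L (pd L 0 v) + L2line L (pd L 1 v)) +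
        Hnorm L 1 v + Hnorm L 1 w ≤ C * (L2norm L f₁ + L2norm L f₂) := by
  set ud := derivWithin u (Ico 0 ℓ) with hud
  have hsub : Icc 0 L ⊆ Ico 0 ℓ := fun x hx => ⟨hx.1, hx.2.trans_lt hLℓ⟩
  have hpos : ∀ x ∈ Icc 0 L, 0 < u x := fun x hx => h.pos x (hsub hx)
  have hdu : ∀ x ∈ Icc 0 L, HasDerivWithinAt u (ud x) (Icc 0 L) x := fun x hx =>
    (h.hasDerivWithinAt_u (hsub hx)).mono hsub
  have hudc : ContinuousOn ud (Icc 0 L) := h.continuousOn_derivWithin.mono hsub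
  have huc : ContinuousOn u (Icc 0 L) := fun x hx => (hdu x hx).continuousWithinAt
  have hEc : ContinuousOn E (Icc 0 L) := h.smooth_E.continuousOn.mono hsub
  have hTc : ContinuousOn T (Icc 0 L) := fun x hx => (m.hasDeriv_T x hx).continuousWithinAt
  have hGc : ContinuousOn G (Icc 0 L) := fun x hx => (m.hasDeriv_G x hx).continuousWithinAt
  have lift : ∀ {Q : ℝ → ℝ}, ContinuousOn Q (Icc 0 L) →
      ContinuousOn (fun z : ℝ × ℝ => Q z.1) (OmBar L) := fun hQ =>
    hQ.comp continuousOn_fst fun z hz => hz.1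
  have hρ : ∀ x ∈ Icc 0 L, 0 < γ * S₀ * (J / u x) ^ (γ - 2) := fun x hx => by
    have := Real.rpow_pos_of_pos (div_pos hJ (hpos x hx)) (γ - 2)
    positivity
  have hρc : ContinuousOn (fun x => γ * S₀ * (J / u x) ^ (γ - 2)) (Icc 0 L) :=
    continuousOn_const.mul ((continuousOn_const.div huc fun x hx => (hpos x hx).ne').rpow_const
      fun x hx => Or.inl (div_pos hJ (hpos x hx)).ne')
  obtain ⟨U, hU, lu⟩ := exists_lipBdd_fst hdu hudc
  obtain ⟨B, hB, lT⟩ := exists_lipBdd_fst m.hasDeriv_T m.continuousOn_T'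
  -- β, μ and k let the perturbation terms be absorbed; the entry 1 keeps the perturbed `G` positive
  -- and at most 3.
  set ε := min (min β μ) (min k 1) / 8 with hε
  have hε0 : 0 < ε := by positivity
  have hεβ : 8 * ε ≤ β := by
    have := (min_le_left (min β μ) (min k 1)).trans (min_le_left _ _)
    linarith
  have hεμ : 8 * ε ≤ μ := by
    have := (min_le_left (min β μ) (min k 1)).trans (min_le_right _ _)
    linarith
  have hεk : 8 * ε ≤ k := by
    have := (min_le_right (min β μ) (min k 1)).trans (min_le_left _ _)
    linarith
  have hε1 : 8 * ε ≤ 1 := by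
    have := (min_le_right (min β μ) (min k 1)).trans (min_le_right _ _)
    linarith
  obtain ⟨t, ht, hpert⟩ := exists_small_perturbation hε0 hU hB hγ lu lT
  obtain ⟨δ, hδ, hrep⟩ := exists_lipBdd_representatives hL ht
  set D := B₁ + B₀ * (2 * L) with hD
  have hD0 : 0 ≤ D := by positivity
  set K := (9 / √(β * k) + 3 / √(μ * k) + 2 / k) * (1 + D * (2 * L)) +
    2 * (2 * L) * (B₃ * (2 / k * (1 + D * (2 * L))) + 1) with hK
  have hK0 : 0 < K := by positivity
  refine ⟨δ, (1 + 2 * L) * (K * 3), hδ, by positivity, ?_⟩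
  intro r₂ r₃ hr φ ψ Ψ hφ hP f₁ f₂ v w hf₁ hf₂ hs
  obtain ⟨s₁, s₂, z, l₁, l₂, lz, hw2, hae⟩ := hrep r₂ r₃ hr φ ψ Ψ hφ hP
  obtain ⟨l₁₁, l₁₂, l₂₂⟩ := hpert s₁ s₂ z l₁ l₂ lz
  have hv := hs.reg_v
  have hw := hs.reg_w
  have hv1 : ContDiffOn ℝ 1 v (OmBar L) := hv.of_le (by norm_num)
  have hw1 : ContDiffOn ℝ 1 w (OmBar L) := hw.of_le (by norm_num)
  set p₂₂ : ℝ × ℝ → ℝ := fun x => T x.1 * ((γ - 1) *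
    (z x - (2 * u x.1 * s₁ x + s₁ x ^ 2 + s₂ x ^ 2) / 2) - s₂ x ^ 2) with hp₂₂
  have hq : ContinuousOn (fun x : ℝ × ℝ => G x.1 + p₂₂ x) (OmBar L) :=
    (lift hGc).add l₂₂.continuousOn
  have hq3 : ∀ x ∈ OmBar L, |G x.1 + p₂₂ x| ≤ 3 := fun x hx => by
    have h1 := m.one_le_G x.1 hx.1
    have h2 := m.G_le_two x.1 hx.1
    have h3 := abs_le.1 (l₂₂.1 x hx)
    rw [abs_le]
    constructor <;> linarith
  have hq0 : ∀ x ∈ OmBar L, G x.1 + p₂₂ x ≠ 0 := fun x hx => by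
    have h1 := m.one_le_G x.1 hx.1
    have h3 := abs_le.1 (l₂₂.1 x hx)
    have : 0 < G x.1 + p₂₂ x := by linarith
    exact this.ne'
  have hF := memLp_mul_of_bounded hq hq3 hf₁
  have hF3 := L2norm_mul_le_of_bounded hq (by norm_num) hq3 hf₁
  have hmixed := mixed_energy_estimate hL hε0.le m.hasDeriv_P m.continuousOn_P' m.hasDeriv_G
    m.le_P m.P_le m.le_G
    (a := fun x => T x.1 * (E x.1 - (γ + 1) * ud x.1 * u x.1))
    (b₀ := fun x => T x.1 * ((γ - 1) * ud x.1)) (b₁ := fun x => T x.1 * u x.1)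
    (lift (hTc.mul (hEc.sub ((continuousOn_const.mul hudc).mul huc))))
    (lift (hTc.mul (continuousOn_const.mul hudc))) (lift (hTc.mul huc))
    (fun x hx => m.coercive x.1 (Ioo_subset_Icc_self hx.1)) (fun x hx => m.bound_b₀ x.1 hx.1)
    (fun x hx => m.bound_b₁ x.1 hx.1) l₁₁ l₁₂ l₂₂
    (fun x hx y hy => by simp only [hw2 x hx y hy, mul_zero]) hF hv hw (by
      filter_upwards [hae, hs.eq₁, ae_restrict_mem (measurableSet_Om L)] with x ⟨e1, e2, e3⟩ he hxm
      have hx1 := Ioo_subset_Icc_self hxm.1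
      rw [m.P_eq x.1 hx1]
      refine multiplied_equation hγ (h.PhiBar_eq hγ hJ hS₀ (hsub hx1)) e1 e2 e3
        (h.hasDerivAt_u ⟨hxm.1.1, hxm.1.2.trans hLℓ⟩).deriv (pd_comm hL hv hxm 0 1) ?_
        (hq0 x (Om_subset_OmBar L hxm)) he
      rw [m.G_eq x.1 hx1]) (fun y hy => (hs.entrance y hy).1) (fun x hx y hy => (hs.wall x hx y hy).1)
  have hell := elliptic_energy_estimate hL (c₀ := c0 γ J S₀ u) (c₁ := c1 γ J S₀ u) (B := B₃)
    (lift (continuousOn_const.div hρc fun x hx => (hρ x hx).ne'))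
    (lift (huc.neg.div hρc fun x hx => (hρ x hx).ne'))
    (fun x hx => one_div_nonneg.2 (hρ x.1 hx.1).le)
    (fun x hx => by
      have := hρ x.1 hx.1
      have := hpos x.1 hx.1
      rw [c1, neg_div, abs_neg, abs_of_pos (by positivity)]
      exact hc₁ x.1 hx.1)
    hf₂ (continuousOn_pd hL hv1 0) hw (by
      filter_upwards [hs.eq₂] with x he
      rw [← he, opL2, Fin.sum_univ_two]) (fun y hy => (hs.entrance y hy).2)
    (fun x hx y hy => (hs.wall x hx y hy).2) hs.exit
  have pv := L2norm_le_of_entrance hL hv1 fun y hy => (hs.entrance y hy).1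
  have pw := L2norm_le_of_exit hL hw1 hs.exit
  have hX := L2norm_nonneg L (pd L 0 v)
  have hV := L2norm_nonneg L (pd L 1 v)
  have hW := L2norm_nonneg L (pd L 0 w)
  have hW₂ := L2norm_nonneg L (pd L 1 w)
  have hl₁ := L2line_nonneg 0 (pd L 0 v)
  have hl₂ := L2line_nonneg L (pd L 0 v)
  have hl₃ := L2line_nonneg L (pd L 1 v)
  have hfF := L2norm_nonneg L (fun x => (G x.1 + p₂₂ x) * f₁ x)
  have hf2n := L2norm_nonneg L f₂
  have hf1n := L2norm_nonneg L f₁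
  -- The zeroth-order term in `w` is converted to ∂₁w by the Poincaré inequality, which accounts for
  -- the 2L in `D`.
  have hclose := coupled_closure hβ hμ hk hD0 (by positivity : 0 ≤ 2 * L) hB₃ hεβ hεμ hεk hsmall
    hX hV hW hW₂ hl₁ hl₂ hl₃ hfF hf2n (by
      have h1 : B₀ * (L2norm L w * L2norm L (pd L 0 v)) ≤
          B₀ * (2 * L * L2norm L (pd L 0 w) * L2norm L (pd L 0 v)) := by gcongr
      have h2 : D * L2norm L (pd L 0 w) * L2norm L (pd L 0 v) =
          B₁ * (L2norm L (pd L 0 w) * L2norm L (pd L 0 v)) +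
          B₀ * (2 * L * L2norm L (pd L 0 w) * L2norm L (pd L 0 v)) := by rw [hD]; ring
      linarith) hell
  rw [← hK] at hclose
  have hv' := Hnorm_one_le hL hv1
  have hw' := Hnorm_one_le hL hw1
  have hrhs : K * (L2norm L (fun x => (G x.1 + p₂₂ x) * f₁ x) + L2norm L f₂) ≤
      K * (3 * (L2norm L f₁ + L2norm L f₂)) := by
    gcongr
    linarith
  set N := L2line 0 (pd L 0 v) + L2line L (pd L 0 v) + L2line L (pd L 1 v) +
    L2norm L (pd L 0 v) + L2norm L (pd L 1 v) + L2norm L (pd L 0 w) + L2norm L (pd L 1 w) with hN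
  -- The factor 1 + 2L adds the L² norms of `v` and `w` through the Poincaré inequalities `pv` and
  -- `pw`.
  calc _ ≤ (1 + 2 * L) * N := by
        have e1 : 0 ≤ L * (L2line 0 (pd L 0 v) + L2line L (pd L 0 v) + L2line L (pd L 1 v) +
          L2norm L (pd L 1 v) + L2norm L (pd L 1 w)) := by positivity
        rw [hN]
        linarith
    _ ≤ (1 + 2 * L) * (K * (3 * (L2norm L f₁ + L2norm L f₂))) := by
        gcongr
        exact hclose.trans hrhs
    _ = _ := by ring

/-- Flows that stay close to the sonic speed live on short nozzles, with uniform constants in the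
energy estimates. -/
theorem exists_width {γ ζ₀ J S₀ : ℝ} (hγ : 1 < γ) (hζ₀ : 1 < ζ₀) (hJ : 0 < J) (hS₀ : 0 < S₀) :
    ∃ d : ℝ, 0 < d ∧ d < 1 ∧ (1 + d) * us γ J S₀ < uIon γ ζ₀ J S₀ ∧
      ∀ (E₀ ℓ L : ℝ) (u E : ℝ → ℝ), IsBackground γ ζ₀ J S₀ E₀ ℓ u E → 0 < L → L < ℓ →
        (1 - d) * us γ J S₀ ≤ u 0 → u 0 < us γ J S₀ → us γ J S₀ < u L →
        u L ≤ (1 + d) * us γ J S₀ →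
        ∃ δ C : ℝ, 0 < δ ∧ 0 < C ∧ ∀ r₂ r₃ : ℝ, max r₂ r₃ ≤ 2 * δ → ∀ φ ψ Ψ : ℝ × ℝ → ℝ,
          φ ∈ IterV L r₂ → (ψ, Ψ) ∈ IterP L r₃ → ∀ f₁ f₂ v w : ℝ × ℝ → ℝ,
          MemLp f₁ 2 (volume.restrict (Om L)) → MemLp f₂ 2 (volume.restrict (Om L)) →
          IsSolution γ J S₀ L u E φ ψ Ψ f₁ f₂ v w →
          L2line 0 (pd L 0 v) + (L2line L (pd L 0 v) + L2line L (pd L 1 v)) +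
            Hnorm L 1 v + Hnorm L 1 w ≤ C * (L2norm L f₁ + L2norm L f₂) := by
  have hs : 0 < us γ J S₀ := us_pos hγ hJ hS₀
  set s := us γ J S₀ with hs_def
  have hI : uIon γ ζ₀ J S₀ = ζ₀ * s := rfl
  -- The fixed velocity window [s/2, b], with b midway between the sonic and ion speeds, is set
  -- before d. All constants below are taken on it, so choosing d afterwards is not circular.
  obtain ⟨b, hb⟩ : ∃ b, b = (1 + ζ₀) / 2 * s := ⟨_, rfl⟩
  have hsb : s < b := by rw [hb]; nlinarith
  have hbI : b < uIon γ ζ₀ J S₀ := by rw [hb, hI]; nlinarith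
  have hb0 : 0 < b := hs.trans hsb
  obtain ⟨κ, Λ, hκ, hΛ, hκΛ⟩ := exists_acceleration_bounds hγ hζ₀ hJ hS₀ (half_pos hs)
    (half_lt_self hs) hsb hbI
  obtain ⟨_, B₃, _, hB₃, hc⟩ := exists_pos_bounds (a := s / 2) (b := b) (by linarith)
    (f := fun t => t / (γ * S₀ * (J / t) ^ (γ - 2)))
    (by
      have h0 : ∀ t ∈ Icc (s / 2) b, t ≠ 0 := fun t ht => by linarith [ht.1]
      refine continuousOn_id.div (continuousOn_const.mul
        ((continuousOn_const.div continuousOn_id h0).rpow_const fun t ht =>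
          Or.inl (div_ne_zero hJ.ne' (h0 t ht)))) fun t ht => ?_
      have h1 : 0 < t := by linarith [ht.1]
      have := Real.rpow_pos_of_pos (div_pos hJ h1) (γ - 2)
      positivity)
    (fun t ht => by
      have h1 : 0 < t := by linarith [ht.1]
      have := Real.rpow_pos_of_pos (div_pos hJ h1) (γ - 2)
      positivity)
  have hγ1 : 0 < γ - 1 := by linarith
  have hS := Real.rpow_pos_of_pos hs (γ + 1)
  obtain ⟨B₀, hB₀⟩ : ∃ B₀, B₀ = 2 * ((γ - 1) * Λ * b ^ (γ - 1) / s ^ (γ + 1)) := ⟨_, rfl⟩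
  obtain ⟨B₁, hB₁⟩ : ∃ B₁, B₁ = 2 * (b ^ γ / s ^ (γ + 1)) := ⟨_, rfl⟩
  have hB₀0 : 0 ≤ B₀ := by
    have := Real.rpow_pos_of_pos hb0 (γ - 1)
    rw [hB₀]; positivity
  have hB₁0 : 0 ≤ B₁ := by
    have := Real.rpow_pos_of_pos hb0 γ
    rw [hB₁]; positivity
  obtain ⟨Q, hQ⟩ : ∃ Q, Q = (B₁ + 2 * B₀) * 2 * B₃ := ⟨_, rfl⟩
  have hQ0 : 0 ≤ Q := by rw [hQ]; positivity
  set k := κ / (2 * b) with hk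
  have hk0 : 0 < k := by positivity
  -- The bound b/κ is what the multiplier requires; the last entry gives the smallness for the
  -- coupling, whose constant is at most L·Q once L ≤ 1.
  set L₀ := min 1 (min (b / κ) (k / 4 / (Q + 1))) with hL₀
  have hL₀0 : 0 < L₀ := by positivity
  -- The first two entries keep the flow in the window; the third turns κL ≤ u(L) - u(0) ≤ 2ds into
  -- L ≤ L₀.
  set d := min (1 / 2) (min ((ζ₀ - 1) / 4) (L₀ * κ / (2 * s))) with hd
  have hζ : 0 < ζ₀ - 1 := by linarith
  have hd0 : 0 < d := by positivity
  have hd2 : d ≤ 1 / 2 := min_le_left _ _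
  have hdζ : d ≤ (ζ₀ - 1) / 4 := (min_le_right _ _).trans (min_le_left _ _)
  have hdL : d * (2 * s) ≤ L₀ * κ := by
    rw [← le_div_iff₀ (by positivity)]
    exact (min_le_right _ _).trans (min_le_right _ _)
  have hdb : (1 + d) * s ≤ b := by rw [hb]; nlinarith
  refine ⟨d, hd0, by linarith, hdb.trans_lt hbI, ?_⟩
  intro E₀ ℓ L u E h hL hLℓ h1 h2 h3 h4
  have hsub : Icc 0 L ⊆ Ico 0 ℓ := fun x hx => ⟨hx.1, hx.2.trans_lt hLℓ⟩
  have hmem : ∀ x ∈ Icc 0 L, u x ∈ Icc (s / 2) b := fun x hx => by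
    have m0 : u 0 ≤ u x := h.strictMonoOn_u.monotoneOn (hsub ⟨le_rfl, hL.le⟩) (hsub hx) hx.1
    have m1 : u x ≤ u L := h.strictMonoOn_u.monotoneOn (hsub hx) (hsub ⟨hL.le, le_rfl⟩) hx.2
    exact ⟨by nlinarith, by linarith⟩
  have hκΛ' := fun x (hx : x ∈ Icc 0 L) => hκΛ E₀ ℓ u E h x (hsub hx) (hmem x hx)
  have hLL : L ≤ L₀ := by
    have hmv := (convex_Icc 0 L).mul_sub_le_image_sub_of_le_deriv (f := u) (C := κ)
      (h.smooth_u.continuousOn.mono hsub) (fun x hx => by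
        rw [interior_Icc] at hx
        exact (h.hasDerivAt_u ⟨hx.1, hx.2.trans hLℓ⟩).differentiableAt.differentiableWithinAt)
      (fun x hx => by
        rw [interior_Icc] at hx
        rw [(h.hasDerivAt_u ⟨hx.1, hx.2.trans hLℓ⟩).deriv]
        exact (hκΛ' x (Ioo_subset_Icc_self hx)).1) 0 ⟨le_rfl, hL.le⟩ L ⟨hL.le, le_rfl⟩ hL.le
    refine le_of_mul_le_mul_left ?_ hκ
    nlinarith
  have hL1 : L ≤ 1 := hLL.trans (min_le_left _ _)
  have hL2 : L ≤ b / κ := hLL.trans ((min_le_right _ _).trans (min_le_left _ _))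
  have hL3 : L * (Q + 1) ≤ k / 4 := by
    rw [← le_div_iff₀ (by positivity)]
    exact hLL.trans ((min_le_right _ _).trans (min_le_right _ _))
  obtain ⟨β, hβ, P, P', G, T, T', m⟩ := h.exists_multiplier hγ hJ hS₀ hL hLℓ h2 h3
    (h4.trans hdb) hκ hκΛ' hL2
  refine h.a_priori_estimate hγ hJ hS₀ hL hLℓ m hβ (by positivity) hk0 ?_ ?_ hB₃.le
    (fun x hx => (hc (u x) (hmem x hx)).2) ?_
  · rw [← hs_def, ← hB₀]; exact hB₀0
  · rw [← hs_def, ← hB₁]; exact hB₁0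
  · rw [← hs_def, ← hB₀, ← hB₁]
    calc (B₁ + B₀ * (2 * L)) * (2 * L) * B₃ ≤ (B₁ + B₀ * (2 * 1)) * (2 * L) * B₃ := by gcongr
      _ = L * Q := by rw [hQ]; ring
      _ ≤ L * (Q + 1) := by nlinarith
      _ ≤ k / 4 := hL3

end EP

/-- The preceding argument applies to every J > 0, so the thresholds 1/2 and 2 are arbitrary. -/
theorem mainTheorem4 (γ ζ₀ S₀ : ℝ) (hγ : 1 < γ) (hζ₀ : 1 < ζ₀) (hS₀ : 0 < S₀) :
    ∃ Jlow Jhigh : ℝ, 0 < Jlow ∧ Jlow < 1 ∧ 1 < Jhigh ∧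
      ∀ J : ℝ, (0 < J ∧ J ≤ Jlow) ∨ Jhigh ≤ J →
        ∃ d : ℝ, 0 < d ∧ d < 1 ∧
          ∀ E₀ L : ℝ, E₀ < 0 → 0 < L →
            ∃ δ C : ℝ, 0 < δ ∧ 0 < C ∧
              ∀ (ℓ : ℝ) (u E : ℝ → ℝ), EP.IsBackground γ ζ₀ J S₀ E₀ ℓ u E → L < ℓ →
                1 - d ≤ u 0 / EP.us γ J S₀ → u 0 / EP.us γ J S₀ < 1 →
                1 < u L / EP.us γ J S₀ → u L / EP.us γ J S₀ ≤ 1 + d →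
                ∀ r₂ r₃ : ℝ, 0 < r₂ → 0 < r₃ → max r₂ r₃ ≤ 2 * δ →
                  ∀ φ ψ Ψ : ℝ × ℝ → ℝ, φ ∈ EP.IterV L r₂ → (ψ, Ψ) ∈ EP.IterP L r₃ →
                    ∀ f₁ f₂ v w : ℝ × ℝ → ℝ,
                      MeasureTheory.MemLp f₁ 2 (MeasureTheory.volume.restrict (EP.Om L)) →
                      MeasureTheory.MemLp f₂ 2 (MeasureTheory.volume.restrict (EP.Om L)) →
                      EP.IsSolution γ J S₀ L u E φ ψ Ψ f₁ f₂ v w →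
                      EP.L2line 0 (EP.pd L 0 v) +
                          (EP.L2line L (EP.pd L 0 v) + EP.L2line L (EP.pd L 1 v)) +
                          EP.Hnorm L 1 v + EP.Hnorm L 1 w ≤
                        C * (EP.L2norm L f₁ + EP.L2norm L f₂) := by
  refine ⟨1 / 2, 2, by norm_num, by norm_num, by norm_num, fun J hJJ => ?_⟩
  have hJ : 0 < J := hJJ.elim And.left fun h => by linarith
  have hs := EP.us_pos hγ hJ hS₀
  obtain ⟨d, hd0, hd1, hdI, hest⟩ := EP.exists_width hγ hζ₀ hJ hS₀
  refine ⟨d, hd0, hd1, fun E₀ L _ hL => ?_⟩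
  -- The constants must be fixed before the flow. Take those of one admissible flow, if any exists;
  -- any other agrees with it on [0, L] by uniqueness, and its solutions transfer. If none exists,
  -- the claim is vacuous.
  by_cases hex : ∃ (ℓ : ℝ) (u E : ℝ → ℝ), EP.IsBackground γ ζ₀ J S₀ E₀ ℓ u E ∧ L < ℓ ∧
      1 - d ≤ u 0 / EP.us γ J S₀ ∧ u 0 / EP.us γ J S₀ < 1 ∧
      1 < u L / EP.us γ J S₀ ∧ u L / EP.us γ J S₀ ≤ 1 + d
  · obtain ⟨ℓ, u, E, h, hLℓ, h1, h2, h3, h4⟩ := hex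
    rw [le_div_iff₀ hs] at h1
    rw [div_lt_one hs] at h2
    rw [one_lt_div hs] at h3
    rw [div_le_iff₀ hs] at h4
    obtain ⟨δ, C, hδ, hC, hfin⟩ := hest E₀ ℓ L u E h hL hLℓ h1 h2 h3 h4
    refine ⟨δ, C, hδ, hC, ?_⟩
    intro ℓ' u' E' h' hLℓ' _ _ _ h4' r₂ r₃ _ _ hr φ ψ Ψ hφ hP f₁ f₂ v w hf₁ hf₂ hsol
    rw [div_le_iff₀ hs] at h4'
    have huE := h'.unique h hγ hζ₀ hJ hS₀ hLℓ' hLℓ (h4'.trans_lt hdI) (h4.trans_lt hdI)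
    exact hfin r₂ r₃ hr φ ψ Ψ hφ hP f₁ f₂ v w hf₁ hf₂ (hsol.congr_background hL huE)
  · refine ⟨1, 1, one_pos, one_pos, ?_⟩
    intro ℓ u E h hLℓ h1 h2 h3 h4
    exact absurd ⟨ℓ, u, E, h, hLℓ, h1, h2, h3, h4⟩ hex
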